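/- **Setting.** Let $d\ge 2$, $\mathcal X=[-1,1]^d$, and consider the model $Y=F[\mu+m(X)]+U$ with $m(x)=m_1(x^1)+\dots+m_d(x^d)$, where $F:\mathbb R\to\mathbb R$ is a known nondecreasing function, $\mu\in\mathbb R$ and $\int_{-1}^1 m_j(v)\,dv=0$ for each $j$. Let $p_1,p_2,\dots$ be measurable functions on $[-1,1]$, put $d(\kappa)=\kappa d+1$, $P_\kappa(x)=[1,p_1(x^1),\dots,p_\kappa(x^1),\dots,p_1(x^d),\dots,p_\kappa(x^d)]'$, $\zeta_\kappa=\sup_{x\in\mathcal X}\|P_\kappa(x)\|$ (Euclidean norm), $\theta_{jk}=\int_{-1}^1 m_jp_k$, $\theta_\kappa=(\mu,\theta_{11},\dots,\theta_{1\kappa},\dots,\theta_{d1},\dots,\theta_{d\kappa})'$, $\Theta_\kappa=[-C_\theta,C_\theta]^{d(\kappa)}$, $V(X)=\operatorname{Var}(U\mid X)$, $$Q_\kappa=\mathbf E\{F'[\mu+m(X)]^2P_\kappa(X)P_\kappa(X)'\},\qquad \Psi_\kappa=Q_\kappa^{-1}\mathbf E\{F'[\mu+m(X)]^2V(X)P_\kappa(X)P_\kappa(X)'\}Q_\kappa^{-1}.$$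 **Assumptions.** A1. $(Y_i,X_i)$, $i=1,2,\dots$, are i.i.d. copies of $(Y,X)$, and $\mathbf E(Y\mid X)=F[\mu+m(X)]$ almost surely. A2. (i) The support of $X$ is $\mathcal X$. (ii) The law of $X$ is absolutely continuous with respect to Lebesgue measure. (iii) Its density is bounded, bounded away from zero and twice continuously differentiable on $\mathcal X$. (iv) There are $c_V>0$, $C_V<\infty$ with $c_V\le \operatorname{Var}(U\mid X)\le C_V$ almost surely. (v) There is $C_U<\infty$ with $\mathbf E|U|^j\le C_U^{j-2}j!\,\mathbf E(U^2)<\infty$ for all integers $j\ge2$. A3. There is $C_m<\infty$ such that, with $I=[\mu-C_md,\mu+C_md]$: (i) $|m_j(v)|<C_m$ for all $j$ and $v\in[-1,1]$; (ii) each $m_j$ is twice continuously differentiable on $[-1,1]$; (iii) there are $C_{F1}<\infty$, $c_{F2}>0$, $C_{F2}<\infty$ with $F(v)\le C_{F1}$ and $c_{F2}\le F'(v)\le C_{F2}$ for $v\in I$; (iv) $F$ is twice continuously differentiable on $I$; (v) $F''$ is Lipschitz on $I$. A4. (i) There are $C_Q<\infty$, $c_\lambda>0$ such that, for all $\kappa\ge1$,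 all entries of $Q_\kappa$ are bounded by $C_Q$ in absolute value and the smallest eigenvalue of $Q_\kappa$ exceeds $c_\lambda$. (ii) The largest eigenvalue of $\Psi_\kappa$ is bounded over all $\kappa\ge1$. A5. (i) $\int_{-1}^1p_k=0$ and $\int_{-1}^1p_jp_k=\mathbf 1\{j=k\}$ for all $j,k$. (ii) There is $c>0$ with $\zeta_\kappa\ge c$ for all large $\kappa$. (iii) $\zeta_\kappa=O(\kappa^{1/2})$. (iv) $\theta_{\kappa0}\in\Theta_\kappa$ are vectors such that $b_{\kappa0}(x)=\mu+m(x)-P_\kappa(x)'\theta_{\kappa0}$ satisfies $\sup_{x\in\mathcal X}|b_{\kappa0}(x)|=O(\kappa^{-2})$ as $\kappa\to\infty$. (v) $\theta_\kappa$ is an interior point of $\Theta_\kappa$ for each $\kappa\ge1$. A6(i). $\kappa=\kappa_n$ are integers with $\kappa_n/n^{4/15+\nu}\to C_\kappa$ for some $0<C_\kappa<\infty$ and $0<\nu<1/30$. **Theorem.** Let A1–A6(i) hold, and let $\hat\theta_{n\kappa}$ be a minimizer of $n^{-1}\sum_{i=1}^n\{Y_i-F[P_\kappa(X_i)'\theta]\}^2$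 over $\theta\in\Theta_\kappa$, where $\kappa=\kappa_n$. Write $\tilde m(x)$ for $P_\kappa(x)'\hat\theta_{n\kappa}$ without its constant term, and $U_i=Y_i-F[\mu+m(X_i)]$. Then, as $n\to\infty$: (a) $\|\hat\theta_{n\kappa}-\theta_{\kappa0}\|\to0$ almost surely; (b) $\|\hat\theta_{n\kappa}-\theta_{\kappa0}\|=O_p(\kappa^{1/2}/n^{1/2}+\kappa^{-2})$; (c) $\sup_{x\in\mathcal X}|\tilde m(x)-m(x)|=O_p(\kappa/n^{1/2}+\kappa^{-3/2})$; (d) $$\hat\theta_{n\kappa}-\theta_{\kappa0}=n^{-1}Q_\kappa^{-1}\sum_{i=1}^nF'[\mu+m(X_i)]P_\kappa(X_i)U_i+n^{-1}Q_\kappa^{-1}\sum_{i=1}^nF'[\mu+m(X_i)]^2P_\kappa(X_i)b_{\kappa0}(X_i)+R_n,$$ where $\|R_n\|=O_p(\kappa^{3/2}/n+n^{-1/2})$. -/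

import Mathlib

open MeasureTheory ProbabilityTheory Filter Topology
open scoped ENNReal NNReal Nat

noncomputable section

namespace SeriesLS

/-- The cube `[-1, 1]^d`. -/
def cube (d : ℕ) : Set (Fin d → ℝ) := {x | ∀ j, x j ∈ Set.Icc (-1 : ℝ) 1}

/-- Index set of the `d(κ) = κ d + 1` coordinates: `none` is the constant term and `some (j, k)` is
the coefficient of the `k`-th basis function of the `j`-th covariate. -/
abbrev Idx (d κ : ℕ) : Type := Option (Fin d × Fin κ)

/-- The coefficient space `ℝ^{d(κ)}` with its Euclidean norm. -/
abbrev Coef (d κ : ℕ) : Type := EuclideanSpace ℝ (Idx d κ)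

/-- The objects of the model: the known function `F`, the constant `μ`, the additive components
`m_1, …, m_d`, the basis functions (`p k` is the `(k+1)`-st basis function, `k = 0, 1, …`),
and the joint distribution `law` of `(X, Y)`. -/
structure Model (d : ℕ) where
  F : ℝ → ℝ
  mu : ℝ
  m : Fin d → ℝ → ℝ
  p : ℕ → ℝ → ℝ
  law : Measure ((Fin d → ℝ) × ℝ)

namespace Model

variable {d : ℕ} (M : Model d)

/-- `m(x) = m_1(x^1) + ⋯ + m_d(x^d)`. -/
def mSum (x : Fin d → ℝ) : ℝ := ∑ j, M.m j (x j)

/-- The disturbance `U = Y - F[μ + m(X)]`, as a function of the value `z = (x, y)` of `(X, Y)`. -/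
def U (z : (Fin d → ℝ) × ℝ) : ℝ := z.2 - M.F (M.mu + M.mSum z.1)

/-- `F'[μ + m(x)]`. -/
def dF (x : Fin d → ℝ) : ℝ := deriv M.F (M.mu + M.mSum x)

/-- The σ-algebra generated by the covariate vector `X`. -/
abbrev sigmaX (d : ℕ) : MeasurableSpace ((Fin d → ℝ) × ℝ) :=
  MeasurableSpace.comap Prod.fst inferInstance

/-- `Var(U | X)`. -/
def condVarU : (Fin d → ℝ) × ℝ → ℝ := condVar (sigmaX d) M.U M.law

/-- `P_κ(x)`. -/
def P (κ : ℕ) (x : Fin d → ℝ) : Coef d κ :=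
  WithLp.toLp 2 (fun i => match i with
    | none => 1
    | some (j, k) => M.p k (x j))

/-- `ζ_κ = sup_{x ∈ [-1,1]^d} ‖P_κ(x)‖`, with the value `∞` if the norms are unbounded. -/
def zeta (κ : ℕ) : ℝ≥0∞ := ⨆ x ∈ cube d, ‖M.P κ x‖ₑ

/-- `Q_κ = E{F'[μ + m(X)]² P_κ(X) P_κ(X)'}`. -/
def Q (κ : ℕ) : Matrix (Idx d κ) (Idx d κ) ℝ :=
  Matrix.of fun a b => ∫ z, M.dF z.1 ^ 2 * (M.P κ z.1 a * M.P κ z.1 b) ∂M.law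

/-- `Ψ_κ = Q_κ⁻¹ E{F'[μ + m(X)]² V(X) P_κ(X) P_κ(X)'} Q_κ⁻¹`. -/
def Psi (κ : ℕ) : Matrix (Idx d κ) (Idx d κ) ℝ :=
  (M.Q κ)⁻¹ *
    (Matrix.of fun a b =>
      ∫ z, M.dF z.1 ^ 2 * M.condVarU z * (M.P κ z.1 a * M.P κ z.1 b) ∂M.law) *
    (M.Q κ)⁻¹

/-- The coefficient vector `θ_κ = (μ, θ_{11}, …, θ_{dκ})'`, where `θ_{jk} = ∫_{-1}^1 m_j p_k` are the
coefficients of `m_j` in the orthonormal system `(p_k)`. -/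
def thetaSeries (κ : ℕ) : Coef d κ :=
  WithLp.toLp 2 (fun i => match i with
    | none => M.mu
    | some (j, k) => ∫ v in (-1 : ℝ)..1, M.m j v * M.p k v)

/-- `b_θ(x) = μ + m(x) - P_κ(x)'θ`. -/
def bias (κ : ℕ) (θ : Coef d κ) (x : Fin d → ℝ) : ℝ :=
  M.mu + M.mSum x - inner ℝ (M.P κ x) θ

/-- The additive part of the series with coefficients `θ`, that is `P_κ(x)'θ` without its
constant term. -/
def mTilde (κ : ℕ) (θ : Coef d κ) (x : Fin d → ℝ) : ℝ :=
  ∑ j : Fin d, ∑ k : Fin κ, M.p k (x j) * θ (some (j, k))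

/-- The least-squares criterion
`S_{nκ}(θ) = n⁻¹ ∑_{i < n} {Y_i - F[P_κ(X_i)'θ]}²` for the sample `z 0, …, z (n-1)`. -/
def S (n κ : ℕ) (z : ℕ → (Fin d → ℝ) × ℝ) (θ : Coef d κ) : ℝ :=
  (n : ℝ)⁻¹ * ∑ i ∈ Finset.range n, ((z i).2 - M.F (inner ℝ (M.P κ (z i).1) θ)) ^ 2

end Model

/-- The parameter set `Θ_κ = [-C_θ, C_θ]^{d(κ)}`. -/
def Theta (d κ : ℕ) (Cθ : ℝ) : Set (Coef d κ) := {θ | ∀ i, θ i ∈ Set.Icc (-Cθ) Cθ}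

/-- The sequence `Z 0, Z 1, …` is i.i.d. with the distribution of `(X, Y)`, and
`E(Y | X) = F[μ + m(X)]` almost surely. -/
structure AssumptionA1 {d : ℕ} (M : Model d) {Ω : Type*} [MeasurableSpace Ω] (Pr : Measure Ω)
    (Z : ℕ → Ω → (Fin d → ℝ) × ℝ) : Prop where
  measurable : ∀ i, Measurable (Z i)
  indep : iIndepFun Z Pr
  law_eq : ∀ i, Pr.map (Z i) = M.law
  integrable : Integrable (fun z => z.2) M.law
  cond_mean : condExp (Model.sigmaX d) M.law (fun z => z.2)
    =ᵐ[M.law] fun z => M.F (M.mu + M.mSum z.1)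

/-- Conditions on the distribution of the covariates and of the disturbance. -/
structure AssumptionA2 {d : ℕ} (M : Model d) : Prop where
  support : (M.law.map Prod.fst).support = cube d
  abs_cont : M.law.map Prod.fst ≪ volume
  density : ∃ f : (Fin d → ℝ) → ℝ,
    M.law.map Prod.fst = (volume.restrict (cube d)).withDensity (fun x => ENNReal.ofReal (f x)) ∧
    (∃ c C : ℝ, 0 < c ∧ ∀ x ∈ cube d, c ≤ f x ∧ f x ≤ C) ∧
    ContDiffOn ℝ 2 f (cube d)
  cond_var : ∃ cV CV : ℝ, 0 < cV ∧ ∀ᵐ z ∂M.law, cV ≤ M.condVarU z ∧ M.condVarU z ≤ CV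
  moments : ∃ CU : ℝ, ∀ j : ℕ, 2 ≤ j →
    Integrable (fun z => |M.U z| ^ j) M.law ∧
    ∫ z, |M.U z| ^ j ∂M.law ≤ CU ^ (j - 2) * (j ! : ℝ) * ∫ z, M.U z ^ 2 ∂M.law

/-- Conditions on the additive components and on `F`, with the normalization `∫ m_j = 0`. The
derivatives of `F` on the closed interval are one-sided at its end points. -/
structure AssumptionA3 {d : ℕ} (M : Model d) : Prop where
  normalized : ∀ j, ∫ v in (-1 : ℝ)..1, M.m j v = 0
  smooth : ∀ j, ContDiffOn ℝ 2 (M.m j) (Set.Icc (-1) 1)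
  monotone : Monotone M.F
  bounds : ∃ Cm : ℝ, ∃ I : Set ℝ, I = Set.Icc (M.mu - Cm * d) (M.mu + Cm * d) ∧
    (∀ j, ∀ v ∈ Set.Icc (-1 : ℝ) 1, |M.m j v| < Cm) ∧
    (∃ CF1 cF2 CF2 : ℝ, 0 < cF2 ∧
      ∀ v ∈ I, M.F v ≤ CF1 ∧ cF2 ≤ derivWithin M.F I v ∧ derivWithin M.F I v ≤ CF2) ∧
    ContDiffOn ℝ 2 M.F I ∧
    (∃ CF3 : ℝ, ∀ v₁ ∈ I, ∀ v₂ ∈ I,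
      |iteratedDerivWithin 2 M.F I v₂ - iteratedDerivWithin 2 M.F I v₁| ≤ CF3 * |v₂ - v₁|)

/-- Conditions on `Q_κ` and `Ψ_κ`. -/
structure AssumptionA4 {d : ℕ} (M : Model d) : Prop where
  Q_bounds : ∃ CQ cl : ℝ, 0 < cl ∧ ∀ κ : ℕ, 1 ≤ κ →
    (∀ a b, |M.Q κ a b| ≤ CQ) ∧
    (∀ l : ℝ, Module.End.HasEigenvalue (Matrix.toLin' (M.Q κ)) l → cl < l)
  Psi_bound : ∃ C : ℝ, ∀ κ : ℕ, 1 ≤ κ →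
    ∀ l : ℝ, Module.End.HasEigenvalue (Matrix.toLin' (M.Psi κ)) l → l ≤ C

/-- Conditions on the basis functions and on the approximating coefficient vectors
`θ0 κ` (`θ_{κ0}` on paper). -/
structure AssumptionA5 {d : ℕ} (M : Model d) (Cθ : ℝ) (θ0 : ∀ κ : ℕ, Coef d κ) : Prop where
  measurable : ∀ k, Measurable (M.p k)
  mean_zero : ∀ k, ∫ v in (-1 : ℝ)..1, M.p k v = 0
  orthonormal : ∀ j k, ∫ v in (-1 : ℝ)..1, M.p j v * M.p k v = if j = k then 1 else 0
  zeta_lower : ∃ c : ℝ≥0, 0 < c ∧ ∀ᶠ κ : ℕ in atTop, (c : ℝ≥0∞) ≤ M.zeta κ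
  zeta_upper : ∃ C : ℝ≥0, ∀ᶠ κ : ℕ in atTop,
    M.zeta κ ≤ C * ENNReal.ofReal ((κ : ℝ) ^ (1 / 2 : ℝ))
  approx_mem : ∀ κ, 1 ≤ κ → θ0 κ ∈ Theta d κ Cθ
  approx : ∃ C : ℝ, ∀ᶠ κ : ℕ in atTop, ∀ x ∈ cube d,
    |M.bias κ (θ0 κ) x| ≤ C * (κ : ℝ) ^ (-2 : ℝ)
  interior : ∀ κ, 1 ≤ κ → M.thetaSeries κ ∈ interior (Theta d κ Cθ)

/-- The integers `κ n` grow like `C_κ n^{4/15+ν}` with `0 < C_κ` and `0 < ν < 1/30`. -/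
def AssumptionA6i (κ : ℕ → ℕ) : Prop :=
  ∃ Cκ ν : ℝ, 0 < Cκ ∧ 0 < ν ∧ ν < 1 / 30 ∧
    Tendsto (fun n : ℕ => (κ n : ℝ) / (n : ℝ) ^ (4 / 15 + ν)) atTop (𝓝 Cκ)

/-- `ξ n = O_p(r n)`: for every `ε > 0` there is a finite `C` such that
`Pr(ξ n > C r n) ≤ ε` for all sufficiently large `n`. -/
def IsBigOp {Ω : Type*} [MeasurableSpace Ω] (Pr : Measure Ω) (ξ : ℕ → Ω → ℝ≥0∞) (r : ℕ → ℝ) :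
    Prop :=
  ∀ ε : ℝ≥0∞, 0 < ε → ∃ C : ℝ≥0, ∀ᶠ n in atTop,
    Pr {ω | C * ENNReal.ofReal (r n) < ξ n ω} ≤ ε

end SeriesLS

end

/-! The growth condition gives n^{4/15} ≲ κ ≲ n^{3/10}. So the bias κ^{-2} is of smaller order than
n^{-1/2}, and κ³/n tends to zero. All orders are expressed through y = √κ, the size of the regressor
vector, and x = √(κ/n), the stochastic rate. Write D = ‖θhat - θ0‖.

Consistency is the delicate point: away from the range of μ + m the function F is only known to be
monotone, and Θ_κ allows indices far outside that range. After the responses are used to clip F, the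
basic inequality of least squares bounds the truncated empirical distance between fitted and true
index by noise sums Σ U_i G(P_κ(X_i)'θ) with G bounded and monotone (`sum_min_sq_le_of_basic_ineq`).
By the layer-cake formula such sums are averages of sums of U_i over half-spaces {q < P_κ(x)'θ}.
Half-spaces cut at most (2(n+1))^{d(κ)+1} subsets out of n points (Radon and Sauer–Shelah,
`card_cutSets_le`). The subsets depend on the covariates only, so given the covariates a Chernoff
bound applies to each of them; hence all half-space sums are at most n^{67/100}
(`whp_noiseBounded`). With a lower bound for the empirical Gram matrix (`whp_gramBounded`) this
yields D² = O(n^{-32/100}). The exceptional probabilities are summable, so Borel–Cantelli gives (a),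
and even √κ D → 0 almost surely and in probability (`whp_sqrt_mul_norm_le`).

Because √κ D → 0, all fitted indices lie in the region where F is smooth. The series coefficients
keep a uniform distance from the boundary of Θ_κ (`exists_thetaSeries_margin`), so the minimizer is
interior and the normal equations hold. A Taylor expansion turns them into Q_κ(θhat - θ0) = score +
bias score + remainder, the remainder being O(yxD + yx² + (yD + x)(D + x))
(`linearization_of_isMinOn`). Since yx and yD are small and Q_κ is uniformly coercive, the terms
containing D are absorbed on the left: first D = O(x), which is (b), and then the remainder is
O(yx²) = O(κ^{3/2}/n), which is (d) (`rate_of_linearization`, `exists_likely_rate`). For (c),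
passing from coefficients to the supremum norm costs the factor sup ‖P_κ‖ = O(√κ). -/

noncomputable section

namespace SeriesLS

/-! ### Combinatorics of half-spaces: VC dimension and the number of cut-out sets. -/

section Halfspaces

variable {V : Type*} [NormedAddCommGroup V] [InnerProductSpace ℝ V] [FiniteDimensional ℝ V]

/-- The index set `J` is cut out of the finite family `p` by an open half-space. -/
def CutOut {n : ℕ} (p : Fin n → V) (J : Finset (Fin n)) : Prop :=
  ∃ θ : V, ∃ q : ℝ, ∀ i, i ∈ J ↔ q < inner ℝ (p i) θ

open Classical in
/-- The family of all index sets cut out of `p` by open half-spaces. -/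
def cutSets {n : ℕ} (p : Fin n → V) : Finset (Finset (Fin n)) :=
  Finset.univ.filter fun J => CutOut p J

/-- Radon's theorem: more than dim V + 1 points split into two classes whose convex hulls meet.
Cutting out one class would put the common point in an open half-space and in its complement, both
of which are convex. -/
lemma card_le_of_shatters_cutSets {n : ℕ} (p : Fin n → V) (s : Finset (Fin n))
    (hs : (cutSets p).Shatters s) : s.card ≤ Module.finrank ℝ V + 1 := by
  by_contra! hcard
  have hdep : ¬ AffineIndependent ℝ (fun i : s => p i) := by
    intro h
    have h1 := h.card_le_finrank_succ
    have h2 := Submodule.finrank_le (vectorSpan ℝ (Set.range fun i : s => p i))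
    simp only [Fintype.card_coe] at h1
    omega
  obtain ⟨I, x, hx1, hx2⟩ := Convex.radon_partition hdep
  classical
  obtain ⟨u, hu, hsu⟩ := hs (t := (Finset.univ.filter fun i : s => i ∈ I).map
    (Function.Embedding.subtype _)) (by intro i hi; simp at hi; exact hi.1)
  simp only [cutSets, Finset.mem_filter, Finset.mem_univ, true_and] at hu
  obtain ⟨θ, q, hq⟩ := hu
  have key : ∀ i : s, (i ∈ I ↔ q < inner ℝ (p i) θ) := by
    intro i
    rw [← hq]
    have := Finset.ext_iff.1 hsu i
    simp at this
    exact this.symm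
  have hc1 : Convex ℝ {y : V | q < inner ℝ y θ} := by
    have := convex_halfSpace_gt (𝕜 := ℝ) (f := fun y : V => inner ℝ y θ)
      ⟨fun a b => inner_add_left a b θ, fun c a => by simp [inner_smul_left]⟩ q
    exact this
  have hc2 : Convex ℝ {y : V | inner ℝ y θ ≤ q} := by
    have := convex_halfSpace_le (𝕜 := ℝ) (f := fun y : V => inner ℝ y θ)
      ⟨fun a b => inner_add_left a b θ, fun c a => by simp [inner_smul_left]⟩ q
    exact this
  have h1 := convexHull_min (s := (fun i : s => p i) '' I) (by
    rintro _ ⟨i, hi, rfl⟩; exact (key i).1 hi) hc1 hx1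
  have h2 := convexHull_min (s := (fun i : s => p i) '' Iᶜ) (by
    rintro _ ⟨i, hi, rfl⟩; exact not_lt.1 (fun h => hi ((key i).2 h))) hc2 hx2
  exact (not_lt.2 (show inner ℝ x θ ≤ q from h2)) h1

/-- Sauer–Shelah, with every binomial coefficient crudely bounded by (n + 1)^(dim V + 1). -/
lemma card_cutSets_le {n : ℕ} (p : Fin n → V) :
    (cutSets p).card ≤ (2 * (n + 1)) ^ (Module.finrank ℝ V + 1) := by
  have hvc : (cutSets p).vcDim ≤ Module.finrank ℝ V + 1 := by
    refine Finset.sup_le fun s hs => ?_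
    exact card_le_of_shatters_cutSets p s (Finset.mem_shatterer.1 hs)
  calc (cutSets p).card ≤ (cutSets p).shatterer.card := Finset.card_le_card_shatterer _
    _ ≤ ∑ k ∈ Finset.Iic (cutSets p).vcDim, (Fintype.card (Fin n)).choose k :=
        Finset.card_shatterer_le_sum_vcDim
    _ ≤ ∑ k ∈ Finset.Iic (Module.finrank ℝ V + 1), (Fintype.card (Fin n)).choose k :=
        Finset.sum_le_sum_of_subset (Finset.Iic_subset_Iic.2 hvc)
    _ ≤ ∑ k ∈ Finset.Iic (Module.finrank ℝ V + 1), (n + 1) ^ (Module.finrank ℝ V + 1) := by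
        refine Finset.sum_le_sum fun k hk => ?_
        rw [Fintype.card_fin]
        calc n.choose k ≤ n ^ k := Nat.choose_le_pow _ _
          _ ≤ (n + 1) ^ k := Nat.pow_le_pow_left (by omega) _
          _ ≤ _ := Nat.pow_le_pow_right (by omega) (Finset.mem_Iic.1 hk)
    _ = (Module.finrank ℝ V + 1 + 1) * (n + 1) ^ (Module.finrank ℝ V + 1) := by
        simp
    _ ≤ 2 ^ (Module.finrank ℝ V + 1) * (n + 1) ^ (Module.finrank ℝ V + 1) :=
        Nat.mul_le_mul_right _ (Nat.lt_two_pow_self (n := Module.finrank ℝ V + 1))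
    _ = _ := (mul_pow _ _ _).symm

/-- The union over all (θ, q) is uncountable, but the pairs that separate strictly form an open set,
so a countable dense sequence of pairs suffices. -/
lemma measurableSet_cutOut {E : Type*} [MeasurableSpace E] [MeasurableSpace V] [BorelSpace V]
    {n : ℕ} {P : E → V} (hP : Measurable P) (J : Finset (Fin n)) :
    MeasurableSet {x : Fin n → E | CutOut (fun i => P (x i)) J} := by
  have heq : {x : Fin n → E | CutOut (fun i => P (x i)) J} =
      ⋃ m : ℕ, {x : Fin n → E | ∀ i,
        (i ∈ J → (TopologicalSpace.denseSeq (V × ℝ) m).2 <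
          inner ℝ (P (x i)) (TopologicalSpace.denseSeq (V × ℝ) m).1) ∧
        (i ∉ J → inner ℝ (P (x i)) (TopologicalSpace.denseSeq (V × ℝ) m).1 <
          (TopologicalSpace.denseSeq (V × ℝ) m).2)} := by
    ext x
    simp only [Set.mem_ofPred_eq, Set.mem_iUnion]
    constructor
    · rintro ⟨θ, q, hq⟩
      have hopen : IsOpen {a : V × ℝ | ∀ i, (i ∈ J → a.2 < inner ℝ (P (x i)) a.1) ∧
          (i ∉ J → inner ℝ (P (x i)) a.1 < a.2)} := by
        simp only [Set.ofPred_forall, Set.ofPred_and]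
        refine isOpen_iInter_of_finite fun i => IsOpen.inter ?_ ?_
        · refine isOpen_iInter_of_finite fun _ => isOpen_lt (by fun_prop) (by fun_prop)
        · refine isOpen_iInter_of_finite fun _ => isOpen_lt (by fun_prop) (by fun_prop)
      -- Raising the threshold slightly makes the inequalities off `J` strict too, while the
      -- finitely many strict ones on `J` survive.
      obtain ⟨q', hq1, hq2⟩ : ∃ q', q < q' ∧ ∀ i ∈ J, q' < inner ℝ (P (x i)) θ := by
        have : ∀ᶠ q' in 𝓝[>] q, ∀ i ∈ J, q' < inner ℝ (P (x i)) θ := by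
          rw [Finset.eventually_all]
          intro i hi
          exact nhdsWithin_le_nhds (eventually_lt_nhds ((hq i).1 hi))
        obtain ⟨q', h1, h2⟩ := (this.and self_mem_nhdsWithin).exists
        exact ⟨q', h2, h1⟩
      have hne : ({a : V × ℝ | ∀ i, (i ∈ J → a.2 < inner ℝ (P (x i)) a.1) ∧
          (i ∉ J → inner ℝ (P (x i)) a.1 < a.2)}).Nonempty :=
        ⟨(θ, q'), fun i => ⟨fun hi => hq2 i hi, fun hi =>
          lt_of_le_of_lt (not_lt.1 fun h => hi ((hq i).2 h)) hq1⟩⟩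
      obtain ⟨m, ha⟩ :=
        (TopologicalSpace.denseRange_denseSeq (V × ℝ)).exists_mem_open hopen hne
      exact ⟨m, ha⟩
    · rintro ⟨m, hm⟩
      exact ⟨_, _, fun i => ⟨fun hi => (hm i).1 hi, fun h => by
        by_contra hi
        exact absurd ((hm i).2 hi) (not_lt.2 h.le)⟩⟩
  rw [heq]
  refine MeasurableSet.iUnion fun m => ?_
  simp only [Set.ofPred_forall, Set.ofPred_and]
  refine MeasurableSet.iInter fun i => MeasurableSet.inter ?_ ?_
  · refine MeasurableSet.iInter fun _ => measurableSet_lt measurable_const ?_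
    exact (hP.comp (measurable_pi_apply i)).inner_const
  · refine MeasurableSet.iInter fun _ => measurableSet_lt ?_ measurable_const
    exact (hP.comp (measurable_pi_apply i)).inner_const

end Halfspaces

/-! ### Exponential bounds, uniform over half-spaces, for noise that is conditionally centred. -/

section Chernoff

variable {E 𝒴 : Type*} [MeasurableSpace E] [MeasurableSpace 𝒴]

/-- Factors whose conditional mean given the first component is at most `C` may be integrated out
of a product measure, at the price of a factor `C` each. -/
lemma lintegral_pi_mul_prod_le (ν : Measure (E × 𝒴)) [IsProbabilityMeasure ν]
    {η : E × 𝒴 → ℝ≥0∞} (hη : Measurable η) (C : ℝ≥0∞)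
    (hC : ∀ g : E → ℝ≥0∞, Measurable g → ∫⁻ z, g z.1 * η z ∂ν ≤ C * ∫⁻ z, g z.1 ∂ν)
    {n : ℕ} {g : (Fin n → E) → ℝ≥0∞} (hg : Measurable g) (J : Finset (Fin n)) :
    ∫⁻ z : Fin n → E × 𝒴, g (fun i => (z i).1) * ∏ i ∈ J, η (z i) ∂Measure.pi (fun _ => ν) ≤
      C ^ J.card * ∫⁻ z : Fin n → E × 𝒴, g (fun i => (z i).1) ∂Measure.pi (fun _ => ν) := by
  classical
  induction J using Finset.induction_on with
  | empty => simp
  | insert k J hk ih =>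
    have hgm : Measurable fun z : Fin n → E × 𝒴 => g (fun i => (z i).1) :=
      hg.comp (measurable_pi_lambda _ fun i => (measurable_pi_apply i).fst)
    have hpm : Measurable fun z : Fin n → E × 𝒴 => ∏ i ∈ J, η (z i) :=
      Finset.measurable_prod _ fun i _ => hη.comp (measurable_pi_apply i)
    calc ∫⁻ z : Fin n → E × 𝒴, g (fun i => (z i).1) * ∏ i ∈ insert k J, η (z i)
          ∂Measure.pi (fun _ => ν)
        ≤ ∫⁻ z : Fin n → E × 𝒴, C * (g (fun i => (z i).1) * ∏ i ∈ J, η (z i))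
          ∂Measure.pi (fun _ => ν) := by
          -- Only the coordinate `k` is integrated: `η (z k)` is the single factor in which the
          -- second component of `z k` occurs.
          refine lintegral_le_of_lmarginal_le (μ := fun _ => ν) {k} ?_ ?_ ?_
          · exact hgm.mul (Finset.measurable_prod _ fun i _ => hη.comp (measurable_pi_apply i))
          · exact (hgm.mul hpm).const_mul C
          · rw [lmarginal_singleton, lmarginal_singleton]
            intro z
            simp only
            have hprod : ∀ x : E × 𝒴, ∏ i ∈ J, η (Function.update z k x i) = ∏ i ∈ J, η (z i) := by
              intro x
              refine Finset.prod_congr rfl fun i hi => ?_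
              rw [Function.update_of_ne (fun h => hk (by rwa [h] at hi))]
            have hupd : ∀ x : E × 𝒴, (fun i => (Function.update z k x i).1) =
                Function.update (fun i => (z i).1) k x.1 := by
              intro x; ext i
              by_cases h : i = k
              · subst h; simp
              · simp [h]
            simp only [Finset.prod_insert hk, hprod, hupd, Function.update_self]
            have hgu : Measurable fun x : E => g (Function.update (fun i => (z i).1) k x) :=
              hg.comp (measurable_update _)
            have hgu1 : Measurable fun x : E × 𝒴 =>
              g (Function.update (fun i => (z i).1) k x.1) := hgu.comp measurable_fst
            have hgu2 : Measurable fun x : E × 𝒴 =>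
              g (Function.update (fun i => (z i).1) k x.1) * η x := hgu1.mul hη
            calc ∫⁻ x : E × 𝒴, g (Function.update (fun i => (z i).1) k x.1) *
                  (η x * ∏ i ∈ J, η (z i)) ∂ν
                = (∫⁻ x : E × 𝒴, g (Function.update (fun i => (z i).1) k x.1) * η x ∂ν) *
                  ∏ i ∈ J, η (z i) := by
                  rw [← lintegral_mul_const _ hgu2]
                  simp only [mul_assoc]
              _ ≤ (C * ∫⁻ x : E × 𝒴, g (Function.update (fun i => (z i).1) k x.1) ∂ν) *
                  ∏ i ∈ J, η (z i) := by
                  gcongr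
                  exact hC _ hgu
              _ = _ := by
                  rw [lintegral_const_mul _ (hgu1.mul_const _),
                    lintegral_mul_const _ hgu1, mul_assoc]
      _ = C * ∫⁻ z : Fin n → E × 𝒴, (g (fun i => (z i).1) * ∏ i ∈ J, η (z i))
          ∂Measure.pi (fun _ => ν) := lintegral_const_mul _ (hgm.mul hpm)
      _ ≤ C * (C ^ J.card * ∫⁻ z : Fin n → E × 𝒴, g (fun i => (z i).1)
          ∂Measure.pi (fun _ => ν)) := by gcongr
      _ = _ := by rw [Finset.card_insert_of_notMem hk, pow_succ']; ring

variable {V : Type*} [NormedAddCommGroup V] [InnerProductSpace ℝ V] [FiniteDimensional ℝ V]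
  [MeasurableSpace V] [BorelSpace V]

/-- A union bound over all 2^n index sets would be useless. Each set `J` is kept together with the
indicator that the covariates allow it to be cut out. This indicator is a function of the
covariates, so the noise can be integrated out first; afterwards the indicators sum to the number of
cut-out sets, which is polynomial in n for fixed dimension. -/
lemma pi_cutOut_exp_le (ν : Measure (E × 𝒴)) [IsProbabilityMeasure ν]
    {P : E → V} (hP : Measurable P) {ψ : E × 𝒴 → ℝ} (hψ : Measurable ψ) {l C : ℝ} (hC1 : 1 ≤ C)
    (hC : ∀ g : E → ℝ≥0∞, Measurable g →
      ∫⁻ z, g z.1 * ENNReal.ofReal (Real.exp (l * ψ z)) ∂ν ≤ ENNReal.ofReal C * ∫⁻ z, g z.1 ∂ν)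
    (hl : 0 ≤ l) (n : ℕ) (s : ℝ) :
    Measure.pi (fun _ : Fin n => ν)
      {z | ∃ θ : V, ∃ q : ℝ, s ≤ ∑ i, if q < inner ℝ (P (z i).1) θ then ψ (z i) else 0} ≤
      ENNReal.ofReal ((2 * (n + 1)) ^ (Module.finrank ℝ V + 1) * C ^ n * Real.exp (-(l * s))) := by
  classical
  set R : Finset (Fin n) → Set (Fin n → E) := fun J => {x | CutOut (fun i => P (x i)) J} with hR
  have hRm : ∀ J, MeasurableSet (R J) := fun J => measurableSet_cutOut hP J
  set η : E × 𝒴 → ℝ≥0∞ := fun z => ENNReal.ofReal (Real.exp (l * ψ z)) with hη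
  have hηm : Measurable η := by fun_prop
  set π : Measure (Fin n → E × 𝒴) := Measure.pi (fun _ : Fin n => ν) with hπ
  set A : Finset (Fin n) → Set (Fin n → E × 𝒴) := fun J =>
    {z | (fun i => (z i).1) ∈ R J ∧ s ≤ ∑ i ∈ J, ψ (z i)} with hA
  have hsub : {z : Fin n → E × 𝒴 | ∃ θ : V, ∃ q : ℝ,
      s ≤ ∑ i, if q < inner ℝ (P (z i).1) θ then ψ (z i) else 0} ⊆ ⋃ J, A J := by
    rintro z ⟨θ, q, h⟩
    refine Set.mem_iUnion.2 ⟨Finset.univ.filter fun i => q < inner ℝ (P (z i).1) θ,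
      ⟨θ, q, fun i => by simp⟩, ?_⟩
    rw [Finset.sum_filter]; exact h
  have hfst : Measurable fun z : Fin n → E × 𝒴 => fun i => (z i).1 :=
    measurable_pi_lambda _ fun i => (measurable_pi_apply i).fst
  have hone : ∀ J, π (A J) ≤ ENNReal.ofReal (C ^ n * Real.exp (-(l * s))) *
      ∫⁻ z, (R J).indicator 1 (fun i => (z i).1) ∂π := by
    intro J
    calc π (A J) ≤ ∫⁻ z, ENNReal.ofReal (Real.exp (-(l * s))) *
          ((R J).indicator 1 (fun i => (z i).1) * ∏ i ∈ J, η (z i)) ∂π := by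
          have hAm : MeasurableSet (A J) := (hfst (hRm J)).inter
            (measurableSet_le measurable_const (Finset.measurable_sum _ fun i _ =>
              hψ.comp (measurable_pi_apply i)))
          rw [← lintegral_indicator_one hAm]
          refine lintegral_mono fun z => ?_
          by_cases hz : z ∈ A J
          · rw [Set.indicator_of_mem hz, Set.indicator_of_mem hz.1]
            simp only [Pi.one_apply, one_mul, hη]
            rw [← ENNReal.ofReal_prod_of_nonneg (fun i _ => (Real.exp_pos _).le),
              ← ENNReal.ofReal_mul (Real.exp_pos _).le, ← Real.exp_sum, ← Real.exp_add,
              ENNReal.one_le_ofReal, Real.one_le_exp_iff, ← Finset.mul_sum]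
            nlinarith [hz.2]
          · rw [Set.indicator_of_notMem hz]; exact zero_le
      _ = ENNReal.ofReal (Real.exp (-(l * s))) *
          ∫⁻ z, ((R J).indicator 1 (fun i => (z i).1) * ∏ i ∈ J, η (z i)) ∂π := by
          refine lintegral_const_mul _ (Measurable.mul ?_ ?_)
          · exact (measurable_one.indicator (hRm J)).comp hfst
          · exact Finset.measurable_prod _ fun i _ => hηm.comp (measurable_pi_apply i)
      _ ≤ ENNReal.ofReal (Real.exp (-(l * s))) * (ENNReal.ofReal C ^ J.card *
          ∫⁻ z, ((R J).indicator 1 (fun i => (z i).1)) ∂π) := by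
          gcongr
          exact lintegral_pi_mul_prod_le ν hηm _ hC (measurable_one.indicator (hRm J)) J
      _ ≤ ENNReal.ofReal (Real.exp (-(l * s))) * (ENNReal.ofReal C ^ n *
          ∫⁻ z, ((R J).indicator 1 (fun i => (z i).1)) ∂π) := by
          gcongr
          · exact ENNReal.one_le_ofReal.2 hC1
          · simpa using J.card_le_univ
      _ = _ := by
          rw [ENNReal.ofReal_mul (by positivity), ENNReal.ofReal_pow (by positivity)]; ring
  calc π _ ≤ π (⋃ J, A J) := measure_mono hsub
    _ ≤ ∑ J, π (A J) := measure_iUnion_fintype_le _ _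
    _ ≤ ∑ J, ENNReal.ofReal (C ^ n * Real.exp (-(l * s))) *
          ∫⁻ z, (R J).indicator 1 (fun i => (z i).1) ∂π := Finset.sum_le_sum fun J _ => hone J
    _ = ENNReal.ofReal (C ^ n * Real.exp (-(l * s))) *
          ∫⁻ z, ∑ J, (R J).indicator 1 (fun i => (z i).1) ∂π := by
          rw [lintegral_finsetSum, Finset.mul_sum]
          exact fun J _ => (measurable_one.indicator (hRm J)).comp hfst
    _ ≤ ENNReal.ofReal (C ^ n * Real.exp (-(l * s))) *
          ∫⁻ _z, ENNReal.ofReal ((2 * (n + 1)) ^ (Module.finrank ℝ V + 1)) ∂π := by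
          gcongr with z
          -- At fixed covariates the sum of the indicators is a cardinality, and the counting bound
          -- holds pointwise.
          have h1 : ∑ J, (R J).indicator (1 : (Fin n → E) → ℝ≥0∞) (fun i => (z i).1) =
              ((cutSets fun i => P (z i).1).card : ℝ≥0∞) := by
            simp only [cutSets, Set.indicator_apply, hR, Set.mem_ofPred_eq, Pi.one_apply,
              Finset.sum_boole]
          rw [h1]
          have h2 := card_cutSets_le (fun i => P (z i).1)
          calc ((cutSets fun i => P (z i).1).card : ℝ≥0∞)
              ≤ (((2 * (n + 1)) ^ (Module.finrank ℝ V + 1) : ℕ) : ℝ≥0∞) := by exact_mod_cast h2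
            _ = _ := by rw [← ENNReal.ofReal_natCast]; push_cast; rfl
    _ = _ := by
          rw [lintegral_const, measure_univ, mul_one, ← ENNReal.ofReal_mul (by positivity)]
          congr 1; ring

end Chernoff

/-! ### From half-lines to bounded monotone functions. -/

section Layer

/-- On finitely many points an upper level set of a monotone function is cut out by an open
half-line, whether or not the function is continuous: `q` is the largest `v i` whose image does not
exceed `t`. -/
lemma exists_lt_iff_lt_of_monotone {n : ℕ} (v : Fin n → ℝ) {G : ℝ → ℝ} (hG : Monotone G) (t : ℝ) :
    ∃ q, ∀ i, q < v i ↔ t < G (v i) := by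
  by_cases h : (Finset.univ.filter fun i => ¬ t < G (v i)).Nonempty
  · obtain ⟨j, hj, hmax⟩ := Finset.exists_max_image _ v h
    simp only [Finset.mem_filter, Finset.mem_univ, true_and] at hj hmax
    refine ⟨v j, fun i => ⟨fun hi => ?_, fun hi => ?_⟩⟩
    · by_contra hc
      exact absurd (hmax i hc) (not_le.2 hi)
    · by_contra hc
      exact hj (hi.trans_le (hG (not_lt.1 hc)))
  · rw [Finset.not_nonempty_iff_eq_empty, Finset.filter_eq_empty_iff] at h
    -- Every point is in the level set here, so any threshold below all `v i` will do.
    refine ⟨-∑ i, |v i| - 1, fun i => ⟨fun _ => not_not.1 (h (Finset.mem_univ i)), fun _ => ?_⟩⟩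
    have h1 : |v i| ≤ ∑ i, |v i| :=
      Finset.single_le_sum (f := fun i => |v i|) (fun i _ => abs_nonneg _) (Finset.mem_univ i)
    linarith [neg_abs_le (v i)]

/-- Weighted sums of a bounded monotone function are controlled by the weighted sums of the
indicators of the upper half-lines. -/
lemma abs_sum_mul_monotone_le {n : ℕ} (v u : Fin n → ℝ) {G : ℝ → ℝ} (hG : Monotone G) {a b s : ℝ}
    (ha : ∀ t, a ≤ G t) (hb : ∀ t, G t ≤ b)
    (hs : ∀ q, |∑ i, if q < v i then u i else 0| ≤ s) :
    |∑ i, u i * (G (v i) - a)| ≤ s * (b - a) := by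
  have hab : a ≤ b := (ha 0).trans (hb 0)
  have hone : ∀ y, a ≤ y → y ≤ b → IntervalIntegrable (fun t => if t < y then (1 : ℝ) else 0)
      volume a b ∧ ∫ t in a..b, (if t < y then (1 : ℝ) else 0) = y - a := by
    intro y hay hyb
    have hanti : Antitone fun t => if t < y then (1 : ℝ) else 0 := by
      intro t t' htt
      dsimp only
      split_ifs with h1 h2
      · exact le_rfl
      · exact absurd (htt.trans_lt h1) h2
      · exact zero_le_one
      · exact le_rfl
    refine ⟨hanti.intervalIntegrable, ?_⟩
    have h1 : ∫ t in a..y, (if t < y then (1 : ℝ) else 0) = ∫ t in a..y, (1 : ℝ) := by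
      simp only [intervalIntegral.integral_of_le hay, integral_Ioc_eq_integral_Ioo]
      exact setIntegral_congr_fun measurableSet_Ioo fun t ht => by simp [ht.2]
    have h2 : ∫ t in y..b, (if t < y then (1 : ℝ) else 0) = ∫ t in y..b, (0 : ℝ) := by
      rw [intervalIntegral.integral_of_le hyb, intervalIntegral.integral_of_le hyb]
      exact setIntegral_congr_fun measurableSet_Ioc fun t ht => by simp [not_lt.2 ht.1.le]
    rw [← intervalIntegral.integral_add_adjacent_intervals (hanti.intervalIntegrable (a := a)
      (b := y)) hanti.intervalIntegrable, h1, h2]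
    simp
  -- Layer-cake formula: y - a is the integral over t in [a, b] of the indicator of t < y, for y in
  -- [a, b].
  have heq : ∑ i, u i * (G (v i) - a) =
      ∫ t in a..b, ∑ i, u i * (if t < G (v i) then (1 : ℝ) else 0) := by
    rw [intervalIntegral.integral_finsetSum]
    · refine Finset.sum_congr rfl fun i _ => ?_
      rw [intervalIntegral.integral_const_mul, (hone _ (ha _) (hb _)).2]
    · exact fun i _ => (hone _ (ha _) (hb _)).1.const_mul _
  rw [heq, ← Real.norm_eq_abs]
  refine (intervalIntegral.norm_integral_le_of_norm_le_const (C := s) fun t _ => ?_).trans_eq ?_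
  · obtain ⟨q, hq⟩ := exists_lt_iff_lt_of_monotone v hG t
    have := hs q
    simp only [hq] at this
    simpa [Real.norm_eq_abs] using this
  · rw [abs_of_nonneg (by linarith)]

end Layer

/-! ### Bernstein-type and Chebyshev inequalities for i.i.d. samples. -/

section IID

variable {Ω 𝒵 : Type*} [MeasurableSpace Ω] [MeasurableSpace 𝒵] {Pr : Measure Ω}
  [IsProbabilityMeasure Pr] {Z : ℕ → Ω → 𝒵} {ν : Measure 𝒵}

/-- The centred variable is bounded by 2B, so the condition l · 2B ≤ 1 keeps the exponent in [-1,
1], where e^t ≤ 1 + t + t². The linear term has mean zero, and the quadratic one is bounded by the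
variance proxy `v`. -/
lemma iid_chernoff (hZ : ∀ i, Measurable (Z i)) (hind : iIndepFun Z Pr)
    (hlaw : ∀ i, Pr.map (Z i) = ν) {f : 𝒵 → ℝ} (hf : Measurable f) {B v l : ℝ}
    (hB : ∀ᵐ z ∂ν, |f z| ≤ B) (hv : ∫ z, f z ^ 2 ∂ν ≤ v) (hl : 0 ≤ l) (hlB : l * (2 * B) ≤ 1)
    (n : ℕ) (s : ℝ) :
    Pr {ω | s ≤ ∑ i ∈ Finset.range n, (f (Z i ω) - ∫ z, f z ∂ν)} ≤
      ENNReal.ofReal (Real.exp (n * (l ^ 2 * v) - l * s)) := by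
  have : IsProbabilityMeasure ν := by
    rw [← hlaw 0]; exact Measure.isProbabilityMeasure_map (hZ 0).aemeasurable
  set m := ∫ z, f z ∂ν with hm
  have hfi : Integrable f ν :=
    Integrable.of_bound hf.aestronglyMeasurable B (by simpa using hB)
  have hB0 : 0 ≤ B := by
    obtain ⟨z, hz⟩ := hB.exists
    exact (abs_nonneg _).trans hz
  have hmB : |m| ≤ B := by
    have := norm_integral_le_of_norm_le_const (μ := ν) (f := f) (C := B) (by simpa using hB)
    simpa using this
  have hgB : ∀ᵐ z ∂ν, |f z - m| ≤ 2 * B := by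
    filter_upwards [hB] with z hz
    calc |f z - m| ≤ |f z| + |m| := abs_sub _ _
      _ ≤ 2 * B := by linarith
  have hgm : Measurable fun z => f z - m := hf.sub_const _
  have hsqi : Integrable (fun z => f z ^ 2) ν := by
    refine Integrable.of_bound (hf.pow_const 2).aestronglyMeasurable (B ^ 2) ?_
    filter_upwards [hB] with z hz
    rw [Real.norm_eq_abs, abs_pow]; gcongr
  have hgi : Integrable (fun z => f z - m) ν := hfi.sub (integrable_const _)
  have hgsqi : Integrable (fun z => (f z - m) ^ 2) ν := by
    have : (fun z => (f z - m) ^ 2) = fun z => f z ^ 2 - 2 * m * f z + m ^ 2 := by ext z; ring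
    rw [this]
    exact (hsqi.sub (hfi.const_mul _)).add (integrable_const _)
  have hgsq : ∫ z, (f z - m) ^ 2 ∂ν ≤ v := by
    rw [hm, ← variance_eq_integral hf.aemeasurable]
    exact (variance_le_expectation_sq hf.aestronglyMeasurable).trans hv
  have hint : Integrable (fun z => Real.exp (l * (f z - m))) ν := by
    refine Integrable.of_bound (Real.measurable_exp.comp
      (hgm.const_mul l)).aestronglyMeasurable (Real.exp 1) ?_
    filter_upwards [hgB] with z hz
    rw [Real.norm_eq_abs, Real.abs_exp, Real.exp_le_exp]
    calc l * (f z - m) ≤ l * (2 * B) := by gcongr; exact (le_abs_self _).trans hz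
      _ ≤ 1 := hlB
  have hmgf : ∫ z, Real.exp (l * (f z - m)) ∂ν ≤ Real.exp (l ^ 2 * v) := by
    calc ∫ z, Real.exp (l * (f z - m)) ∂ν
        ≤ ∫ z, (1 + l * (f z - m) + l ^ 2 * (f z - m) ^ 2) ∂ν := by
          refine integral_mono_ae hint (((integrable_const _).add (hgi.const_mul _)).add
            (hgsqi.const_mul _)) ?_
          filter_upwards [hgB] with z hz
          have h1 : |l * (f z - m)| ≤ 1 := by
            rw [abs_mul, abs_of_nonneg hl]
            exact (mul_le_mul_of_nonneg_left hz hl).trans hlB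
          have h2 := (abs_le.1 (Real.abs_exp_sub_one_sub_id_le h1)).2
          have h3 : (l * (f z - m)) ^ 2 = l ^ 2 * (f z - m) ^ 2 := by ring
          linarith
      _ = 1 + l ^ 2 * ∫ z, (f z - m) ^ 2 ∂ν := by
          have h1 : Integrable (fun z => 1 + l * (f z - m)) ν :=
            (integrable_const _).add (hgi.const_mul _)
          rw [integral_add h1 (hgsqi.const_mul _),
            integral_add (integrable_const _) (hgi.const_mul _), integral_const_mul,
            integral_const_mul, integral_sub hfi (integrable_const _)]
          simp [← hm]
      _ ≤ 1 + l ^ 2 * v := by gcongr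
      _ ≤ Real.exp (l ^ 2 * v) := by linarith [Real.add_one_le_exp (l ^ 2 * v)]
  set X : ℕ → Ω → ℝ := fun i ω => f (Z i ω) - m with hX
  have hXm : ∀ i, Measurable (X i) := fun i => hgm.comp (hZ i)
  have hXind : iIndepFun X Pr := hind.comp (fun _ z => f z - m) fun _ => hgm
  have hXmgf : ∀ i, mgf (X i) Pr l ≤ Real.exp (l ^ 2 * v) := by
    intro i
    have : mgf (X i) Pr l = ∫ z, Real.exp (l * (f z - m)) ∂ν := by
      rw [← hlaw i, integral_map (hZ i).aemeasurable]
      · rfl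
      · exact (Real.measurable_exp.comp (hgm.const_mul l)).aestronglyMeasurable
    rw [this]; exact hmgf
  have hXint : ∀ i, Integrable (fun ω => Real.exp (l * X i ω)) Pr := by
    intro i
    have h1 : Integrable (fun z => Real.exp (l * (f z - m))) (Pr.map (Z i)) := by rwa [hlaw i]
    exact h1.comp_measurable (hZ i)
  have hsint : Integrable (fun ω => Real.exp (l * (∑ i ∈ Finset.range n, X i) ω)) Pr :=
    hXind.integrable_exp_mul_sum hXm fun i _ => hXint i
  have hmain := measure_ge_le_exp_mul_mgf s hl hsint
  rw [hXind.mgf_sum hXm] at hmain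
  have hset : {ω | s ≤ ∑ i ∈ Finset.range n, (f (Z i ω) - m)} =
      {ω | s ≤ (∑ i ∈ Finset.range n, X i) ω} := by
    ext ω; simp [hX, Finset.sum_apply]
  rw [hset, ← ofReal_measureReal]
  refine ENNReal.ofReal_le_ofReal (hmain.trans ?_)
  calc Real.exp (-l * s) * ∏ i ∈ Finset.range n, mgf (X i) Pr l
      ≤ Real.exp (-l * s) * ∏ i ∈ Finset.range n, Real.exp (l ^ 2 * v) := by
        gcongr with i _
        · exact fun i _ => mgf_nonneg
        · exact hXmgf i
    _ = _ := by
        rw [Finset.prod_const, Finset.card_range, ← Real.exp_nat_mul, ← Real.exp_add]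
        congr 1; ring

lemma iid_chernoff_abs (hZ : ∀ i, Measurable (Z i)) (hind : iIndepFun Z Pr)
    (hlaw : ∀ i, Pr.map (Z i) = ν) {f : 𝒵 → ℝ} (hf : Measurable f) {B v l : ℝ}
    (hB : ∀ᵐ z ∂ν, |f z| ≤ B) (hv : ∫ z, f z ^ 2 ∂ν ≤ v) (hl : 0 ≤ l) (hlB : l * (2 * B) ≤ 1)
    (n : ℕ) (s : ℝ) :
    Pr {ω | s ≤ |∑ i ∈ Finset.range n, (f (Z i ω) - ∫ z, f z ∂ν)|} ≤
      ENNReal.ofReal (2 * Real.exp (n * (l ^ 2 * v) - l * s)) := by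
  have h1 := iid_chernoff hZ hind hlaw hf hB hv hl hlB n s
  have h2 := iid_chernoff hZ hind hlaw hf.neg (B := B) (v := v) (by simpa using hB)
    (by simpa using hv) hl hlB n s
  have hsub : {ω | s ≤ |∑ i ∈ Finset.range n, (f (Z i ω) - ∫ z, f z ∂ν)|} ⊆
      {ω | s ≤ ∑ i ∈ Finset.range n, (f (Z i ω) - ∫ z, f z ∂ν)} ∪
      {ω | s ≤ ∑ i ∈ Finset.range n, ((-f) (Z i ω) - ∫ z, (-f) z ∂ν)} := by
    intro ω hω
    rcases le_abs.1 (show s ≤ |_| from hω) with h | h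
    · exact Or.inl h
    · right
      simp only [Pi.neg_apply, integral_neg, Set.mem_ofPred_eq]
      rw [← Finset.sum_neg_distrib] at h
      refine h.trans_eq (Finset.sum_congr rfl fun i _ => by ring)
  calc _ ≤ _ := measure_mono hsub
    _ ≤ _ := measure_union_le _ _
    _ ≤ _ := add_le_add h1 h2
    _ = _ := by rw [← ENNReal.ofReal_add (Real.exp_pos _).le (Real.exp_pos _).le, two_mul]

/-- Chebyshev's inequality for the squared norm of the centred mean of a random vector. -/
lemma iid_chebyshev (hZ : ∀ i, Measurable (Z i)) (hind : iIndepFun Z Pr)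
    (hlaw : ∀ i, Pr.map (Z i) = ν) {ι : Type*} [Fintype ι] {f : ι → 𝒵 → ℝ}
    (hf : ∀ a, Measurable (f a)) (hf2 : ∀ a, MemLp (f a) 2 ν) {B : ℝ}
    (hB : ∫ z, ∑ a, f a z ^ 2 ∂ν ≤ B) {n : ℕ} (hn : 0 < n) {t : ℝ} (ht : 0 < t) :
    Pr {ω | t ≤ ∑ a, ((n : ℝ)⁻¹ * ∑ i ∈ Finset.range n, f a (Z i ω) - ∫ z, f a z ∂ν) ^ 2} ≤
      ENNReal.ofReal (B / (n * t)) := by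
  have : IsProbabilityMeasure ν := by
    rw [← hlaw 0]; exact Measure.isProbabilityMeasure_map (hZ 0).aemeasurable
  have hn' : (0 : ℝ) < n := by exact_mod_cast hn
  have hXL : ∀ a i, MemLp (fun ω => f a (Z i ω)) 2 Pr := by
    intro a i
    have h1 : MemLp (f a) 2 (Pr.map (Z i)) := by rw [hlaw i]; exact hf2 a
    exact h1.comp_of_map (hZ i).aemeasurable
  have hmean : ∀ a i, ∫ ω, f a (Z i ω) ∂Pr = ∫ z, f a z ∂ν := by
    intro a i
    rw [← hlaw i, integral_map (hZ i).aemeasurable (hf a).aestronglyMeasurable]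
  have hvar : ∀ a i, Var[fun ω => f a (Z i ω); Pr] ≤ ∫ z, f a z ^ 2 ∂ν := by
    intro a i
    refine (variance_le_expectation_sq (hXL a i).1).trans_eq ?_
    rw [← hlaw i, integral_map (hZ i).aemeasurable ((hf a).pow_const 2).aestronglyMeasurable]
    rfl
  have hsL : ∀ a, MemLp (∑ i ∈ Finset.range n, fun ω => f a (Z i ω)) 2 Pr :=
    fun a => memLp_finsetSum' _ fun i _ => hXL a i
  have hsumvar : ∀ a, Var[∑ i ∈ Finset.range n, fun ω => f a (Z i ω); Pr] ≤
      n * ∫ z, f a z ^ 2 ∂ν := by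
    intro a
    rw [IndepFun.variance_sum (fun i _ => hXL a i)]
    · calc _ ≤ ∑ i ∈ Finset.range n, ∫ z, f a z ^ 2 ∂ν := Finset.sum_le_sum fun i _ => hvar a i
        _ = _ := by simp
    · intro i _ j _ hij
      exact (hind.indepFun hij).comp (hf a) (hf a)
  have hterm : ∀ a, Integrable (fun ω => ((n : ℝ)⁻¹ * ∑ i ∈ Finset.range n, f a (Z i ω)
      - ∫ z, f a z ∂ν) ^ 2) Pr ∧ ∫ ω, ((n : ℝ)⁻¹ * ∑ i ∈ Finset.range n, f a (Z i ω)
      - ∫ z, f a z ∂ν) ^ 2 ∂Pr ≤ (n : ℝ)⁻¹ * ∫ z, f a z ^ 2 ∂ν := by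
    intro a
    have hm : Pr[∑ i ∈ Finset.range n, fun ω => f a (Z i ω)] = n * ∫ z, f a z ∂ν := by
      simp only [Finset.sum_apply]
      rw [integral_finsetSum _ fun i _ => (hXL a i).integrable (by norm_num)]
      simp [hmean]
    have heq : (fun ω => ((n : ℝ)⁻¹ * ∑ i ∈ Finset.range n, f a (Z i ω) - ∫ z, f a z ∂ν) ^ 2) =
        fun ω => ((n : ℝ)⁻¹) ^ 2 * ((∑ i ∈ Finset.range n, fun ω => f a (Z i ω)) ω -
          Pr[∑ i ∈ Finset.range n, fun ω => f a (Z i ω)]) ^ 2 := by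
      ext ω
      rw [hm, Finset.sum_apply, ← mul_pow]
      congr 1
      field_simp
    rw [heq]
    refine ⟨(((hsL a).sub (memLp_const _)).integrable_sq).const_mul _, ?_⟩
    rw [integral_const_mul, ← variance_eq_integral (hsL a).1.aemeasurable]
    calc _ ≤ ((n : ℝ)⁻¹) ^ 2 * (n * ∫ z, f a z ^ 2 ∂ν) := by gcongr; exact hsumvar a
      _ = _ := by field_simp
  have hI : ∫ ω, ∑ a, ((n : ℝ)⁻¹ * ∑ i ∈ Finset.range n, f a (Z i ω) - ∫ z, f a z ∂ν) ^ 2 ∂Pr ≤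
      (n : ℝ)⁻¹ * B := by
    rw [integral_finsetSum _ fun a _ => (hterm a).1]
    rw [integral_finsetSum _ fun a _ => (hf2 a).integrable_sq] at hB
    calc _ ≤ ∑ a, (n : ℝ)⁻¹ * ∫ z, f a z ^ 2 ∂ν := Finset.sum_le_sum fun a _ => (hterm a).2
      _ ≤ _ := by rw [← Finset.mul_sum]; gcongr
  have hmk := mul_meas_ge_le_integral_of_nonneg (μ := Pr)
    (f := fun ω => ∑ a, ((n : ℝ)⁻¹ * ∑ i ∈ Finset.range n, f a (Z i ω) - ∫ z, f a z ∂ν) ^ 2)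
    (Eventually.of_forall fun ω => Finset.sum_nonneg fun a _ => sq_nonneg _)
    (integrable_finsetSum _ fun a _ => (hterm a).1) t
  rw [← ofReal_measureReal]
  refine ENNReal.ofReal_le_ofReal ?_
  rw [le_div_iff₀ (by positivity)]
  have := hmk.trans hI
  calc _ = n * (t * Pr.real {ω | t ≤ ∑ a, ((n : ℝ)⁻¹ * ∑ i ∈ Finset.range n, f a (Z i ω)
        - ∫ z, f a z ∂ν) ^ 2}) := by ring
    _ ≤ n * ((n : ℝ)⁻¹ * B) := by gcongr
    _ = B := by field_simp

end IID

/-! ### Local regularity of the link function. -/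

/-- Quantitative regularity of the link function `F` in the `δ`-neighbourhood of the set `W`. -/
structure LinkRegular (F : ℝ → ℝ) (W : Set ℝ) (δ c C a b : ℝ) : Prop where
  delta_pos : 0 < δ
  delta_le_one : δ ≤ 1
  c_pos : 0 < c
  one_le_C : 1 ≤ C
  lo : ∀ w ∈ W, a ≤ w - δ
  hi : ∀ w ∈ W, w + δ ≤ b
  deriv_lo : ∀ w ∈ W, c ≤ deriv F w
  deriv_hi : ∀ w ∈ W, ∀ v, |v - w| ≤ δ → |deriv F v| ≤ C
  deriv2_hi : ∀ w ∈ W, |deriv (deriv F) w| ≤ C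
  diff : ∀ w ∈ W, ∀ v, |v - w| ≤ δ → DifferentiableAt ℝ F v
  lip : ∀ w ∈ W, ∀ v, |v - w| ≤ δ → |F v - F w| ≤ C * |v - w|
  taylor : ∀ w ∈ W, ∀ v, |v - w| ≤ δ → |F v - F w - deriv F w * (v - w)| ≤ C * (v - w) ^ 2
  taylor_deriv : ∀ w ∈ W, ∀ v, |v - w| ≤ δ →
    |deriv F v - deriv F w - deriv (deriv F) w * (v - w)| ≤ C * (v - w) ^ 2
  growth_right : ∀ w ∈ W, ∀ v, w ≤ v → v ≤ w + δ → c * (v - w) ≤ F v - F w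
  growth_left : ∀ w ∈ W, ∀ v, v ≤ w → w - δ ≤ v → c * (w - v) ≤ F w - F v

/-- The strict inequalities place every point within δ of `W` in the open interval (a, b), where
one-sided and two-sided derivatives agree. There the mean value inequality yields all the Taylor
bounds. -/
lemma linkRegular_of_contDiffOn {F : ℝ → ℝ} {a b δ : ℝ} {W : Set ℝ} (hδ : 0 < δ) (hδ1 : δ ≤ 1)
    (hlo : ∀ w ∈ W, a < w - δ) (hhi : ∀ w ∈ W, w + δ < b) (hF : ContDiffOn ℝ 2 F (Set.Icc a b))
    {c C' : ℝ} (hc : 0 < c)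
    (hF' : ∀ v ∈ Set.Icc a b, c ≤ derivWithin F (Set.Icc a b) v ∧
      derivWithin F (Set.Icc a b) v ≤ C')
    {L : ℝ} (hL : ∀ v₁ ∈ Set.Icc a b, ∀ v₂ ∈ Set.Icc a b,
      |iteratedDerivWithin 2 F (Set.Icc a b) v₂ - iteratedDerivWithin 2 F (Set.Icc a b) v₁| ≤
        L * |v₂ - v₁|) :
    ∃ C, LinkRegular F W δ c C a b := by
  have hnhds : ∀ v ∈ Set.Ioo a b, Set.Icc a b ∈ 𝓝 v := fun v hv => Icc_mem_nhds hv.1 hv.2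
  have hd1 : ∀ v ∈ Set.Ioo a b, derivWithin F (Set.Icc a b) v = deriv F v := fun v hv =>
    derivWithin_of_mem_nhds (hnhds v hv)
  have hd2 : ∀ v ∈ Set.Ioo a b, iteratedDerivWithin 2 F (Set.Icc a b) v = deriv (deriv F) v := by
    intro v hv
    rw [iteratedDerivWithin_succ, derivWithin_of_mem_nhds (hnhds v hv)]
    refine EventuallyEq.deriv_eq ?_
    filter_upwards [isOpen_Ioo.mem_nhds hv] with t ht
    rw [iteratedDerivWithin_one, hd1 t ht]
  have hFo : ContDiffOn ℝ 2 F (Set.Ioo a b) := hF.mono Set.Ioo_subset_Icc_self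
  have hdF : ∀ v ∈ Set.Ioo a b, DifferentiableAt ℝ F v := fun v hv =>
    (hFo.differentiableOn (by norm_num)).differentiableAt (isOpen_Ioo.mem_nhds hv)
  have hdF' : ∀ v ∈ Set.Ioo a b, DifferentiableAt ℝ (deriv F) v := fun v hv =>
    ((hFo.deriv_of_isOpen (m := 1) isOpen_Ioo (by norm_num)).differentiableOn
      (by norm_num)).differentiableAt (isOpen_Ioo.mem_nhds hv)
  have hb1 : ∀ v ∈ Set.Ioo a b, c ≤ deriv F v ∧ deriv F v ≤ C' := fun v hv => by
    rw [← hd1 v hv]; exact hF' v (Set.Ioo_subset_Icc_self hv)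
  have hb2 : ∀ v ∈ Set.Ioo a b, ∀ t ∈ Set.Ioo a b,
      |deriv (deriv F) t - deriv (deriv F) v| ≤ |L| * |t - v| := fun v hv t ht => by
    rw [← hd2 v hv, ← hd2 t ht]
    exact (hL v (Set.Ioo_subset_Icc_self hv) t (Set.Ioo_subset_Icc_self ht)).trans
      (mul_le_mul_of_nonneg_right (le_abs_self L) (abs_nonneg _))
  -- F'' is Lipschitz on a bounded interval, hence bounded by its modulus at the midpoint plus |L|
  -- times the length.
  obtain ⟨K, hK0, hK⟩ : ∃ K, 0 ≤ K ∧ ∀ v ∈ Set.Ioo a b, |deriv (deriv F) v| ≤ K := by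
    refine ⟨|deriv (deriv F) ((a + b) / 2)| + |L| * |b - a|, by positivity, fun v hv => ?_⟩
    have hm : (a + b) / 2 ∈ Set.Ioo a b := by
      have := hv.1.trans hv.2
      exact ⟨by linarith, by linarith⟩
    have h1 := hb2 _ hm v hv
    have h2 : |v - (a + b) / 2| ≤ |b - a| := by
      rw [abs_of_pos (show 0 < b - a by linarith [hv.1.trans hv.2]), abs_le]
      constructor <;> linarith [hv.1, hv.2]
    have h3 : |L| * |v - (a + b) / 2| ≤ |L| * |b - a| := by gcongr
    have h4 := abs_sub_abs_le_abs_sub (deriv (deriv F) v) (deriv (deriv F) ((a + b) / 2))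
    linarith
  have hsub : ∀ w ∈ W, ∀ v, |v - w| ≤ δ → Metric.closedBall w |v - w| ⊆ Set.Ioo a b := by
    intro w hw v hv t ht
    rw [Metric.mem_closedBall, Real.dist_eq] at ht
    have := abs_le.1 (ht.trans hv)
    exact ⟨by linarith [hlo w hw], by linarith [hhi w hw]⟩
  have hwm : ∀ w v : ℝ, w ∈ Metric.closedBall w |v - w| := fun w v =>
    Metric.mem_closedBall_self (abs_nonneg _)
  have hvm : ∀ w v : ℝ, v ∈ Metric.closedBall w |v - w| := fun w v => by
    rw [Metric.mem_closedBall, Real.dist_eq]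
  have hball : ∀ w v t : ℝ, t ∈ Metric.closedBall w |v - w| → |t - w| ≤ |v - w| := fun w v t ht => by
    rwa [Metric.mem_closedBall, Real.dist_eq] at ht
  have hWI : ∀ w ∈ W, w ∈ Set.Ioo a b := fun w hw =>
    ⟨by linarith [hlo w hw], by linarith [hhi w hw]⟩
  refine ⟨1 + |C'| + K + |L|, ⟨hδ, hδ1, hc, by linarith [abs_nonneg C', abs_nonneg L],
    fun w hw => (hlo w hw).le, fun w hw => (hhi w hw).le, fun w hw => (hb1 w (hWI w hw)).1,
    ?_, ?_, ?_, ?_, ?_, ?_, ?_, ?_⟩⟩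
  · intro w hw v hv
    have := hb1 v (hsub w hw v hv (hvm w v))
    rw [abs_of_pos (hc.trans_le this.1)]
    linarith [le_abs_self C', abs_nonneg L]
  · intro w hw
    linarith [hK w (hWI w hw), abs_nonneg C', abs_nonneg L]
  · exact fun w hw v hv => hdF v (hsub w hw v hv (hvm w v))
  · intro w hw v hv
    have := (convex_closedBall w |v - w|).norm_image_sub_le_of_norm_deriv_le (f := F)
      (C := |C'|) (fun t ht => hdF t (hsub w hw v hv ht)) (fun t ht => by
        have := hb1 t (hsub w hw v hv ht)
        rw [Real.norm_eq_abs, abs_of_pos (hc.trans_le this.1)]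
        exact this.2.trans (le_abs_self _)) (hwm w v) (hvm w v)
    simp only [Real.norm_eq_abs] at this
    refine this.trans (mul_le_mul_of_nonneg_right ?_ (abs_nonneg _))
    linarith [abs_nonneg L]
  · intro w hw v hv
    -- The mean value inequality is applied to F minus its linear part at `w`: the derivative F'(t)
    -- - F'(w) is at most K|v - w| on the ball, which yields the square.
    have hder : ∀ t ∈ Metric.closedBall w |v - w|,
        HasDerivAt (fun t => F t - deriv F w * t) (deriv F t - deriv F w) t := fun t ht => by
      have h1 := (hdF t (hsub w hw v hv ht)).hasDerivAt
      have h2 := (hasDerivAt_id t).const_mul (deriv F w)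
      exact (h1.sub h2).congr_deriv (by simp)
    have := (convex_closedBall w |v - w|).norm_image_sub_le_of_norm_deriv_le
      (f := fun t => F t - deriv F w * t) (C := K * |v - w|)
      (fun t ht => (hder t ht).differentiableAt) (fun t ht => by
        rw [(hder t ht).deriv]
        have h3 := (convex_closedBall w |v - w|).norm_image_sub_le_of_norm_deriv_le
          (f := deriv F) (C := K) (fun t ht => hdF' t (hsub w hw v hv ht))
          (fun t ht => hK t (hsub w hw v hv ht)) (hwm w v) ht
        refine h3.trans (mul_le_mul_of_nonneg_left ?_ hK0)
        exact hball w v t ht) (hwm w v) (hvm w v)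
    simp only [Real.norm_eq_abs] at this
    have h5 : K * |v - w| * |v - w| = K * (v - w) ^ 2 := by rw [mul_assoc, ← sq, sq_abs]
    rw [h5] at this
    have h6 : F v - F w - deriv F w * (v - w) = F v - deriv F w * v - (F w - deriv F w * w) := by
      ring
    rw [h6]
    refine this.trans (mul_le_mul_of_nonneg_right ?_ (sq_nonneg _))
    linarith [abs_nonneg L, abs_nonneg C']
  · intro w hw v hv
    have hder : ∀ t ∈ Metric.closedBall w |v - w|,
        HasDerivAt (fun t => deriv F t - deriv (deriv F) w * t)
          (deriv (deriv F) t - deriv (deriv F) w) t := fun t ht => by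
      have h1 := (hdF' t (hsub w hw v hv ht)).hasDerivAt
      have h2 := (hasDerivAt_id t).const_mul (deriv (deriv F) w)
      exact (h1.sub h2).congr_deriv (by simp)
    have := (convex_closedBall w |v - w|).norm_image_sub_le_of_norm_deriv_le
      (f := fun t => deriv F t - deriv (deriv F) w * t) (C := |L| * |v - w|)
      (fun t ht => (hder t ht).differentiableAt) (fun t ht => by
        rw [(hder t ht).deriv]
        refine (hb2 w (hWI w hw) t (hsub w hw v hv ht)).trans
          (mul_le_mul_of_nonneg_left ?_ (abs_nonneg _))
        exact hball w v t ht) (hwm w v) (hvm w v)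
    simp only [Real.norm_eq_abs] at this
    have h5 : |L| * |v - w| * |v - w| = |L| * (v - w) ^ 2 := by rw [mul_assoc, ← sq, sq_abs]
    rw [h5] at this
    have h6 : deriv F v - deriv F w - deriv (deriv F) w * (v - w) =
      deriv F v - deriv (deriv F) w * v - (deriv F w - deriv (deriv F) w * w) := by ring
    rw [h6]
    refine this.trans (mul_le_mul_of_nonneg_right ?_ (sq_nonneg _))
    linarith [abs_nonneg C']
  · intro w hw v hwv hv
    refine (convex_Ioo a b).mul_sub_le_image_sub_of_le_deriv
      (fun t ht => (hdF t ht).continuousAt.continuousWithinAt)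
      (fun t ht => (hdF t (interior_subset ht)).differentiableWithinAt)
      (fun t ht => (hb1 t (interior_subset ht)).1) w (hWI w hw) v ?_ hwv
    exact ⟨by linarith [(hWI w hw).1], by linarith [hhi w hw]⟩
  · intro w hw v hwv hv
    refine (convex_Ioo a b).mul_sub_le_image_sub_of_le_deriv
      (fun t ht => (hdF t ht).continuousAt.continuousWithinAt)
      (fun t ht => (hdF t (interior_subset ht)).differentiableWithinAt)
      (fun t ht => (hb1 t (interior_subset ht)).1) v ?_ w (hWI w hw) hwv
    exact ⟨by linarith [hlo w hw], by linarith [(hWI w hw).2]⟩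

/-! ### The index μ + m and compactness of the cube. -/

namespace Model

variable {d : ℕ} (M : Model d)

/-- The index `μ + m(x)`, with the additive components extended continuously off the cube. -/
def index (x : Fin d → ℝ) : ℝ :=
  M.mu + ∑ j, M.m j (Set.projIcc (-1 : ℝ) 1 (by norm_num) (x j))

variable {M}

lemma index_eq {x : Fin d → ℝ} (hx : x ∈ cube d) : M.index x = M.mu + M.mSum x := by
  simp only [index, mSum]
  congr 1
  refine Finset.sum_congr rfl fun j _ => ?_
  rw [Set.projIcc_of_mem _ (hx j)]

lemma continuous_index (h : AssumptionA3 M) : Continuous M.index := by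
  refine continuous_const.add (continuous_finsetSum _ fun j _ => ?_)
  have h1 : Continuous ((Set.Icc (-1 : ℝ) 1).domRestrict (M.m j)) :=
    continuousOn_iff_continuous_domRestrict.1 (h.smooth j).continuousOn
  exact h1.comp (continuous_projIcc.comp (continuous_apply j))

end Model

lemma cube_eq_pi (d : ℕ) : cube d = Set.univ.pi fun _ => Set.Icc (-1 : ℝ) 1 := by
  ext x; simp [cube, -Set.pi_univ_Icc]

lemma isCompact_cube (d : ℕ) : IsCompact (cube d) := by
  rw [cube_eq_pi]; exact isCompact_univ_pi fun _ => isCompact_Icc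

lemma zero_mem_cube (d : ℕ) : (0 : Fin d → ℝ) ∈ cube d := fun j => by simp

/-- The strict bound |m_j| < C_m and compactness of the cube make the maximum r of |m(x)| smaller
than C_m d. Half of this gap, capped at 1, serves as δ and leaves room for strict inequalities. At
least one covariate is needed for the sum of strict inequalities to be strict. -/
lemma AssumptionA3.exists_linkRegular {d : ℕ} {M : Model d} (h : AssumptionA3 M) (hd : 0 < d) :
    ∃ δ c C a b, LinkRegular M.F (M.index '' cube d) δ c C a b := by
  obtain ⟨Cm, I, rfl, hm, ⟨CF1, cF2, CF2, hc, hF'⟩, hF, CF3, hL⟩ := h.bounds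
  obtain ⟨x₀, hx₀, hmax⟩ := (isCompact_cube d).exists_isMaxOn ⟨0, zero_mem_cube d⟩
    ((Model.continuous_index h).sub continuous_const).abs.continuousOn
    (f := fun x => |M.index x - M.mu|)
  have hlt : ∀ x ∈ cube d, |M.index x - M.mu| < Cm * d := by
    intro x hx
    rw [Model.index_eq hx, add_sub_cancel_left, Model.mSum]
    have : Nonempty (Fin d) := ⟨⟨0, hd⟩⟩
    calc |∑ j, M.m j (x j)| ≤ ∑ j, |M.m j (x j)| := Finset.abs_sum_le_sum_abs _ _
      _ < ∑ _j : Fin d, Cm := Finset.sum_lt_sum_of_nonempty Finset.univ_nonempty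
          fun j _ => hm j _ (hx j)
      _ = Cm * d := by simp [mul_comm]
  set r := |M.index x₀ - M.mu| with hr
  have hr' := hlt x₀ hx₀
  have hδ1 : min 1 ((Cm * d - r) / 2) ≤ (Cm * d - r) / 2 := min_le_right _ _
  obtain ⟨C, hC⟩ := linkRegular_of_contDiffOn (F := M.F) (a := M.mu - Cm * d) (b := M.mu + Cm * d)
    (δ := min 1 ((Cm * d - r) / 2)) (W := M.index '' cube d)
    (lt_min one_pos (by linarith)) (min_le_left _ _)
    (by
      rintro _ ⟨x, hx, rfl⟩
      have := abs_le.1 (show |M.index x - M.mu| ≤ r from hmax hx)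
      linarith)
    (by
      rintro _ ⟨x, hx, rfl⟩
      have := abs_le.1 (show |M.index x - M.mu| ≤ r from hmax hx)
      linarith) hF hc (fun v hv => (hF' v hv).2) hL
  exact ⟨_, _, _, _, _, hC⟩

/-! ### Integrals over the cube by Fubini. -/

section CubeIntegrals

variable {d : ℕ}

lemma measurableSet_cube (d : ℕ) : MeasurableSet (cube d) := (isCompact_cube d).measurableSet

lemma volume_restrict_cube (d : ℕ) : (volume : Measure (Fin d → ℝ)).restrict (cube d) =
    Measure.pi fun _ => (volume : Measure ℝ).restrict (Set.Icc (-1) 1) := by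
  rw [cube_eq_pi, volume_pi, Measure.restrict_pi_pi]

instance isFiniteMeasure_restrict_cube :
    IsFiniteMeasure ((volume : Measure (Fin d → ℝ)).restrict (cube d)) := by
  rw [volume_restrict_cube]; infer_instance

lemma integral_Icc_eq (f : ℝ → ℝ) :
    ∫ v, f v ∂(volume : Measure ℝ).restrict (Set.Icc (-1) 1) = ∫ v in (-1 : ℝ)..1, f v := by
  rw [intervalIntegral.integral_of_le (by norm_num), integral_Icc_eq_integral_Ioc]

lemma setIntegral_cube_const (c : ℝ) : ∫ _x in cube d, c = 2 ^ d * c := by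
  have h := integral_fintype_prod_eq_prod (𝕜 := ℝ) (ι := Fin d) (E := fun _ => ℝ)
    (fun _ _ => 1) (μ := fun _ => (volume : Measure ℝ).restrict (Set.Icc (-1) 1))
  rw [← volume_restrict_cube] at h
  simp only [Finset.prod_const_one, integral_Icc_eq] at h
  rw [show (∫ _x in cube d, c) = (∫ _x in cube d, (1 : ℝ)) * c by
    rw [← integral_mul_const]; simp, h]
  norm_num

lemma setIntegral_cube_apply (f : ℝ → ℝ) (j : Fin d) :
    ∫ x in cube d, f (x j) = 2 ^ (d - 1) * ∫ v in (-1 : ℝ)..1, f v := by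
  have h := integral_fintype_prod_eq_prod (𝕜 := ℝ) (ι := Fin d) (E := fun _ => ℝ)
    (fun i v => if i = j then f v else 1)
    (μ := fun _ => (volume : Measure ℝ).restrict (Set.Icc (-1) 1))
  rw [← volume_restrict_cube] at h
  simp only [Finset.prod_ite_eq', Finset.mem_univ, if_true, integral_Icc_eq] at h
  rw [h, ← Finset.mul_prod_erase _ _ (Finset.mem_univ j), mul_comm]
  simp only [if_true]
  congr 1
  rw [Finset.prod_congr rfl (g := fun _ => (2 : ℝ))]
  · simp
  · intro i hi
    simp only [(Finset.mem_erase.1 hi).1, if_false]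
    norm_num

lemma setIntegral_cube_mul_eq_zero (f g : ℝ → ℝ) {j k : Fin d} (hjk : j ≠ k)
    (hg : ∫ v in (-1 : ℝ)..1, g v = 0) : ∫ x in cube d, f (x j) * g (x k) = 0 := by
  have h := integral_fintype_prod_eq_prod (𝕜 := ℝ) (ι := Fin d) (E := fun _ => ℝ)
    (fun i v => (if i = j then f v else 1) * (if i = k then g v else 1))
    (μ := fun _ => (volume : Measure ℝ).restrict (Set.Icc (-1) 1))
  rw [← volume_restrict_cube] at h
  simp only [Finset.prod_mul_distrib, Finset.prod_ite_eq', Finset.mem_univ, if_true,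
    integral_Icc_eq] at h
  rw [h]
  refine Finset.prod_eq_zero (Finset.mem_univ k) ?_
  simp [hjk.symm, hg]

end CubeIntegrals

/-! ### The regressors: Gram matrices, series coefficients and distance to the boundary of Θ_κ. -/

section Basis

variable {d : ℕ} {M : Model d} {Cθ : ℝ} {θ0 : ∀ κ : ℕ, Coef d κ}

lemma inner_P (κ : ℕ) (x : Fin d → ℝ) (u : Coef d κ) :
    inner ℝ (M.P κ x) u = ∑ a, M.P κ x a * u a := by
  rw [PiLp.inner_apply]
  exact Finset.sum_congr rfl fun a _ => by simp [mul_comm]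

lemma P_none (κ : ℕ) (x : Fin d → ℝ) : M.P κ x none = 1 := rfl

lemma P_some (κ : ℕ) (x : Fin d → ℝ) (j : Fin d) (k : Fin κ) :
    M.P κ x (some (j, k)) = M.p k (x j) := rfl

namespace AssumptionA5

lemma measurable_P (h : AssumptionA5 M Cθ θ0) (κ : ℕ) : Measurable (M.P κ) := by
  refine (WithLp.measurable_toLp 2 _).comp (measurable_pi_lambda _ fun i => ?_)
  rcases i with _ | ⟨j, k⟩
  · exact measurable_const
  · exact (h.measurable k).comp (measurable_pi_apply j)

lemma measurable_P_apply (h : AssumptionA5 M Cθ θ0) (κ : ℕ) (a : Idx d κ) :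
    Measurable fun x => M.P κ x a := by
  rcases a with _ | ⟨j, k⟩
  · exact measurable_const
  · exact (h.measurable k).comp (measurable_pi_apply j)

lemma exists_norm_P_sq_le (h : AssumptionA5 M Cθ θ0) :
    ∃ C : ℝ, 1 ≤ C ∧ ∀ᶠ κ : ℕ in atTop, ∀ x ∈ cube d, ‖M.P κ x‖ ^ 2 ≤ C * κ := by
  obtain ⟨C, hC⟩ := h.zeta_upper
  refine ⟨max 1 (C ^ 2 : ℝ), le_max_left _ _, hC.mono fun κ hκ x hx => ?_⟩
  have h1 : ‖M.P κ x‖ₑ ≤ ENNReal.ofReal (C * (κ : ℝ) ^ (1 / 2 : ℝ)) := by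
    rw [ENNReal.ofReal_mul C.coe_nonneg, ENNReal.ofReal_coe_nnreal]
    exact (le_iSup₂ (f := fun x (_ : x ∈ cube d) => ‖M.P κ x‖ₑ) x hx).trans hκ
  rw [← ofReal_norm, ENNReal.ofReal_le_ofReal_iff (by positivity)] at h1
  calc ‖M.P κ x‖ ^ 2 ≤ (C * (κ : ℝ) ^ (1 / 2 : ℝ)) ^ 2 := by gcongr
    _ = (C : ℝ) ^ 2 * κ := by
        rw [mul_pow, ← Real.sqrt_eq_rpow, Real.sq_sqrt (Nat.cast_nonneg _)]
    _ ≤ _ := by gcongr; exact le_max_right _ _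

/-- The bound on ζ_κ holds for large κ only. A coordinate of P_κ is also a coordinate of every
longer vector P_κ', so it inherits a bound from a large κ'. -/
lemma exists_P_apply_le (h : AssumptionA5 M Cθ θ0) (κ : ℕ) (a : Idx d κ) :
    ∃ B, ∀ x ∈ cube d, |M.P κ x a| ≤ B := by
  obtain ⟨C, _, hC⟩ := h.exists_norm_P_sq_le
  obtain ⟨κ', hκ', hle⟩ := (hC.and (eventually_ge_atTop κ)).exists
  refine ⟨√(C * κ'), fun x hx => Real.le_sqrt_of_sq_le ?_⟩
  rw [sq_abs]
  rcases a with _ | ⟨j, k⟩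
  · refine le_trans ?_ (hκ' x hx)
    rw [EuclideanSpace.real_norm_sq_eq]
    exact Finset.single_le_sum (f := fun i => M.P κ' x i ^ 2) (fun i _ => sq_nonneg _)
      (Finset.mem_univ none)
  · refine le_trans ?_ (hκ' x hx)
    rw [EuclideanSpace.real_norm_sq_eq]
    exact Finset.single_le_sum (f := fun i => M.P κ' x i ^ 2) (fun i _ => sq_nonneg _)
      (Finset.mem_univ (some (j, (⟨k, k.2.trans_le hle⟩ : Fin κ'))))

lemma exists_norm_P_le (h : AssumptionA5 M Cθ θ0) (κ : ℕ) :
    ∃ B, ∀ x ∈ cube d, ‖M.P κ x‖ ≤ B := by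
  choose B hB using h.exists_P_apply_le κ
  refine ⟨√(∑ a, B a ^ 2), fun x hx => ?_⟩
  rw [EuclideanSpace.norm_eq]
  refine Real.sqrt_le_sqrt (Finset.sum_le_sum fun a _ => ?_)
  rw [Real.norm_eq_abs]
  have := hB a x hx
  gcongr

/-- Lebesgue measure on the cube is not normalized: each covariate that does not enter contributes a
factor 2. Cross terms between different covariates, and with the constant, vanish because the basis
functions integrate to zero. -/
lemma gram_cube (h : AssumptionA5 M Cθ θ0) (κ : ℕ) (a b : Idx d κ) :
    ∫ x in cube d, M.P κ x a * M.P κ x b =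
      if a = b then (match a with | none => 2 ^ d | some _ => 2 ^ (d - 1)) else 0 := by
  rcases a with _ | ⟨j, k⟩ <;> rcases b with _ | ⟨j', k'⟩
  · simp [P_none, -integral_const, setIntegral_cube_const]
  · simp [P_none, P_some, setIntegral_cube_apply, h.mean_zero]
  · simp [P_none, P_some, setIntegral_cube_apply, h.mean_zero]
  · simp only [P_some, Option.some.injEq, Prod.mk.injEq]
    by_cases hj : j = j'
    · subst hj
      rw [setIntegral_cube_apply (fun v => M.p k v * M.p k' v), h.orthonormal]
      simp [Fin.ext_iff]
    · rw [setIntegral_cube_mul_eq_zero _ _ hj (h.mean_zero _)]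
      simp [hj]

lemma integrableOn_cube (h : AssumptionA5 M Cθ θ0) (κ : ℕ) (a b : Idx d κ) :
    IntegrableOn (fun x => M.P κ x a * M.P κ x b) (cube d) := by
  obtain ⟨A, hA⟩ := h.exists_P_apply_le κ a
  obtain ⟨B, hB⟩ := h.exists_P_apply_le κ b
  refine Integrable.of_bound
    ((h.measurable_P_apply κ a).mul (h.measurable_P_apply κ b)).aestronglyMeasurable (A * B) ?_
  filter_upwards [ae_restrict_mem (measurableSet_cube d)] with x hx
  rw [Real.norm_eq_abs, abs_mul]
  exact mul_le_mul (hA x hx) (hB x hx) (abs_nonneg _) ((abs_nonneg _).trans (hA x hx))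

lemma inner_P_sq (κ : ℕ) (x : Fin d → ℝ) (u : Coef d κ) :
    inner ℝ (M.P κ x) u ^ 2 = ∑ a, ∑ b, M.P κ x a * M.P κ x b * (u a * u b) := by
  rw [inner_P, sq, Finset.sum_mul_sum]
  exact Finset.sum_congr rfl fun a _ => Finset.sum_congr rfl fun b _ => by ring

lemma integral_inner_sq_cube (h : AssumptionA5 M Cθ θ0) (κ : ℕ) (u : Coef d κ) :
    IntegrableOn (fun x => inner ℝ (M.P κ x) u ^ 2) (cube d) ∧
    ‖u‖ ^ 2 ≤ ∫ x in cube d, inner ℝ (M.P κ x) u ^ 2 ∧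
    ∫ x in cube d, inner ℝ (M.P κ x) u ^ 2 ≤ 2 ^ d * ‖u‖ ^ 2 := by
  have hint : ∀ a b : Idx d κ, IntegrableOn
      (fun x => M.P κ x a * M.P κ x b * (u a * u b)) (cube d) := fun a b =>
    (h.integrableOn_cube κ a b).mul_const _
  have heq : ∫ x in cube d, inner ℝ (M.P κ x) u ^ 2 =
      ∑ a : Idx d κ, (match a with | none => 2 ^ d | some _ => 2 ^ (d - 1)) * u a ^ 2 := by
    simp only [inner_P_sq]
    rw [integral_finsetSum _ fun a _ => integrable_finsetSum _ fun b _ => hint a b]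
    refine Finset.sum_congr rfl fun a _ => ?_
    rw [integral_finsetSum _ fun b _ => hint a b]
    simp only [integral_mul_const, h.gram_cube]
    simp [sq]
  refine ⟨?_, ?_, ?_⟩
  · simp only [inner_P_sq]
    exact integrable_finsetSum _ fun a _ => integrable_finsetSum _ fun b _ => hint a b
  · rw [heq, EuclideanSpace.real_norm_sq_eq]
    refine Finset.sum_le_sum fun a _ => le_mul_of_one_le_left (sq_nonneg _) ?_
    rcases a with _ | a
    · exact one_le_pow₀ (by norm_num)
    · exact one_le_pow₀ (by norm_num)
  · rw [heq, EuclideanSpace.real_norm_sq_eq, Finset.mul_sum]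
    refine Finset.sum_le_sum fun a _ => mul_le_mul_of_nonneg_right ?_ (sq_nonneg _)
    rcases a with _ | a
    · exact le_rfl
    · exact pow_le_pow_right₀ (by norm_num) (Nat.sub_le _ _)

end AssumptionA5

lemma AssumptionA2.exists_measure_bounds (h : AssumptionA2 M) : ∃ c C : ℝ≥0, 0 < c ∧
    c • (volume.restrict (cube d)) ≤ M.law.map Prod.fst ∧
    M.law.map Prod.fst ≤ C • (volume.restrict (cube d)) := by
  obtain ⟨f, hf, ⟨c, C, hc, hcC⟩, -⟩ := h.density
  refine ⟨c.toNNReal, C.toNNReal, by simpa using hc, ?_, ?_⟩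
  · rw [hf, show c.toNNReal • (volume.restrict (cube d)) =
      (volume.restrict (cube d)).withDensity (fun _ => ENNReal.ofReal c) by
        rw [withDensity_const]; rfl]
    refine withDensity_mono ?_
    filter_upwards [ae_restrict_mem (measurableSet_cube d)] with x hx
    exact ENNReal.ofReal_le_ofReal (hcC x hx).1
  · rw [hf, show C.toNNReal • (volume.restrict (cube d)) =
      (volume.restrict (cube d)).withDensity (fun _ => ENNReal.ofReal C) by
        rw [withDensity_const]; rfl]
    refine withDensity_mono ?_
    filter_upwards [ae_restrict_mem (measurableSet_cube d)] with x hx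
    exact ENNReal.ofReal_le_ofReal (hcC x hx).2

lemma AssumptionA2.ae_mem_cube (h : AssumptionA2 M) : ∀ᵐ z ∂M.law, z.1 ∈ cube d := by
  obtain ⟨c, C, -, -, hC⟩ := h.exists_measure_bounds
  have h1 : ∀ᵐ x ∂(C • (volume.restrict (cube d))), x ∈ cube d :=
    Measure.ae_smul_measure (ae_restrict_mem (measurableSet_cube d)) C
  have h2 : ∀ᵐ x ∂(M.law.map Prod.fst), x ∈ cube d := hC.absolutelyContinuous.ae_le h1
  exact ae_of_ae_map measurable_fst.aemeasurable h2

/-- The density is sandwiched between positive constants, so E(P_κ P_κ') is comparable with the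
diagonal Gram matrix of Lebesgue measure, with constants independent of κ. -/
lemma exists_gram_bounds (h2 : AssumptionA2 M) (h5 : AssumptionA5 M Cθ θ0) :
    ∃ c C : ℝ, 0 < c ∧ 1 ≤ C ∧ ∀ (κ : ℕ) (u : Coef d κ),
      Integrable (fun z => inner ℝ (M.P κ z.1) u ^ 2) M.law ∧
      c * ‖u‖ ^ 2 ≤ ∫ z, inner ℝ (M.P κ z.1) u ^ 2 ∂M.law ∧
      ∫ z, inner ℝ (M.P κ z.1) u ^ 2 ∂M.law ≤ C * ‖u‖ ^ 2 := by
  obtain ⟨c, C, hc, hcl, hCl⟩ := h2.exists_measure_bounds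
  refine ⟨c, max 1 (C * 2 ^ d), by exact_mod_cast hc, le_max_left _ _, fun κ u => ?_⟩
  obtain ⟨hi, hlo, hhi⟩ := h5.integral_inner_sq_cube κ u
  have hm : Measurable fun x => inner ℝ (M.P κ x) u ^ 2 :=
    ((h5.measurable_P κ).inner_const).pow_const 2
  have hiC : Integrable (fun x => inner ℝ (M.P κ x) u ^ 2) (C • (volume.restrict (cube d))) :=
    hi.smul_measure_nnreal
  have hiX : Integrable (fun x => inner ℝ (M.P κ x) u ^ 2) (M.law.map Prod.fst) :=
    hiC.mono_measure hCl
  have hmap : ∫ z, inner ℝ (M.P κ z.1) u ^ 2 ∂M.law =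
      ∫ x, inner ℝ (M.P κ x) u ^ 2 ∂(M.law.map Prod.fst) :=
    (integral_map measurable_fst.aemeasurable hm.aestronglyMeasurable).symm
  refine ⟨hiX.comp_measurable measurable_fst, ?_, ?_⟩
  · rw [hmap]
    calc (c : ℝ) * ‖u‖ ^ 2 ≤ c * ∫ x in cube d, inner ℝ (M.P κ x) u ^ 2 := by gcongr
      _ = ∫ x, inner ℝ (M.P κ x) u ^ 2 ∂(c • (volume.restrict (cube d))) := by
          rw [integral_smul_nnreal_measure]; rfl
      _ ≤ _ := integral_mono_measure hcl (Eventually.of_forall fun x => sq_nonneg _) hiX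
  · rw [hmap]
    calc _ ≤ ∫ x, inner ℝ (M.P κ x) u ^ 2 ∂(C • (volume.restrict (cube d))) :=
          integral_mono_measure hCl (Eventually.of_forall fun x => sq_nonneg _) hiC
      _ = C * ∫ x in cube d, inner ℝ (M.P κ x) u ^ 2 := by
          rw [integral_smul_nnreal_measure]; rfl
      _ ≤ C * (2 ^ d * ‖u‖ ^ 2) := by gcongr
      _ ≤ max 1 (C * 2 ^ d) * ‖u‖ ^ 2 := by
          rw [← mul_assoc]; gcongr; exact le_max_right _ _

/-- Up to the weights of the diagonal Gram matrix, the series coefficients are those of the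
orthogonal projection of μ + m under Lebesgue measure on the cube. The components with another
covariate drop out because each m_j integrates to zero. -/
lemma gram_index (h3 : AssumptionA3 M) (h5 : AssumptionA5 M Cθ θ0) (κ : ℕ) (a : Idx d κ) :
    IntegrableOn (fun x => M.P κ x a * M.index x) (cube d) ∧
    ∫ x in cube d, M.P κ x a * M.index x =
      (match a with | none => 2 ^ d | some _ => 2 ^ (d - 1)) * M.thetaSeries κ a := by
  set g : Fin d → ℝ → ℝ := fun j v => M.m j (Set.projIcc (-1 : ℝ) 1 (by norm_num) v) with hg
  have hgc : ∀ j, Continuous (g j) := fun j => by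
    have h1 : Continuous ((Set.Icc (-1 : ℝ) 1).domRestrict (M.m j)) :=
      continuousOn_iff_continuous_domRestrict.1 (h3.smooth j).continuousOn
    exact h1.comp continuous_projIcc
  have hgm : ∀ (j : Fin d) (q : ℝ → ℝ), ∫ v in (-1 : ℝ)..1, q v * g j v =
      ∫ v in (-1 : ℝ)..1, q v * M.m j v := by
    intro j q
    refine intervalIntegral.integral_congr fun v hv => ?_
    rw [Set.uIcc_of_le (by norm_num)] at hv
    simp only [hg, Set.projIcc_of_mem _ hv]
  have hg0 : ∀ j, ∫ v in (-1 : ℝ)..1, g j v = 0 := by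
    intro j
    have := hgm j (fun _ => 1)
    simp only [one_mul] at this
    rw [this, h3.normalized j]
  obtain ⟨B, hB⟩ := h5.exists_P_apply_le κ a
  have hint : ∀ f : (Fin d → ℝ) → ℝ, Continuous f →
      IntegrableOn (fun x => M.P κ x a * f x) (cube d) := by
    intro f hf
    refine Integrable.bdd_mul (c := B)
      (hf.continuousOn.integrableOn_compact (isCompact_cube d))
      (h5.measurable_P_apply κ a).aestronglyMeasurable ?_
    filter_upwards [ae_restrict_mem (measurableSet_cube d)] with x hx using hB x hx
  refine ⟨hint _ (Model.continuous_index h3), ?_⟩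
  have hexp : ∀ x, M.P κ x a * M.index x = M.P κ x a * M.mu + ∑ j, M.P κ x a * g j (x j) := by
    intro x; simp only [Model.index, mul_add, Finset.mul_sum, hg]
  simp only [hexp]
  have hint' : ∀ j : Fin d, IntegrableOn (fun x => M.P κ x a * g j (x j)) (cube d) := fun j =>
    hint (fun x => g j (x j)) ((hgc j).comp (continuous_apply j))
  rw [integral_add (hint _ continuous_const) (integrable_finsetSum _ fun j _ => hint' j),
    integral_finsetSum _ fun j _ => hint' j]
  rcases a with _ | ⟨j, k⟩
  · simp only [P_none, one_mul, setIntegral_cube_const, setIntegral_cube_apply, hg0]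
    simp [Model.thetaSeries]
  · simp only [P_some]
    rw [Finset.sum_eq_single j]
    · rw [setIntegral_cube_apply (fun v => M.p k v * M.mu),
        setIntegral_cube_apply (fun v => M.p k v * g j v), hgm]
      simp only [intervalIntegral.integral_mul_const, h5.mean_zero, Model.thetaSeries]
      simp only [zero_mul, mul_zero, zero_add]
      congr 2
      ext v; ring
    · intro i _ hij
      exact setIntegral_cube_mul_eq_zero _ _ hij.symm (hg0 i)
    · simp

/-- Integrating the bias against the a-th regressor returns the coefficient difference times the
Gram weight w ≥ 1. The integral is controlled through |p| ≤ 1 + p², whose integral is 2^d + w. -/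
lemma abs_thetaSeries_sub_le (h3 : AssumptionA3 M) (h5 : AssumptionA5 M Cθ θ0) {κ : ℕ}
    (θ : Coef d κ) {β : ℝ} (hβ : ∀ x ∈ cube d, |M.bias κ θ x| ≤ β) (a : Idx d κ) :
    |M.thetaSeries κ a - θ a| ≤ 2 ^ (d + 1) * β := by
  set w : ℝ := (match a with | none => 2 ^ d | some _ => 2 ^ (d - 1)) with hw
  have hw1 : 1 ≤ w := by
    rcases a with _ | a
    · exact one_le_pow₀ (by norm_num)
    · exact one_le_pow₀ (by norm_num)
  have hw2 : w ≤ 2 ^ d := by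
    rcases a with _ | a
    · exact le_rfl
    · exact pow_le_pow_right₀ (by norm_num) (Nat.sub_le _ _)
  have hβ0 : 0 ≤ β := (abs_nonneg _).trans (hβ 0 (zero_mem_cube d))
  obtain ⟨hi1, he1⟩ := gram_index h3 h5 κ a
  have hi2 : IntegrableOn (fun x => ∑ b, M.P κ x a * M.P κ x b * θ b) (cube d) :=
    integrable_finsetSum _ fun b _ => (h5.integrableOn_cube κ a b).mul_const _
  have he2 : ∫ x in cube d, ∑ b, M.P κ x a * M.P κ x b * θ b = w * θ a := by
    rw [integral_finsetSum _ fun b _ => (h5.integrableOn_cube κ a b).mul_const _]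
    simp [integral_mul_const, h5.gram_cube, hw]
  have heq : w * (M.thetaSeries κ a - θ a) = ∫ x in cube d, M.P κ x a * M.bias κ θ x := by
    rw [mul_sub, ← he1, ← he2, ← integral_sub hi1 hi2]
    refine setIntegral_congr_fun (measurableSet_cube d) fun x hx => ?_
    simp only [Model.bias, ← Model.index_eq hx, inner_P, mul_sub, Finset.mul_sum, mul_assoc]
  have hle : |w * (M.thetaSeries κ a - θ a)| ≤ β * (2 ^ d + w) := by
    rw [heq, ← Real.norm_eq_abs]
    have hib : IntegrableOn (fun x => β * (1 + M.P κ x a * M.P κ x a)) (cube d) :=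
      ((integrable_const _).add (h5.integrableOn_cube κ a a)).const_mul _
    refine (norm_integral_le_of_norm_le hib ?_).trans_eq ?_
    · filter_upwards [ae_restrict_mem (measurableSet_cube d)] with x hx
      rw [Real.norm_eq_abs, abs_mul, mul_comm]
      refine mul_le_mul (hβ x hx) ?_ (abs_nonneg _) hβ0
      nlinarith [sq_nonneg (|M.P κ x a| - 1), abs_mul_abs_self (M.P κ x a)]
    · rw [integral_const_mul, integral_add (integrable_const _) (h5.integrableOn_cube κ a a),
        setIntegral_cube_const, h5.gram_cube]
      simp [hw]
  rw [abs_mul, abs_of_pos (by linarith)] at hle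
  have h4 : w * |M.thetaSeries κ a - θ a| ≤ w * (2 ^ (d + 1) * β) := by
    refine hle.trans ?_
    rw [pow_succ]
    have : (1 : ℝ) ≤ 2 ^ d := one_le_pow₀ (by norm_num)
    have h5 : β * (2 ^ d + w) ≤ β * (w * 2 ^ d * 2) := by
      gcongr
      nlinarith
    linarith
  exact le_of_mul_le_mul_left h4 (by linarith)

lemma abs_lt_of_mem_interior_Theta {κ : ℕ} {θ : Coef d κ} (h : θ ∈ interior (Theta d κ Cθ))
    (a : Idx d κ) : |θ a| < Cθ := by
  obtain ⟨ε, hε, hball⟩ := Metric.mem_nhds_iff.1 (mem_interior_iff_mem_nhds.1 h)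
  have hmem : ∀ s : ℝ, |s| < ε → |θ a + s| ≤ Cθ := by
    intro s hs
    have := hball (show θ + EuclideanSpace.single a s ∈ Metric.ball θ ε by
      rw [Metric.mem_ball, dist_eq_norm, add_sub_cancel_left, PiLp.norm_single]
      exact hs) a
    simpa [abs_le] using this
  have h1 := abs_le.1 (hmem (ε / 2) (by rw [abs_of_pos] <;> linarith))
  have h2 := abs_le.1 (hmem (-(ε / 2)) (by rw [abs_neg, abs_of_pos] <;> linarith))
  rw [abs_lt]
  constructor <;> linarith

/-- The range of a convergent sequence together with its limit is compact, so the supremum of |u k|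
is attained, either at the limit 0 or at some term, and is below R in both cases. -/
lemma exists_pos_margin {u : ℕ → ℝ} {R : ℝ} (h0 : Tendsto u atTop (𝓝 0)) (hu : ∀ k, |u k| < R) :
    ∃ ρ, 0 < ρ ∧ ∀ k, |u k| ≤ R - ρ := by
  obtain ⟨y, hy, hmax⟩ := h0.isCompact_insert_range.exists_isMaxOn ⟨0, Set.mem_insert _ _⟩
    (f := fun y : ℝ => |y|) continuous_abs.continuousOn
  refine ⟨R - |y|, ?_, fun k => ?_⟩
  · rcases hy with rfl | ⟨k, rfl⟩
    · simpa using (abs_nonneg _).trans_lt (hu 0)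
    · linarith [hu k]
  · have : |u k| ≤ |y| := hmax (Set.mem_insert_of_mem _ ⟨k, rfl⟩)
    linarith

/-- The coefficients are square summable. The approximants P_κ'θ0 are uniformly bounded on the cube,
so ‖θ0 κ‖ is bounded by the lower Gram bound. Replacing θ0 by the series coefficients costs κ terms
of order κ^{-4}, which is bounded as well. -/
lemma tendsto_thetaSeries (h3 : AssumptionA3 M) (h5 : AssumptionA5 M Cθ θ0)
    (j : Fin d) :
    Tendsto (fun k : ℕ => ∫ v in (-1 : ℝ)..1, M.m j v * M.p k v) atTop (𝓝 0) := by
  set t : ℕ → ℝ := fun k => ∫ v in (-1 : ℝ)..1, M.m j v * M.p k v with ht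
  obtain ⟨C, hC⟩ := h5.approx
  obtain ⟨W, hW⟩ := (isCompact_cube d).exists_bound_of_continuousOn
    (Model.continuous_index h3).continuousOn
  have hbd : ∀ᶠ κ : ℕ in atTop, ∑ k ∈ Finset.range κ, t k ^ 2 ≤
      2 * (2 ^ d * (W + |C|) ^ 2) + 2 * ((2 ^ (d + 1) * |C|) ^ 2) := by
    filter_upwards [hC, eventually_ge_atTop 1] with κ hκ hκ1
    have hκ' : (1 : ℝ) ≤ κ := by exact_mod_cast hκ1
    have hrp : (κ : ℝ) ^ (-2 : ℝ) ≤ 1 := Real.rpow_le_one_of_one_le_of_nonpos hκ' (by norm_num)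
    have hrp0 : 0 ≤ (κ : ℝ) ^ (-2 : ℝ) := by positivity
    have hb : ∀ x ∈ cube d, |M.bias κ (θ0 κ) x| ≤ |C| * (κ : ℝ) ^ (-2 : ℝ) := fun x hx =>
      (hκ x hx).trans (mul_le_mul_of_nonneg_right (le_abs_self _) hrp0)
    have hin : ∀ x ∈ cube d, inner ℝ (M.P κ x) (θ0 κ) ^ 2 ≤ (W + |C|) ^ 2 := by
      intro x hx
      have h1 := (hb x hx).trans (mul_le_of_le_one_right (abs_nonneg C) hrp)
      have h2 := hW x hx
      rw [Model.bias, ← Model.index_eq hx] at h1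
      rw [Real.norm_eq_abs] at h2
      refine sq_le_sq' ?_ ?_ <;> linarith [abs_le.1 h1, (abs_le.1 h1).1, (abs_le.1 h1).2,
        (abs_le.1 h2).1, (abs_le.1 h2).2]
    obtain ⟨hi, hlo, -⟩ := h5.integral_inner_sq_cube κ (θ0 κ)
    have hθ : ‖θ0 κ‖ ^ 2 ≤ 2 ^ d * (W + |C|) ^ 2 := by
      refine hlo.trans ?_
      rw [← setIntegral_cube_const]
      exact setIntegral_mono_on hi (integrable_const _) (measurableSet_cube d) hin
    rw [EuclideanSpace.real_norm_sq_eq] at hθ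
    have hsum : ∑ k : Fin κ, θ0 κ (some (j, k)) ^ 2 ≤ ∑ a, θ0 κ a ^ 2 := by
      rw [← Finset.sum_image (s := Finset.univ) (f := fun a => θ0 κ a ^ 2)
        (g := fun k : Fin κ => (some (j, k) : Idx d κ))]
      · exact Finset.sum_le_univ_sum_of_nonneg fun a => sq_nonneg _
      · intro k _ k' _ hkk
        simpa using hkk
    rw [Finset.sum_range]
    calc ∑ k : Fin κ, t k ^ 2
        ≤ ∑ k : Fin κ, (2 * θ0 κ (some (j, k)) ^ 2 +
            2 * (2 ^ (d + 1) * (|C| * (κ : ℝ) ^ (-2 : ℝ))) ^ 2) := by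
          refine Finset.sum_le_sum fun k _ => ?_
          have h1 := abs_thetaSeries_sub_le h3 h5 (θ0 κ) hb (some (j, k))
          have h2 : M.thetaSeries κ (some (j, k)) = t k := rfl
          rw [h2] at h1
          have h4 := sq_le_sq' (by linarith [abs_le.1 h1 |>.1]) (abs_le.1 h1).2
          nlinarith [sq_nonneg (t k - 2 * θ0 κ (some (j, k)))]
      _ = 2 * ∑ k : Fin κ, θ0 κ (some (j, k)) ^ 2 +
            2 * ((2 ^ (d + 1) * |C|) ^ 2 * (κ * ((κ : ℝ) ^ (-2 : ℝ)) ^ 2)) := by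
          rw [Finset.sum_add_distrib, ← Finset.mul_sum]
          simp; ring
      _ ≤ 2 * (2 ^ d * (W + |C|) ^ 2) + 2 * ((2 ^ (d + 1) * |C|) ^ 2 * 1) := by
          gcongr
          · exact hsum.trans hθ
          · have h1 : (κ : ℝ) * ((κ : ℝ) ^ (-2 : ℝ)) ^ 2 = (κ : ℝ) ^ (-3 : ℝ) := by
              rw [← Real.rpow_natCast, ← Real.rpow_mul (by positivity)]
              nth_rewrite 1 [← Real.rpow_one (κ : ℝ)]
              rw [← Real.rpow_add (by positivity)]; norm_num
            rw [h1]
            exact Real.rpow_le_one_of_one_le_of_nonpos hκ' (by norm_num)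
      _ = _ := by ring
  have hsummable : Summable fun k => t k ^ 2 := by
    obtain ⟨κ₀, hκ₀⟩ := eventually_atTop.1 hbd
    refine summable_of_sum_range_le (fun k => sq_nonneg _) (fun n => ?_)
      (c := 2 * (2 ^ d * (W + |C|) ^ 2) + 2 * ((2 ^ (d + 1) * |C|) ^ 2))
    refine le_trans ?_ (hκ₀ (max n κ₀) (le_max_right _ _))
    exact Finset.sum_le_sum_of_subset_of_nonneg
      (Finset.range_subset_range.2 (le_max_left _ _)) fun _ _ _ => sq_nonneg _
  have h0 := hsummable.tendsto_atTop_zero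
  have h1 : Tendsto (fun k => √(t k ^ 2)) atTop (𝓝 0) := by
    simpa [Function.comp_def] using (Real.continuous_sqrt.tendsto 0).comp h0
  simp only [Real.sqrt_sq_eq_abs] at h1
  exact (tendsto_zero_iff_abs_tendsto_zero _).2 h1

/-- The series coefficients stay uniformly away from the boundary of the parameter set. -/
lemma exists_thetaSeries_margin (h3 : AssumptionA3 M) (h5 : AssumptionA5 M Cθ θ0) (hd : 0 < d) :
    ∃ ρ, 0 < ρ ∧ ∀ κ, 1 ≤ κ → ∀ a, |M.thetaSeries κ a| ≤ Cθ - ρ := by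
  have hlt : ∀ κ, 1 ≤ κ → ∀ a, |M.thetaSeries κ a| < Cθ := fun κ hκ a =>
    abs_lt_of_mem_interior_Theta (h5.interior κ hκ) a
  have hj : ∀ j : Fin d, ∃ ρ, 0 < ρ ∧
      ∀ k : ℕ, |∫ v in (-1 : ℝ)..1, M.m j v * M.p k v| ≤ Cθ - ρ := fun j =>
    exists_pos_margin (tendsto_thetaSeries h3 h5 j) fun k =>
      hlt (k + 1) (by omega) (some (j, ⟨k, by omega⟩))
  choose ρ hρ hle using hj
  have hmu := hlt 1 le_rfl none
  have hne : Nonempty (Fin d) := ⟨⟨0, hd⟩⟩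
  refine ⟨min (Cθ - |M.mu|) (Finset.univ.inf' Finset.univ_nonempty ρ), lt_min ?_ ?_, ?_⟩
  · have : |M.mu| < Cθ := hmu
    linarith
  · rw [Finset.lt_inf'_iff]; exact fun j _ => hρ j
  · rintro κ hκ (_ | ⟨j, k⟩)
    · have h1 : M.thetaSeries κ none = M.mu := rfl
      rw [h1]
      linarith [min_le_left (Cθ - |M.mu|) (Finset.univ.inf' Finset.univ_nonempty ρ)]
    · have h1 := min_le_right (Cθ - |M.mu|) (Finset.univ.inf' Finset.univ_nonempty ρ)
      have h2 := Finset.inf'_le ρ (Finset.mem_univ j)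
      have h4 : |M.thetaSeries κ (some (j, k))| ≤ Cθ - ρ j := hle j k
      linarith

end Basis

/-! ### Conditional exponential moments of truncated noise. -/

section CondMoments

/-- No lower bound on `x` is required, which is why the noise has to be truncated from above only.
-/
lemma exp_le_one_add_self_add_sq {x : ℝ} (hx : x ≤ 1) : Real.exp x ≤ 1 + x + x ^ 2 := by
  rcases le_or_gt (-1) x with h | h
  · have := (abs_le.1 (Real.abs_exp_sub_one_sub_id_le (abs_le.2 ⟨h, hx⟩))).2
    linarith
  · have : Real.exp x ≤ 1 := Real.exp_le_one_iff.2 (by linarith)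
    nlinarith

variable {E 𝒴 : Type*} [MeasurableSpace E] [MeasurableSpace 𝒴]

/-- The condition on cylinder sets says that the first marginal of h·ν is dominated by C times the
first marginal of ν. Domination of measures passes to integrals of all nonnegative g. -/
lemma lintegral_fst_mul_le {ν : Measure (E × 𝒴)} [IsFiniteMeasure ν] {h : E × 𝒴 → ℝ≥0∞}
    (hh : Measurable h) {C : ℝ≥0∞}
    (hset : ∀ A : Set E, MeasurableSet A →
      ∫⁻ z in Prod.fst ⁻¹' A, h z ∂ν ≤ C * ν (Prod.fst ⁻¹' A))
    {g : E → ℝ≥0∞} (hg : Measurable g) :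
    ∫⁻ z, g z.1 * h z ∂ν ≤ C * ∫⁻ z, g z.1 ∂ν := by
  have hle : (ν.withDensity h).map Prod.fst ≤ C • ν.map Prod.fst := by
    refine Measure.le_iff.2 fun A hA => ?_
    rw [Measure.map_apply measurable_fst hA, withDensity_apply _ (measurable_fst hA),
      Measure.smul_apply, Measure.map_apply measurable_fst hA]
    exact hset A hA
  have h1 : ∫⁻ z, g z.1 * h z ∂ν = ∫⁻ x, g x ∂((ν.withDensity h).map Prod.fst) := by
    rw [lintegral_map hg measurable_fst,
      lintegral_withDensity_eq_lintegral_mul _ hh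
        (show Measurable fun z : E × 𝒴 => g z.1 from hg.comp measurable_fst)]
    simp only [Pi.mul_apply, mul_comm]
  have h2 : C * ∫⁻ z, g z.1 ∂ν = ∫⁻ x, g x ∂(C • ν.map Prod.fst) := by
    rw [lintegral_smul_measure, lintegral_map hg measurable_fst, smul_eq_mul]
  rw [h1, h2]
  exact lintegral_mono' hle le_rfl

/-- The conditional exponential moments of a variable truncated from above. -/
lemma lintegral_fst_mul_exp_min_le {ν : Measure (E × 𝒴)} [IsProbabilityMeasure ν]
    {R : E × 𝒴 → ℝ} (hR : Measurable R) (hR2 : MemLp R 2 ν) {C l τ : ℝ}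
    (hmean : ∀ A : Set E, MeasurableSet A → ∫ z in Prod.fst ⁻¹' A, R z ∂ν = 0)
    (hvar : ∀ A : Set E, MeasurableSet A →
      ∫ z in Prod.fst ⁻¹' A, R z ^ 2 ∂ν ≤ C * ν.real (Prod.fst ⁻¹' A))
    (hl : 0 ≤ l) (hτ : 0 ≤ τ) (hlτ : l * τ ≤ 1) {g : E → ℝ≥0∞} (hg : Measurable g) :
    ∫⁻ z, g z.1 * ENNReal.ofReal (Real.exp (l * min (R z) τ)) ∂ν ≤
      ENNReal.ofReal (Real.exp (l ^ 2 * C)) * ∫⁻ z, g z.1 ∂ν := by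
  have hm : Measurable fun z => Real.exp (l * min (R z) τ) :=
    Real.measurable_exp.comp ((hR.min measurable_const).const_mul l)
  refine lintegral_fst_mul_le hm.ennreal_ofReal (fun A hA => ?_) hg
  set A' : Set (E × 𝒴) := Prod.fst ⁻¹' A
  have hRi : Integrable R ν := hR2.integrable (by norm_num)
  -- Where R ≥ τ, the majorant 1 + lτ + l²τ² only grows when τ is replaced by R. So the bound is in
  -- terms of the untruncated R, whose conditional mean is exactly zero.
  have hpt : ∀ z, Real.exp (l * min (R z) τ) ≤ 1 + l * R z + l ^ 2 * R z ^ 2 := by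
    intro z
    rcases le_total (R z) τ with h | h
    · rw [min_eq_left h]
      have := exp_le_one_add_self_add_sq ((mul_le_mul_of_nonneg_left h hl).trans hlτ)
      rw [mul_pow] at this
      exact this
    · rw [min_eq_right h]
      have := exp_le_one_add_self_add_sq hlτ
      rw [mul_pow] at this
      exact this.trans (by gcongr)
  have hint : IntegrableOn (fun z => Real.exp (l * min (R z) τ)) A' ν := by
    refine (Integrable.of_bound hm.aestronglyMeasurable (Real.exp 1) ?_).integrableOn
    refine Eventually.of_forall fun z => ?_
    rw [Real.norm_eq_abs, Real.abs_exp, Real.exp_le_exp]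
    exact (mul_le_mul_of_nonneg_left (min_le_right _ _) hl).trans hlτ
  rw [← ofReal_integral_eq_lintegral_ofReal hint (Eventually.of_forall fun z => (Real.exp_pos _).le),
    ← ofReal_measureReal, ← ENNReal.ofReal_mul (Real.exp_pos _).le]
  refine ENNReal.ofReal_le_ofReal ?_
  have h1 : Integrable (fun z => 1 + l * R z) ν := (integrable_const _).add (hRi.const_mul _)
  calc ∫ z in A', Real.exp (l * min (R z) τ) ∂ν
      ≤ ∫ z in A', (1 + l * R z + l ^ 2 * R z ^ 2) ∂ν :=
        setIntegral_mono hint ((h1.add (hR2.integrable_sq.const_mul _)).integrableOn) hpt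
    _ = ν.real A' + l ^ 2 * ∫ z in A', R z ^ 2 ∂ν := by
        rw [integral_add h1.integrableOn (hR2.integrable_sq.const_mul _).integrableOn,
          integral_add (integrable_const _).integrableOn (hRi.const_mul _).integrableOn,
          integral_const_mul, integral_const_mul, hmean A hA]
        simp
    _ ≤ ν.real A' + l ^ 2 * (C * ν.real A') := by gcongr; exact hvar A hA
    _ = (l ^ 2 * C + 1) * ν.real A' := by ring
    _ ≤ _ := by gcongr; exact Real.add_one_le_exp _

end CondMoments

/-! ### The disturbance and its conditional moments. -/

namespace Model

variable {d : ℕ} (M : Model d)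

/-- The disturbance, with the index extended continuously off the cube. -/
def resid (z : (Fin d → ℝ) × ℝ) : ℝ := z.2 - M.F (M.index z.1)

variable {M}

lemma resid_eq {z : (Fin d → ℝ) × ℝ} (hz : z.1 ∈ cube d) : M.resid z = M.U z := by
  rw [resid, U, index_eq hz]

lemma measurable_resid (h : AssumptionA3 M) : Measurable M.resid :=
  measurable_snd.sub (h.monotone.measurable.comp
    ((continuous_index h).measurable.comp measurable_fst))

end Model

section Resid

variable {d : ℕ} {M : Model d} {Ω : Type*} [MeasurableSpace Ω] {Pr : Measure Ω}
  {Z : ℕ → Ω → (Fin d → ℝ) × ℝ}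

lemma AssumptionA1.isProbabilityMeasure_law [IsProbabilityMeasure Pr] (h : AssumptionA1 M Pr Z) :
    IsProbabilityMeasure M.law := by
  rw [← h.law_eq 0]; exact Measure.isProbabilityMeasure_map (h.measurable 0).aemeasurable

lemma resid_ae_eq (h2 : AssumptionA2 M) : M.resid =ᵐ[M.law] M.U :=
  h2.ae_mem_cube.mono fun _ hz => Model.resid_eq hz

lemma integrable_resid_pow (h2 : AssumptionA2 M) {j : ℕ} (hj : 2 ≤ j) :
    Integrable (fun z => |M.resid z| ^ j) M.law := by
  obtain ⟨CU, hCU⟩ := h2.moments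
  refine (hCU j hj).1.congr ?_
  filter_upwards [resid_ae_eq h2] with z hz
  rw [hz]

lemma memLp_resid (h2 : AssumptionA2 M) (h3 : AssumptionA3 M) : MemLp M.resid 2 M.law := by
  rw [memLp_two_iff_integrable_sq (Model.measurable_resid h3).aestronglyMeasurable]
  simpa using integrable_resid_pow h2 le_rfl

lemma sigmaX_le (d : ℕ) : Model.sigmaX d ≤ (inferInstance : MeasurableSpace ((Fin d → ℝ) × ℝ)) :=
  measurable_fst.comap_le

lemma condExp_resid [IsProbabilityMeasure Pr] (h1 : AssumptionA1 M Pr Z) (h2 : AssumptionA2 M) :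
    condExp (Model.sigmaX d) M.law M.resid =ᵐ[M.law] 0 := by
  have := h1.isProbabilityMeasure_law
  set Y : (Fin d → ℝ) × ℝ → ℝ := fun z => z.2
  have hY : M.resid =ᵐ[M.law] Y - condExp (Model.sigmaX d) M.law Y := by
    filter_upwards [h1.cond_mean, resid_ae_eq h2] with z hz hz2
    rw [hz2, Pi.sub_apply, hz]
    rfl
  have h3 := condExp_sub (m := Model.sigmaX d) h1.integrable
    (integrable_condExp (m := Model.sigmaX d) (μ := M.law) (f := Y))
  rw [condExp_of_stronglyMeasurable (sigmaX_le d) stronglyMeasurable_condExp integrable_condExp]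
    at h3
  refine ((condExp_congr_ae hY).trans h3).trans ?_
  rw [sub_self]

lemma integral_mul_resid [IsProbabilityMeasure Pr] (h1 : AssumptionA1 M Pr Z)
    (h2 : AssumptionA2 M) (h3 : AssumptionA3 M) {g : (Fin d → ℝ) → ℝ} (hg : Measurable g)
    {B : ℝ} (hB : ∀ x ∈ cube d, |g x| ≤ B) : ∫ z, g z.1 * M.resid z ∂M.law = 0 := by
  have := h1.isProbabilityMeasure_law
  have hR : Integrable M.resid M.law := (memLp_resid h2 h3).integrable (by norm_num)
  have hgm : StronglyMeasurable[Model.sigmaX d] fun z : (Fin d → ℝ) × ℝ => g z.1 :=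
    (hg.comp (comap_measurable Prod.fst)).stronglyMeasurable
  have hint : Integrable (fun z => g z.1 * M.resid z) M.law := by
    refine hR.bdd_mul (c := B) (hg.comp measurable_fst).aestronglyMeasurable ?_
    filter_upwards [h2.ae_mem_cube] with z hz using hB _ hz
  rw [← integral_condExp (sigmaX_le d)]
  have h4 := condExp_mul_of_stronglyMeasurable_left (μ := M.law) hgm hint hR
  have h5 : condExp (Model.sigmaX d) M.law (fun z => g z.1 * M.resid z) =ᵐ[M.law] 0 := by
    refine h4.trans ?_
    filter_upwards [condExp_resid h1 h2] with z hz
    simp [hz]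
  rw [integral_congr_ae h5]; simp

lemma exists_integral_mul_resid_sq_le [IsProbabilityMeasure Pr] (h1 : AssumptionA1 M Pr Z)
    (h2 : AssumptionA2 M) (h3 : AssumptionA3 M) :
    ∃ CV : ℝ, 0 < CV ∧ ∀ (g : (Fin d → ℝ) → ℝ) (B : ℝ), Measurable g → (∀ x, 0 ≤ g x) →
      (∀ x ∈ cube d, |g x| ≤ B) →
      ∫ z, g z.1 * M.resid z ^ 2 ∂M.law ≤ CV * ∫ z, g z.1 ∂M.law := by
  have := h1.isProbabilityMeasure_law
  obtain ⟨cV, CV, hcV, hV⟩ := h2.cond_var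
  have hCV : 0 < CV := by
    obtain ⟨z, hz⟩ := hV.exists
    exact hcV.trans_le (hz.1.trans hz.2)
  refine ⟨CV, hCV, fun g B hg hg0 hB => ?_⟩
  have hR : Integrable (fun z => M.resid z ^ 2) M.law := (memLp_resid h2 h3).integrable_sq
  have hgm : StronglyMeasurable[Model.sigmaX d] fun z : (Fin d → ℝ) × ℝ => g z.1 :=
    (hg.comp (comap_measurable Prod.fst)).stronglyMeasurable
  have hbd : ∀ᵐ z ∂M.law, ‖g z.1‖ ≤ B := by
    filter_upwards [h2.ae_mem_cube] with z hz using hB _ hz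
  have hint : Integrable (fun z => g z.1 * M.resid z ^ 2) M.law :=
    hR.bdd_mul (c := B) (hg.comp measurable_fst).aestronglyMeasurable hbd
  have hgi : Integrable (fun z => g z.1) M.law :=
    Integrable.of_bound (hg.comp measurable_fst).aestronglyMeasurable B hbd
  -- The conditional mean of U is zero, so its conditional variance is the conditional second
  -- moment.
  have hcv : condExp (Model.sigmaX d) M.law (fun z => M.resid z ^ 2) =ᵐ[M.law] M.condVarU := by
    refine condExp_congr_ae ?_
    have hUR : condExp (Model.sigmaX d) M.law M.U =ᵐ[M.law] 0 :=
      (condExp_congr_ae (resid_ae_eq h2).symm).trans (condExp_resid h1 h2)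
    filter_upwards [hUR, resid_ae_eq h2] with z hz hz2
    simp [hz, hz2]
  have h4 := condExp_mul_of_stronglyMeasurable_left (μ := M.law) hgm hint hR
  rw [← integral_condExp (sigmaX_le d), ← integral_const_mul]
  refine integral_mono_ae integrable_condExp (hgi.const_mul _) ?_
  filter_upwards [h4, hcv, hV] with z hz hz2 hz3
  refine hz.trans_le ?_
  simp only [Pi.mul_apply]
  rw [hz2, mul_comm]
  exact mul_le_mul_of_nonneg_right hz3.2 (hg0 _)

end Resid

/-! ### The basic inequality of least squares. -/

lemma mean_abs_mul_le {n : ℕ} (x y : Fin n → ℝ) {X Y : ℝ} (hX : 0 ≤ X) (hY : 0 ≤ Y)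
    (hx : (n : ℝ)⁻¹ * ∑ i, x i ^ 2 ≤ X ^ 2) (hy : (n : ℝ)⁻¹ * ∑ i, y i ^ 2 ≤ Y ^ 2) :
    (n : ℝ)⁻¹ * ∑ i, |x i * y i| ≤ X * Y := by
  refine abs_le_of_sq_le_sq' (a := (n : ℝ)⁻¹ * ∑ i, |x i * y i|) ?_ (mul_nonneg hX hY) |>.2
  have h1 := Finset.sum_mul_sq_le_sq_mul_sq Finset.univ (fun i => |x i|) fun i => |y i|
  simp only [sq_abs] at h1
  calc ((n : ℝ)⁻¹ * ∑ i, |x i * y i|) ^ 2 = ((n : ℝ)⁻¹) ^ 2 * (∑ i, |x i| * |y i|) ^ 2 := by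
        simp only [abs_mul]; ring
    _ ≤ ((n : ℝ)⁻¹) ^ 2 * ((∑ i, x i ^ 2) * ∑ i, y i ^ 2) := by gcongr
    _ = ((n : ℝ)⁻¹ * ∑ i, x i ^ 2) * ((n : ℝ)⁻¹ * ∑ i, y i ^ 2) := by ring
    _ ≤ X ^ 2 * Y ^ 2 := by
        gcongr
    _ = _ := by ring

/-- The basic inequality of least squares for a monotone link function: outside of the interval
`[a, b]` nothing but monotonicity is used. -/
lemma sum_min_sq_le_of_basic_ineq {F : ℝ → ℝ} (hF : Monotone F) {W : Set ℝ} {δ c C a b : ℝ}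
    (hL : LinkRegular F W δ c C a b) {n : ℕ} (hn : 0 < n) {w u v v0 : Fin n → ℝ} {τ β s : ℝ}
    (hw : ∀ i, w i ∈ W) (hu : ∀ i, |u i| ≤ τ) (hv0 : ∀ i, |v0 i - w i| ≤ β) (hβ : β ≤ δ)
    (hτ : 0 ≤ τ)
    (hmin : ∑ i, (F (w i) + u i - F (v i)) ^ 2 ≤ ∑ i, (F (w i) + u i - F (v0 i)) ^ 2)
    (hs : ∀ q, |∑ i, if q < v i then u i else 0| ≤ s)
    (hs0 : ∀ q, |∑ i, if q < v0 i then u i else 0| ≤ s) :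
    ∑ i, (c * min |v i - w i| δ) ^ 2 ≤ n * (C * β) ^ 2 + 4 * s * (F b - F a + 2 * τ) := by
  have hδ := hL.delta_pos
  have hwa : ∀ i, F a ≤ F (w i) := fun i => hF (by linarith [hL.lo _ (hw i)])
  have hwb : ∀ i, F (w i) ≤ F b := fun i => hF (by linarith [hL.hi _ (hw i)])
  have hab : F a ≤ F b := (hwa ⟨0, hn⟩).trans (hwb ⟨0, hn⟩)
  -- F is clipped to an interval that contains every response F(w i) + u i. Clipping can only
  -- decrease the squared errors at `v`, and it does not affect `v0`, whose values stay in [a, b].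
  set G : ℝ → ℝ := fun t => max (F a - τ) (min (F b + τ) (F t)) with hG
  have hGm : Monotone G := fun x y hxy => max_le_max le_rfl (min_le_min le_rfl (hF hxy))
  have hGlo : ∀ t, F a - τ ≤ G t := fun t => le_max_left _ _
  have hGhi : ∀ t, G t ≤ F b + τ := fun t => max_le (by linarith) (min_le_left _ _)
  have hGF : ∀ t, a ≤ t → t ≤ b → G t = F t := fun t h1 h2 => by
    have h3 := hF h1
    have h4 := hF h2
    simp only [hG]
    rw [min_eq_right (by linarith), max_eq_right (by linarith)]
  have hGv0 : ∀ i, G (v0 i) = F (v0 i) := fun i => by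
    have := abs_le.1 ((hv0 i).trans hβ)
    exact hGF _ (by linarith [hL.lo _ (hw i)]) (by linarith [hL.hi _ (hw i)])
  have hproj : ∀ i, (F (w i) + u i - G (v i)) ^ 2 ≤ (F (w i) + u i - F (v i)) ^ 2 := by
    intro i
    have h1 := abs_le.1 (hu i)
    rw [sq_le_sq]
    simp only [hG]
    rcases le_total (F (v i)) (F b + τ) with h2 | h2
    · rw [min_eq_right h2]
      rcases le_total (F a - τ) (F (v i)) with h3 | h3
      · rw [max_eq_right h3]
      · rw [max_eq_left h3, abs_of_nonneg (by linarith [hwa i]),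
          abs_of_nonneg (by linarith [hwa i])]
        linarith
    · rw [min_eq_left h2, max_eq_right (by linarith), abs_of_nonpos (by linarith [hwb i]),
        abs_of_nonpos (by linarith [hwb i])]
      linarith
  have hn1 := abs_le.1 (abs_sum_mul_monotone_le v u hGm hGlo hGhi hs)
  have hn2 := abs_le.1 (abs_sum_mul_monotone_le v0 u hGm hGlo hGhi hs0)
  have hbasic : ∑ i, (G (v i) - F (w i)) ^ 2 ≤ ∑ i, (G (v0 i) - F (w i)) ^ 2 +
      2 * (∑ i, u i * (G (v i) - (F a - τ)) - ∑ i, u i * (G (v0 i) - (F a - τ))) := by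
    have h1 : ∑ i, (F (w i) + u i - G (v i)) ^ 2 ≤ ∑ i, (F (w i) + u i - G (v0 i)) ^ 2 := by
      simp only [hGv0]
      exact (Finset.sum_le_sum fun i _ => hproj i).trans hmin
    have h2 : ∀ y : Fin n → ℝ, ∑ i, (F (w i) + u i - G (y i)) ^ 2 =
        ∑ i, (G (y i) - F (w i)) ^ 2 - 2 * ∑ i, u i * (G (y i) - (F a - τ)) +
        ∑ i, (u i ^ 2 + 2 * u i * (F (w i) - (F a - τ))) := by
      intro y
      rw [Finset.mul_sum, ← Finset.sum_sub_distrib, ← Finset.sum_add_distrib]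
      exact Finset.sum_congr rfl fun i _ => by ring
    rw [h2, h2] at h1
    linarith
  -- By monotonicity `v i` may be moved towards `w i` until their distance is at most δ; there G =
  -- F, and F grows at rate c.
  have hgrow : ∀ i, (c * min |v i - w i| δ) ^ 2 ≤ (G (v i) - F (w i)) ^ 2 := by
    intro i
    have hc := hL.c_pos
    have hmin0 : 0 ≤ min |v i - w i| δ := le_min (abs_nonneg _) hδ.le
    rw [sq_le_sq, abs_of_nonneg (mul_nonneg hc.le hmin0)]
    rcases le_total (w i) (v i) with h | h
    · rw [abs_of_nonneg (sub_nonneg.2 h)]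
      have h1 := hL.growth_right _ (hw i) (w i + min (v i - w i) δ)
        (by rw [abs_of_nonneg (sub_nonneg.2 h)] at hmin0; linarith)
        (by linarith [min_le_right (v i - w i) δ])
      have h2 : G (w i + min (v i - w i) δ) ≤ G (v i) :=
        hGm (by linarith [min_le_left (v i - w i) δ])
      rw [hGF _ (by
          rw [abs_of_nonneg (sub_nonneg.2 h)] at hmin0
          linarith [hL.lo _ (hw i)])
        (by linarith [hL.hi _ (hw i), min_le_right (v i - w i) δ])] at h2
      refine le_trans ?_ (le_abs_self _)
      rw [add_sub_cancel_left] at h1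
      linarith
    · rw [abs_of_nonpos (sub_nonpos.2 h), neg_sub]
      rw [abs_of_nonpos (sub_nonpos.2 h), neg_sub] at hmin0
      have h1 := hL.growth_left _ (hw i) (w i - min (w i - v i) δ)
        (by linarith) (by linarith [min_le_right (w i - v i) δ])
      have h2 : G (v i) ≤ G (w i - min (w i - v i) δ) :=
        hGm (by linarith [min_le_left (w i - v i) δ])
      rw [hGF (w i - min (w i - v i) δ) (by linarith [hL.lo _ (hw i), min_le_right (w i - v i) δ])
        (by linarith [hL.hi _ (hw i)])] at h2
      refine le_trans ?_ (neg_le_abs _)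
      rw [sub_sub_cancel] at h1
      linarith
  have hbias : ∑ i, (G (v0 i) - F (w i)) ^ 2 ≤ n * (C * β) ^ 2 := by
    calc ∑ i, (G (v0 i) - F (w i)) ^ 2 ≤ ∑ _i : Fin n, (C * β) ^ 2 := by
          refine Finset.sum_le_sum fun i _ => ?_
          rw [hGv0]
          refine sq_le_sq.2 (((hL.lip _ (hw i) _ ((hv0 i).trans hβ)).trans ?_).trans
            (le_abs_self _))
          have hC := hL.one_le_C
          have := hv0 i
          gcongr
      _ = _ := by simp
  calc _ ≤ _ := Finset.sum_le_sum fun i _ => hgrow i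
    _ ≤ _ := hbasic
    -- The two noise sums are each at most s(F b - F a + 2τ) and enter with a factor 2, hence the
    -- constant 4.
    _ ≤ _ := by linarith [hn1.1, hn1.2, hn2.1, hn2.2]

/-! ### Deterministic inequalities: truncated quadratic forms and expanded normal equations. -/

section Hilbert

variable {V : Type*} [NormedAddCommGroup V] [InnerProductSpace ℝ V]

/-- A truncated empirical quadratic form controls the norm of its argument as soon as it is of
smaller order than the inverse of the squared norm of the regressors. -/
lemma norm_sq_le_of_sum_min_sq_le {n : ℕ} (hn : 0 < n) {P : Fin n → V} {D : V} {e b : Fin n → ℝ}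
    {δ c g ζ β r : ℝ} (hδ : 0 < δ) (hc : 0 < c)
    (he : ∀ i, e i = inner ℝ (P i) D - b i) (hb : ∀ i, |b i| ≤ β)
    (hP : ∀ i, ‖P i‖ ^ 2 ≤ ζ)
    (hgram : g * ‖D‖ ^ 2 ≤ (n : ℝ)⁻¹ * ∑ i, inner ℝ (P i) D ^ 2)
    (hr : ∑ i, (c * min |e i| δ) ^ 2 ≤ n * r)
    (hsmall : (2 * (r / c ^ 2) + 2 * β ^ 2) * ζ < g * δ ^ 2) :
    g * ‖D‖ ^ 2 ≤ 2 * (r / c ^ 2) + 2 * β ^ 2 := by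
  have hn' : (0 : ℝ) < n := by exact_mod_cast hn
  have hβ : 0 ≤ β := (abs_nonneg _).trans (hb ⟨0, hn⟩)
  have hζ : 0 ≤ ζ := (sq_nonneg _).trans (hP ⟨0, hn⟩)
  have hr0 : 0 ≤ r := by
    have : 0 ≤ n * r := (Finset.sum_nonneg fun i _ => sq_nonneg _).trans hr
    exact nonneg_of_mul_nonneg_right this hn'
  set ρ := 2 * (r / c ^ 2) + 2 * β ^ 2 with hρ
  have hmin : (n : ℝ)⁻¹ * ∑ i, (min |inner ℝ (P i) D| δ) ^ 2 ≤ ρ := by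
    have h1 : ∀ i, (min |inner ℝ (P i) D| δ) ^ 2 ≤
        2 / c ^ 2 * (c * min |e i| δ) ^ 2 + 2 * β ^ 2 := by
      intro i
      have h2 : min |inner ℝ (P i) D| δ ≤ min |e i| δ + β := by
        have h3 : |inner ℝ (P i) D| ≤ |e i| + β := by
          have : inner ℝ (P i) D = e i + b i := by rw [he]; ring
          rw [this]
          exact (abs_add_le _ _).trans (by linarith [hb i])
        rcases le_total |e i| δ with h4 | h4
        · rw [min_eq_left h4]; exact (min_le_left _ _).trans h3
        · rw [min_eq_right h4]; exact (min_le_right _ _).trans (by linarith)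
      have h3 : 0 ≤ min |inner ℝ (P i) D| δ := le_min (abs_nonneg _) hδ.le
      calc (min |inner ℝ (P i) D| δ) ^ 2 ≤ (min |e i| δ + β) ^ 2 := by gcongr
        _ ≤ 2 * (min |e i| δ) ^ 2 + 2 * β ^ 2 := by
            nlinarith [sq_nonneg (min |e i| δ - β)]
        _ = _ := by field_simp
    calc (n : ℝ)⁻¹ * ∑ i, (min |inner ℝ (P i) D| δ) ^ 2
        ≤ (n : ℝ)⁻¹ * ∑ i, (2 / c ^ 2 * (c * min |e i| δ) ^ 2 + 2 * β ^ 2) := by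
          gcongr with i _
          exact h1 i
      _ = (n : ℝ)⁻¹ * (2 / c ^ 2 * ∑ i, (c * min |e i| δ) ^ 2 + n * (2 * β ^ 2)) := by
          rw [Finset.sum_add_distrib, ← Finset.mul_sum]; simp
      _ ≤ (n : ℝ)⁻¹ * (2 / c ^ 2 * (n * r) + n * (2 * β ^ 2)) := by gcongr
      _ = ρ := by rw [hρ]; field_simp
  have hle : ∀ i, inner ℝ (P i) D ^ 2 ≤ ζ * ‖D‖ ^ 2 := fun i => by
    have h1 := abs_real_inner_le_norm (P i) D
    calc inner ℝ (P i) D ^ 2 = |inner ℝ (P i) D| ^ 2 := (sq_abs _).symm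
      _ ≤ (‖P i‖ * ‖D‖) ^ 2 := by gcongr
      _ = ‖P i‖ ^ 2 * ‖D‖ ^ 2 := by ring
      _ ≤ _ := by gcongr; exact hP i
  -- All |P_i'D| are at most √ζ‖D‖. If this is below δ, the truncation is void and the claim
  -- follows. Otherwise truncation costs at most the factor δ²/(ζ‖D‖²), so ‖D‖² cancels and the
  -- smallness assumption is contradicted.
  rcases le_or_gt (ζ * ‖D‖ ^ 2) (δ ^ 2) with h | h
  · refine hgram.trans (le_trans (le_of_eq ?_) hmin)
    congr 1
    refine Finset.sum_congr rfl fun i _ => ?_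
    rw [min_eq_left (abs_le_of_sq_le_sq ((hle i).trans h) hδ.le), sq_abs]
  · exfalso
    have hD : 0 < ζ * ‖D‖ ^ 2 := lt_trans (by positivity) h
    have h1 : ∀ i, δ ^ 2 * inner ℝ (P i) D ^ 2 ≤
        (ζ * ‖D‖ ^ 2) * (min |inner ℝ (P i) D| δ) ^ 2 := by
      intro i
      rcases le_total |inner ℝ (P i) D| δ with h4 | h4
      · rw [min_eq_left h4, sq_abs]; gcongr
      · rw [min_eq_right h4, mul_comm]
        exact mul_le_mul_of_nonneg_right (hle i) (sq_nonneg _)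
    have h2 : δ ^ 2 * (g * ‖D‖ ^ 2) ≤ (ζ * ‖D‖ ^ 2) * ρ := by
      calc δ ^ 2 * (g * ‖D‖ ^ 2) ≤ δ ^ 2 * ((n : ℝ)⁻¹ * ∑ i, inner ℝ (P i) D ^ 2) := by gcongr
        _ = (n : ℝ)⁻¹ * ∑ i, δ ^ 2 * inner ℝ (P i) D ^ 2 := by rw [← Finset.mul_sum]; ring
        _ ≤ (n : ℝ)⁻¹ * ∑ i, (ζ * ‖D‖ ^ 2) * (min |inner ℝ (P i) D| δ) ^ 2 := by
            refine mul_le_mul_of_nonneg_left (Finset.sum_le_sum fun i _ => h1 i) (by positivity)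
        _ = (ζ * ‖D‖ ^ 2) * ((n : ℝ)⁻¹ * ∑ i, (min |inner ℝ (P i) D| δ) ^ 2) := by
            rw [← Finset.mul_sum]; ring
        _ ≤ _ := by gcongr
    have hD2 : 0 < ‖D‖ ^ 2 := pos_of_mul_pos_right hD hζ
    have h3 : (g * δ ^ 2) * ‖D‖ ^ 2 ≤ (ρ * ζ) * ‖D‖ ^ 2 := by linarith
    exact absurd (le_of_mul_le_mul_right h3 hD2) (not_le.2 hsmall)

lemma sum_mul_deriv_eq_zero {F : ℝ → ℝ} {n : ℕ} {y v p : Fin n → ℝ}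
    (hF : ∀ i, DifferentiableAt ℝ F (v i))
    (hmin : IsLocalMin (fun t : ℝ => ∑ i, (y i - F (v i + t * p i)) ^ 2) 0) :
    ∑ i, (y i - F (v i)) * deriv F (v i) * p i = 0 := by
  have hder : HasDerivAt (fun t : ℝ => ∑ i, (y i - F (v i + t * p i)) ^ 2)
      (∑ i, -2 * ((y i - F (v i)) * deriv F (v i) * p i)) 0 := by
    refine HasDerivAt.fun_sum fun i _ => ?_
    have h1 : HasDerivAt (fun t : ℝ => v i + t * p i) (p i) 0 := by
      simpa using ((hasDerivAt_id (0 : ℝ)).mul_const (p i)).const_add (v i)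
    have h2 : HasDerivAt F (deriv F (v i)) (v i + 0 * p i) := by
      simpa using (hF i).hasDerivAt
    have h3 := ((h2.comp 0 h1).const_sub (y i)).pow 2
    refine h3.congr_deriv ?_
    simp
    ring
  have := hmin.hasDerivAt_eq_zero hder
  rw [← Finset.mul_sum] at this
  linarith

set_option maxHeartbeats 1000000 in
/-- First-order expansion of the normal equations of nonlinear least squares. -/
lemma abs_normal_equations_remainder_le {F : ℝ → ℝ} {W : Set ℝ} {δ c C a b : ℝ}
    (hL : LinkRegular F W δ c C a b) {n : ℕ} {P : Fin n → V} {D : V}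
    {w U bi : Fin n → ℝ} {β ζ K α α' : ℝ} (hw : ∀ i, w i ∈ W) (hβ : 0 ≤ β) (hζ : 0 ≤ ζ)
    (hbi : ∀ i, |bi i| ≤ β) (hP : ∀ i, ‖P i‖ ≤ ζ) (hsmall : ζ * ‖D‖ + β ≤ δ) (hK : 1 ≤ K)
    (hfoc : ∀ u, ∑ i, (F (w i) + U i - F (w i + (inner ℝ (P i) D - bi i))) *
      deriv F (w i + (inner ℝ (P i) D - bi i)) * inner ℝ (P i) u = 0)
    (hG : ∀ u, (n : ℝ)⁻¹ * ∑ i, inner ℝ (P i) u ^ 2 ≤ K * ‖u‖ ^ 2)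
    (hGU : ∀ u, (n : ℝ)⁻¹ * ∑ i, U i ^ 2 * inner ℝ (P i) u ^ 2 ≤ K * ‖u‖ ^ 2)
    (hU : (n : ℝ)⁻¹ * ∑ i, U i ^ 2 ≤ K) (u : V)
    (hM : |(n : ℝ)⁻¹ * ∑ i, U i * deriv (deriv F) (w i) * inner ℝ (P i) D * inner ℝ (P i) u| ≤
      α * ‖D‖ * ‖u‖)
    (hMb : |(n : ℝ)⁻¹ * ∑ i, U i * deriv (deriv F) (w i) * bi i * inner ℝ (P i) u| ≤ α' * ‖u‖) :
    |(n : ℝ)⁻¹ * ∑ i, deriv F (w i) ^ 2 * inner ℝ (P i) D * inner ℝ (P i) u -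
      (n : ℝ)⁻¹ * ∑ i, deriv F (w i) * U i * inner ℝ (P i) u -
      (n : ℝ)⁻¹ * ∑ i, deriv F (w i) ^ 2 * bi i * inner ℝ (P i) u| ≤
      (α * ‖D‖ + α' + 8 * C ^ 2 * K ^ 2 * (ζ * ‖D‖ + β) * (‖D‖ + β)) * ‖u‖ := by
  set e : Fin n → ℝ := fun i => inner ℝ (P i) D - bi i with he
  set η := ζ * ‖D‖ + β with hη
  have hC := hL.one_le_C
  have hη0 : 0 ≤ η := by positivity
  have heη : ∀ i, |e i| ≤ η := fun i => by
    calc |e i| ≤ |inner ℝ (P i) D| + |bi i| := abs_sub _ _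
      _ ≤ ‖P i‖ * ‖D‖ + β := add_le_add (abs_real_inner_le_norm _ _) (hbi i)
      _ ≤ η := by rw [hη]; gcongr; exact hP i
  have he2 : ∀ i, e i ^ 2 ≤ 2 * inner ℝ (P i) D ^ 2 + 2 * β ^ 2 := fun i => by
    have h1 : bi i ^ 2 ≤ β ^ 2 := sq_le_sq.2 ((hbi i).trans (le_abs_self _))
    have h2 : e i ^ 2 ≤ 2 * inner ℝ (P i) D ^ 2 + 2 * bi i ^ 2 := by
      simp only [he]; nlinarith [sq_nonneg (inner ℝ (P i) D + bi i)]
    linarith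
  -- The remainder after the linear term in the expansion of F' at `w i`; it multiplies the noise.
  set σ : Fin n → ℝ := fun i =>
    deriv F (w i + e i) - deriv F (w i) - deriv (deriv F) (w i) * e i with hσ
  -- Equal to (F(w + e) - F(w)) F'(w + e) - F'(w)² e, split so that both summands are visibly
  -- quadratic in e.
  set t : Fin n → ℝ := fun i =>
    deriv F (w i) * e i * (deriv F (w i + e i) - deriv F (w i)) +
      (F (w i + e i) - F (w i) - deriv F (w i) * e i) * deriv F (w i + e i) with ht
  have hew : ∀ i, |w i + e i - w i| ≤ δ := fun i => by
    rw [add_sub_cancel_left]; exact (heη i).trans hsmall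
  have hσle : ∀ i, |σ i| ≤ C * e i ^ 2 := fun i => by
    have := hL.taylor_deriv _ (hw i) _ (hew i)
    rwa [add_sub_cancel_left] at this
  have htle : ∀ i, |t i| ≤ 3 * C ^ 2 * e i ^ 2 := fun i => by
    have h1 := hL.taylor _ (hw i) _ (hew i)
    rw [add_sub_cancel_left] at h1
    have h2 := hL.deriv_hi _ (hw i) _ (hew i)
    have h3 := hL.deriv_hi _ (hw i) (w i) (by simpa using hL.delta_pos.le)
    have h4 : |deriv F (w i + e i) - deriv F (w i)| ≤ 2 * C * |e i| := by
      have h5 : deriv F (w i + e i) - deriv F (w i) = σ i + deriv (deriv F) (w i) * e i := by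
        simp only [hσ]; ring
      have h6 : |e i| ≤ 1 := ((heη i).trans hsmall).trans hL.delta_le_one
      have h7 : e i ^ 2 ≤ |e i| := by
        rw [← sq_abs]; nlinarith [abs_nonneg (e i)]
      have h8 := hL.deriv2_hi _ (hw i)
      calc _ ≤ |σ i| + |deriv (deriv F) (w i) * e i| := by rw [h5]; exact abs_add_le _ _
        _ ≤ C * |e i| + C * |e i| := by
            rw [abs_mul]
            exact add_le_add ((hσle i).trans (by gcongr)) (by gcongr)
        _ = _ := by ring
    calc |t i| ≤ |deriv F (w i)| * |e i| * |deriv F (w i + e i) - deriv F (w i)| +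
          |F (w i + e i) - F (w i) - deriv F (w i) * e i| * |deriv F (w i + e i)| := by
          rw [← abs_mul, ← abs_mul, ← abs_mul]; exact abs_add_le _ _
      _ ≤ C * |e i| * (2 * C * |e i|) + C * e i ^ 2 * C := by gcongr
      _ = 3 * C ^ 2 * e i ^ 2 := by rw [← sq_abs (e i)]; ring
  -- The first-order noise term U F''(w) e is kept apart and split into its D part and its bias
  -- part: both are to be controlled by the stochastic bounds `hM` and `hMb`, not by absolute
  -- values.
  have hid : (n : ℝ)⁻¹ * ∑ i, deriv F (w i) ^ 2 * inner ℝ (P i) D * inner ℝ (P i) u -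
      (n : ℝ)⁻¹ * ∑ i, deriv F (w i) * U i * inner ℝ (P i) u -
      (n : ℝ)⁻¹ * ∑ i, deriv F (w i) ^ 2 * bi i * inner ℝ (P i) u =
      (n : ℝ)⁻¹ * ∑ i, U i * deriv (deriv F) (w i) * inner ℝ (P i) D * inner ℝ (P i) u -
      (n : ℝ)⁻¹ * ∑ i, U i * deriv (deriv F) (w i) * bi i * inner ℝ (P i) u +
      (n : ℝ)⁻¹ * ∑ i, U i * σ i * inner ℝ (P i) u -
      (n : ℝ)⁻¹ * ∑ i, t i * inner ℝ (P i) u := by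
    have h1 := hfoc u
    have h2 : ∑ i, deriv F (w i) ^ 2 * inner ℝ (P i) D * inner ℝ (P i) u -
      ∑ i, deriv F (w i) * U i * inner ℝ (P i) u -
      ∑ i, deriv F (w i) ^ 2 * bi i * inner ℝ (P i) u =
      ∑ i, U i * deriv (deriv F) (w i) * inner ℝ (P i) D * inner ℝ (P i) u -
      ∑ i, U i * deriv (deriv F) (w i) * bi i * inner ℝ (P i) u +
      ∑ i, U i * σ i * inner ℝ (P i) u - ∑ i, t i * inner ℝ (P i) u -
      ∑ i, (F (w i) + U i - F (w i + e i)) * deriv F (w i + e i) * inner ℝ (P i) u := by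
      simp only [← Finset.sum_sub_distrib, ← Finset.sum_add_distrib]
      refine Finset.sum_congr rfl fun i _ => ?_
      simp only [hσ, ht, he]
      ring
    rw [h1, sub_zero] at h2
    simp only [← mul_sub, ← mul_add, h2]
  have hB : 0 ≤ ‖D‖ + β := by positivity
  have hPu : (n : ℝ)⁻¹ * ∑ i, inner ℝ (P i) u ^ 2 ≤ (K * ‖u‖) ^ 2 := by
    refine (hG u).trans ?_
    rw [mul_pow]
    gcongr
    nlinarith
  have hDβ : K * ‖D‖ ^ 2 * 2 + 2 * β ^ 2 * K ≤ (2 * K * (‖D‖ + β)) ^ 2 := by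
    have h1 : K * (2 * ‖D‖ ^ 2 + 2 * β ^ 2) ≤ K * (4 * (‖D‖ + β) ^ 2) := by
      gcongr
      nlinarith [norm_nonneg D, mul_nonneg (norm_nonneg D) hβ, sq_nonneg ‖D‖, sq_nonneg β]
    have h2 : K * (4 * (‖D‖ + β) ^ 2) ≤ K ^ 2 * (4 * (‖D‖ + β) ^ 2) := by
      gcongr
      nlinarith
    nlinarith
  have hee : (n : ℝ)⁻¹ * ∑ i, e i ^ 2 ≤ (2 * K * (‖D‖ + β)) ^ 2 := by
    refine le_trans ?_ hDβ
    calc (n : ℝ)⁻¹ * ∑ i, e i ^ 2 ≤ (n : ℝ)⁻¹ * ∑ i, (2 * inner ℝ (P i) D ^ 2 + 2 * β ^ 2) := by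
          gcongr with i _
          exact he2 i
      _ = ((n : ℝ)⁻¹ * ∑ i, inner ℝ (P i) D ^ 2) * 2 + 2 * β ^ 2 * ((n : ℝ)⁻¹ * n) := by
          rw [Finset.sum_add_distrib, ← Finset.mul_sum]; simp; ring
      _ ≤ K * ‖D‖ ^ 2 * 2 + 2 * β ^ 2 * K := by
          refine add_le_add (mul_le_mul_of_nonneg_right (hG D) zero_le_two)
            (mul_le_mul_of_nonneg_left (inv_mul_le_one.trans hK) (by positivity))
  have hUe : (n : ℝ)⁻¹ * ∑ i, (U i * e i) ^ 2 ≤ (2 * K * (‖D‖ + β)) ^ 2 := by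
    refine le_trans ?_ hDβ
    calc (n : ℝ)⁻¹ * ∑ i, (U i * e i) ^ 2
        ≤ (n : ℝ)⁻¹ * ∑ i, (2 * (U i ^ 2 * inner ℝ (P i) D ^ 2) + 2 * β ^ 2 * U i ^ 2) := by
          gcongr with i _
          rw [mul_pow]
          nlinarith [mul_le_mul_of_nonneg_left (he2 i) (sq_nonneg (U i))]
      _ = ((n : ℝ)⁻¹ * ∑ i, U i ^ 2 * inner ℝ (P i) D ^ 2) * 2 +
          2 * β ^ 2 * ((n : ℝ)⁻¹ * ∑ i, U i ^ 2) := by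
          rw [Finset.sum_add_distrib, ← Finset.mul_sum, ← Finset.mul_sum]; ring
      _ ≤ K * ‖D‖ ^ 2 * 2 + 2 * β ^ 2 * K := by
          exact add_le_add (mul_le_mul_of_nonneg_right (hGU D) zero_le_two)
            (mul_le_mul_of_nonneg_left hU (by positivity))
  have hKB : 0 ≤ 2 * K * (‖D‖ + β) := by positivity
  have hKu : 0 ≤ K * ‖u‖ := by positivity
  -- One factor |e| of the quadratic remainder is bounded by η in the supremum norm; the other is
  -- paired with P_i'u by the Cauchy–Schwarz inequality for empirical means.
  have hT1 : |(n : ℝ)⁻¹ * ∑ i, U i * σ i * inner ℝ (P i) u| ≤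
      C * η * (2 * K * (‖D‖ + β) * (K * ‖u‖)) := by
    rw [abs_mul, abs_of_nonneg (by positivity : (0 : ℝ) ≤ (n : ℝ)⁻¹)]
    calc (n : ℝ)⁻¹ * |∑ i, U i * σ i * inner ℝ (P i) u|
        ≤ (n : ℝ)⁻¹ * ∑ i, C * η * |U i * e i * inner ℝ (P i) u| := by
          gcongr
          refine (Finset.abs_sum_le_sum_abs _ _).trans (Finset.sum_le_sum fun i _ => ?_)
          have h1 : |σ i| ≤ C * η * |e i| := (hσle i).trans (by
            rw [← sq_abs, sq, mul_assoc]; gcongr; exact heη i)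
          calc |U i * σ i * inner ℝ (P i) u| = |U i| * |σ i| * |inner ℝ (P i) u| := by
                rw [abs_mul, abs_mul]
            _ ≤ |U i| * (C * η * |e i|) * |inner ℝ (P i) u| := by gcongr
            _ = _ := by rw [abs_mul, abs_mul]; ring
      _ = C * η * ((n : ℝ)⁻¹ * ∑ i, |U i * e i * inner ℝ (P i) u|) := by
          rw [← Finset.mul_sum]; ring
      _ ≤ _ := by
          exact mul_le_mul_of_nonneg_left (mean_abs_mul_le _ _ hKB hKu hUe hPu) (by positivity)
  have hT2 : |(n : ℝ)⁻¹ * ∑ i, t i * inner ℝ (P i) u| ≤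
      3 * C ^ 2 * η * (2 * K * (‖D‖ + β) * (K * ‖u‖)) := by
    rw [abs_mul, abs_of_nonneg (by positivity : (0 : ℝ) ≤ (n : ℝ)⁻¹)]
    calc (n : ℝ)⁻¹ * |∑ i, t i * inner ℝ (P i) u|
        ≤ (n : ℝ)⁻¹ * ∑ i, 3 * C ^ 2 * η * |e i * inner ℝ (P i) u| := by
          gcongr
          refine (Finset.abs_sum_le_sum_abs _ _).trans (Finset.sum_le_sum fun i _ => ?_)
          have h1 : |t i| ≤ 3 * C ^ 2 * η * |e i| := (htle i).trans (by
            rw [← sq_abs (e i), sq |e i|, mul_assoc _ η]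
            exact mul_le_mul_of_nonneg_left
              (mul_le_mul_of_nonneg_right (heη i) (abs_nonneg _)) (by positivity))
          calc |t i * inner ℝ (P i) u| = |t i| * |inner ℝ (P i) u| := abs_mul _ _
            _ ≤ 3 * C ^ 2 * η * |e i| * |inner ℝ (P i) u| := by gcongr
            _ = _ := by rw [abs_mul]; ring
      _ = 3 * C ^ 2 * η * ((n : ℝ)⁻¹ * ∑ i, |e i * inner ℝ (P i) u|) := by
          rw [← Finset.mul_sum]; ring
      _ ≤ _ := by
          exact mul_le_mul_of_nonneg_left (mean_abs_mul_le _ _ hKB hKu hee hPu) (by positivity)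
  rw [hid]
  have hX : 0 ≤ 2 * K * (‖D‖ + β) * (K * ‖u‖) := mul_nonneg hKB hKu
  generalize hXe : 2 * K * (‖D‖ + β) * (K * ‖u‖) = X at hX hT1 hT2
  have hCC : C * η * X ≤ C ^ 2 * η * X :=
    mul_le_mul_of_nonneg_right (mul_le_mul_of_nonneg_right (by nlinarith) hη0) hX
  -- The constant 8 is 2 · (1 + 3): the 2 comes from X, the 1 and the 3 from the two quadratic
  -- remainders.
  have hfin : (α * ‖D‖ + α' + 8 * C ^ 2 * K ^ 2 * η * (‖D‖ + β)) * ‖u‖ =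
      α * ‖D‖ * ‖u‖ + α' * ‖u‖ + C ^ 2 * η * X + 3 * C ^ 2 * η * X := by
    rw [← hXe]; ring
  rw [hfin]
  refine (abs_sub _ _).trans (add_le_add ((abs_add_le _ _).trans
    (add_le_add ((abs_sub _ _).trans (add_le_add hM hMb)) (hT1.trans hCC))) hT2)

end Hilbert

/-! ### Comparison of powers of n and the growth of κ. -/

section Rates

lemma eventually_mul_rpow_le (C : ℝ) {a b : ℝ} (hab : a < b) :
    ∀ᶠ n : ℕ in atTop, C * (n : ℝ) ^ a ≤ (n : ℝ) ^ b := by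
  have h1 : Tendsto (fun n : ℕ => (n : ℝ) ^ (b - a)) atTop atTop :=
    (tendsto_rpow_atTop (sub_pos.2 hab)).comp tendsto_natCast_atTop_atTop
  filter_upwards [h1.eventually_ge_atTop C, eventually_gt_atTop 0] with n hn hn0
  have hn' : (0 : ℝ) < n := by exact_mod_cast hn0
  calc C * (n : ℝ) ^ a ≤ (n : ℝ) ^ (b - a) * (n : ℝ) ^ a := by gcongr
    _ = (n : ℝ) ^ b := by rw [← Real.rpow_add hn', sub_add_cancel]

lemma eventually_mul_log_le (C : ℝ) {a c : ℝ} (ha : 0 < a) (hc : 0 < c) :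
    ∀ᶠ n : ℕ in atTop, C * Real.log n ≤ c * (n : ℝ) ^ a := by
  have h1 := (isLittleO_log_rpow_atTop ha).comp_tendsto tendsto_natCast_atTop_atTop
  have h2 := h1.bound (c := c / (|C| + 1)) (by positivity)
  filter_upwards [h2] with n hn
  simp only [Function.comp_apply, Real.norm_eq_abs] at hn
  rw [abs_of_nonneg (by positivity : 0 ≤ (n : ℝ) ^ a)] at hn
  have hC : 0 < |C| + 1 := by positivity
  calc C * Real.log n ≤ |C| * |Real.log n| := (le_abs_self _).trans_eq (abs_mul _ _)
    _ ≤ (|C| + 1) * (c / (|C| + 1) * (n : ℝ) ^ a) := by gcongr; linarith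
    _ = c * (n : ℝ) ^ a := by field_simp

/-- The exponent 4/15 + ν lies between 4/15 and 4/15 + 1/30 = 3/10. The lower bound makes the bias
small; the upper bound controls the dimension. -/
lemma AssumptionA6i.exists_bounds {κ : ℕ → ℕ} (h : AssumptionA6i κ) :
    ∃ c C : ℝ, 0 < c ∧ 1 ≤ C ∧ ∀ᶠ n : ℕ in atTop,
      c * (n : ℝ) ^ (4 / 15 : ℝ) ≤ κ n ∧ (κ n : ℝ) ≤ C * (n : ℝ) ^ (3 / 10 : ℝ) := by
  obtain ⟨Cκ, ν, hC, hν, hν', ht⟩ := h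
  refine ⟨Cκ / 2, max 1 (2 * Cκ), by positivity, le_max_left _ _, ?_⟩
  filter_upwards [ht.eventually (lt_mem_nhds (half_lt_self hC)),
    ht.eventually (gt_mem_nhds (show Cκ < 2 * Cκ by linarith)), eventually_ge_atTop 1]
    with n h1 h2 hn
  have hn' : (1 : ℝ) ≤ n := by exact_mod_cast hn
  have hpos : 0 < (n : ℝ) ^ (4 / 15 + ν) := by positivity
  rw [lt_div_iff₀ hpos] at h1
  rw [div_lt_iff₀ hpos] at h2
  constructor
  · refine le_trans ?_ h1.le
    gcongr
    linarith
  · refine h2.le.trans ?_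
    gcongr
    · exact le_max_right _ _
    · linarith

lemma AssumptionA6i.tendsto {κ : ℕ → ℕ} (h : AssumptionA6i κ) : Tendsto κ atTop atTop := by
  obtain ⟨c, C, hc, -, hκ⟩ := h.exists_bounds
  have h1 : Tendsto (fun n : ℕ => c * (n : ℝ) ^ (4 / 15 : ℝ)) atTop atTop :=
    ((tendsto_rpow_atTop (by norm_num)).comp tendsto_natCast_atTop_atTop).const_mul_atTop hc
  have h2 : Tendsto (fun n => (κ n : ℝ)) atTop atTop :=
    tendsto_atTop_mono' _ (hκ.mono fun n hn => hn.1) h1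
  exact tendsto_natCast_atTop_iff.1 h2

end Rates

/-! ### Events that hold eventually almost surely and with probability tending to one. -/

section HighProbability

variable {Ω : Type*} [MeasurableSpace Ω] {Pr : Measure Ω}

/-- The events `A n` occur eventually almost surely, and with probability tending to one. -/
def Whp (Pr : Measure Ω) (A : ℕ → Ω → Prop) : Prop :=
  (∀ᵐ ω ∂Pr, ∀ᶠ n in atTop, A n ω) ∧ Tendsto (fun n => Pr {ω | ¬ A n ω}) atTop (𝓝 0)

/-- The almost sure half is the Borel–Cantelli lemma; indices below `N`, where nothing is known, are
assigned the empty set. -/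
lemma whp_of_summable {A : ℕ → Ω → Prop} {f : ℕ → ℝ} (hf : Summable f)
    (h : ∀ᶠ n in atTop, Pr {ω | ¬ A n ω} ≤ ENNReal.ofReal (f n)) : Whp Pr A := by
  obtain ⟨N, hN⟩ := eventually_atTop.1 h
  constructor
  · have hsum : ∑' n, Pr (if N ≤ n then {ω | ¬ A n ω} else ∅) ≠ ∞ := by
      refine ne_top_of_le_ne_top hf.tsum_ofReal_ne_top (ENNReal.tsum_le_tsum fun n => ?_)
      split_ifs with hn
      · exact hN n hn
      · simp
    filter_upwards [ae_eventually_notMem hsum] with ω hω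
    filter_upwards [hω, eventually_ge_atTop N] with n hn hn2
    rw [if_pos hn2] at hn
    exact not_not.1 hn
  · refine tendsto_of_tendsto_of_tendsto_of_le_of_le' tendsto_const_nhds
      (h := fun n => ENNReal.ofReal (f n)) ?_ (Eventually.of_forall fun n => zero_le) h
    simpa using ENNReal.tendsto_ofReal hf.tendsto_atTop_zero

lemma whp_of_le_rpow_neg_two {A : ℕ → Ω → Prop} {C : ℝ}
    (h : ∀ᶠ n : ℕ in atTop, Pr {ω | ¬ A n ω} ≤ ENNReal.ofReal (C * (n : ℝ) ^ (-2 : ℝ))) :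
    Whp Pr A :=
  whp_of_summable ((Real.summable_nat_rpow.2 (by norm_num)).mul_left C) h

lemma Whp.and {A B : ℕ → Ω → Prop} (hA : Whp Pr A) (hB : Whp Pr B) :
    Whp Pr fun n ω => A n ω ∧ B n ω := by
  constructor
  · filter_upwards [hA.1, hB.1] with ω h1 h2 using h1.and h2
  · refine tendsto_of_tendsto_of_tendsto_of_le_of_le tendsto_const_nhds
      (by simpa using hA.2.add hB.2) (fun n => zero_le) fun n => ?_
    refine (measure_mono fun ω hω => ?_).trans (measure_union_le _ _)
    by_contra hc
    simp only [Set.mem_union, Set.mem_ofPred_eq, not_or, not_not] at hc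
    exact hω hc

lemma Whp.mono {A B : ℕ → Ω → Prop} (hA : Whp Pr A)
    (h : ∀ᶠ n in atTop, ∀ᵐ ω ∂Pr, A n ω → B n ω) : Whp Pr B := by
  obtain ⟨N, hN⟩ := eventually_atTop.1 h
  constructor
  · have h1 : ∀ᵐ ω ∂Pr, ∀ n, N ≤ n → A n ω → B n ω := by
      rw [ae_all_iff]
      intro n
      by_cases hn : N ≤ n
      · filter_upwards [hN n hn] with ω hω _ using hω
      · exact Eventually.of_forall fun ω h => absurd h hn
    filter_upwards [hA.1, h1] with ω h2 h3
    filter_upwards [h2, eventually_ge_atTop N] with n h4 h5 using h3 n h5 h4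
  · refine tendsto_of_tendsto_of_tendsto_of_le_of_le' tendsto_const_nhds hA.2
      (Eventually.of_forall fun n => zero_le) ?_
    filter_upwards [h] with n hn
    refine measure_mono_ae ?_
    filter_upwards [hn] with ω hω h1 h2 using h1 (hω h2)

end HighProbability

/-! ### High-probability events: bounded noise, half-space sums, empirical Gram matrix. -/

section Events

variable {d : ℕ} {M : Model d} {Cθ : ℝ} {θ0 : ∀ κ : ℕ, Coef d κ} {κ : ℕ → ℕ}
  {Ω : Type*} [MeasurableSpace Ω] {Pr : Measure Ω} [IsProbabilityMeasure Pr]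
  {Z : ℕ → Ω → (Fin d → ℝ) × ℝ}

/-- The sums of the disturbances over half-spaces of regressors are of smaller order. -/
def NoiseBounded (M : Model d) (κ n : ℕ) (z : ℕ → (Fin d → ℝ) × ℝ) : Prop :=
  ∀ (θ : Coef d κ) (q : ℝ), |∑ i : Fin n, if q < inner ℝ (M.P κ (z i).1) θ then
    M.resid (z i) else 0| ≤ (n : ℝ) ^ (67 / 100 : ℝ)

/-- Upper and lower bounds for the empirical Gram matrix of the regressors. -/
def GramBounded (M : Model d) (g G : ℝ) (κ n : ℕ) (z : ℕ → (Fin d → ℝ) × ℝ) : Prop :=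
  ∀ u : Coef d κ, g * ‖u‖ ^ 2 ≤ (n : ℝ)⁻¹ * ∑ i : Fin n, inner ℝ (M.P κ (z i).1) u ^ 2 ∧
    (n : ℝ)⁻¹ * ∑ i : Fin n, inner ℝ (M.P κ (z i).1) u ^ 2 ≤ G * ‖u‖ ^ 2

lemma whp_resid_le (h1 : AssumptionA1 M Pr Z) (h2 : AssumptionA2 M) (h3 : AssumptionA3 M) :
    Whp Pr fun n ω => ∀ i : Fin n, |M.resid (Z i ω)| ≤ (n : ℝ) ^ (1 / 100 : ℝ) := by
  have hp := h1.isProbabilityMeasure_law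
  -- Markov's inequality with the 400th moment turns the threshold n^{1/100} into n^{-4} per
  -- observation, so a union over n observations remains summable.
  set B := ∫ z, |M.resid z| ^ 400 ∂M.law with hB
  refine whp_of_le_rpow_neg_two (C := B) ?_
  filter_upwards [eventually_ge_atTop 1] with n hn
  have hn' : (1 : ℝ) ≤ n := by exact_mod_cast hn
  have hRm := Model.measurable_resid h3
  have hone : ∀ i, Pr {ω | (n : ℝ) ^ (1 / 100 : ℝ) < |M.resid (Z i ω)|} ≤
      ENNReal.ofReal (B * (n : ℝ) ^ (-4 : ℝ)) := by
    intro i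
    have hset : MeasurableSet {z | (n : ℝ) ^ (1 / 100 : ℝ) < |M.resid z|} :=
      measurableSet_lt measurable_const hRm.abs
    have hmap : Pr {ω | (n : ℝ) ^ (1 / 100 : ℝ) < |M.resid (Z i ω)|} =
        M.law {z | (n : ℝ) ^ (1 / 100 : ℝ) < |M.resid z|} := by
      rw [← h1.law_eq i, Measure.map_apply (h1.measurable i) hset]; rfl
    rw [hmap, ← ofReal_measureReal]
    refine ENNReal.ofReal_le_ofReal ?_
    have hmk := mul_meas_ge_le_integral_of_nonneg (μ := M.law) (f := fun z => |M.resid z| ^ 400)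
      (Eventually.of_forall fun z => by positivity) (integrable_resid_pow h2 (by norm_num))
      ((n : ℝ) ^ (4 : ℝ))
    have hsub : {z | (n : ℝ) ^ (1 / 100 : ℝ) < |M.resid z|} ⊆
        {z | (n : ℝ) ^ (4 : ℝ) ≤ |M.resid z| ^ 400} := by
      intro z hz
      have h4 : ((n : ℝ) ^ (1 / 100 : ℝ)) ^ 400 = (n : ℝ) ^ (4 : ℝ) := by
        rw [← Real.rpow_natCast, ← Real.rpow_mul (by positivity)]; norm_num
      simp only [Set.mem_ofPred_eq] at hz ⊢
      rw [← h4]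
      gcongr
    have h5 : M.law.real {z | (n : ℝ) ^ (1 / 100 : ℝ) < |M.resid z|} ≤
        M.law.real {z | (n : ℝ) ^ (4 : ℝ) ≤ |M.resid z| ^ 400} := measureReal_mono hsub
    rw [Real.rpow_neg (by positivity), ← div_eq_mul_inv, le_div_iff₀ (by positivity), mul_comm]
    exact (mul_le_mul_of_nonneg_left h5 (by positivity)).trans hmk
  calc Pr {ω | ¬ ∀ i : Fin n, |M.resid (Z i ω)| ≤ (n : ℝ) ^ (1 / 100 : ℝ)}
      ≤ Pr (⋃ i : Fin n, {ω | (n : ℝ) ^ (1 / 100 : ℝ) < |M.resid (Z i ω)|}) := by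
        refine measure_mono fun ω hω => ?_
        simpa using hω
    _ ≤ ∑ i : Fin n, Pr {ω | (n : ℝ) ^ (1 / 100 : ℝ) < |M.resid (Z i ω)|} :=
        measure_iUnion_fintype_le _ _
    _ ≤ ∑ _i : Fin n, ENNReal.ofReal (B * (n : ℝ) ^ (-4 : ℝ)) :=
        Finset.sum_le_sum fun i _ => hone i
    _ = ENNReal.ofReal (n * (B * (n : ℝ) ^ (-4 : ℝ))) := by
        rw [Finset.sum_const, Finset.card_univ, Fintype.card_fin, nsmul_eq_mul,
          ENNReal.ofReal_mul (p := (n : ℝ)) (Nat.cast_nonneg n), ENNReal.ofReal_natCast]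
    _ ≤ _ := by
        refine ENNReal.ofReal_le_ofReal ?_
        have hB0 : 0 ≤ B := integral_nonneg fun z => by positivity
        have : (n : ℝ) * (n : ℝ) ^ (-4 : ℝ) ≤ (n : ℝ) ^ (-2 : ℝ) := by
          nth_rewrite 1 [← Real.rpow_one (n : ℝ)]
          rw [← Real.rpow_add (by positivity)]
          exact Real.rpow_le_rpow_of_exponent_le hn' (by norm_num)
        calc (n : ℝ) * (B * (n : ℝ) ^ (-4 : ℝ)) = B * (n * (n : ℝ) ^ (-4 : ℝ)) := by ring
          _ ≤ _ := by gcongr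

lemma finrank_coef (d κ : ℕ) : Module.finrank ℝ (Coef d κ) = d * κ + 1 := by
  simp [Fintype.card_option]

/-- With l = n^{-34/100} and s = n^{67/100}, the gain is l·s = n^{33/100}. It beats the entropy d(κ)
log n = O(n^{31/100}) and the variance term n l² = n^{32/100}, with room for the factor n^{-2}. -/
lemma exists_halfspace_sum_rate (h6 : AssumptionA6i κ) (CV : ℝ) (d : ℕ) :
    ∀ᶠ n : ℕ in atTop, (2 * ((n : ℝ) + 1)) ^ (d * κ n + 1 + 1) *
      Real.exp (((n : ℝ) ^ (-(34 / 100) : ℝ)) ^ 2 * CV) ^ n *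
      Real.exp (-((n : ℝ) ^ (-(34 / 100) : ℝ) * (n : ℝ) ^ (67 / 100 : ℝ))) ≤
      (n : ℝ) ^ (-2 : ℝ) := by
  obtain ⟨c, C, hc, hC, hκ⟩ := h6.exists_bounds
  filter_upwards [hκ, eventually_ge_atTop 4,
    eventually_mul_log_le 2 (a := 1 / 100) (c := 1) (by norm_num) one_pos,
    eventually_mul_rpow_le (4 * (d * C + 2)) (a := 31 / 100) (b := 33 / 100) (by norm_num),
    eventually_mul_rpow_le (4 * |CV|) (a := 32 / 100) (b := 33 / 100) (by norm_num),
    eventually_mul_rpow_le 4 (a := 1 / 100) (b := 33 / 100) (by norm_num)]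
    with n hκn hn hlog hr1 hr2 hr3
  have hn' : (4 : ℝ) ≤ n := by exact_mod_cast hn
  have hn0 : (0 : ℝ) < n := by linarith
  have hn1 : (1 : ℝ) ≤ n := by linarith
  have e1 : ((n : ℝ) ^ (-(34 / 100) : ℝ)) ^ 2 * CV * n ≤ |CV| * (n : ℝ) ^ (32 / 100 : ℝ) := by
    have : ((n : ℝ) ^ (-(34 / 100) : ℝ)) ^ 2 * n = (n : ℝ) ^ (32 / 100 : ℝ) := by
      rw [← Real.rpow_natCast, ← Real.rpow_mul hn0.le]
      nth_rewrite 2 [← Real.rpow_one (n : ℝ)]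
      rw [← Real.rpow_add hn0]; norm_num
    calc _ = CV * (((n : ℝ) ^ (-(34 / 100) : ℝ)) ^ 2 * n) := by ring
      _ = CV * (n : ℝ) ^ (32 / 100 : ℝ) := by rw [this]
      _ ≤ _ := by gcongr; exact le_abs_self _
  have e2 : (n : ℝ) ^ (-(34 / 100) : ℝ) * (n : ℝ) ^ (67 / 100 : ℝ) = (n : ℝ) ^ (33 / 100 : ℝ) := by
    rw [← Real.rpow_add hn0]; norm_num
  have e3 : (2 * ((n : ℝ) + 1)) ^ (d * κ n + 1 + 1) ≤
      Real.exp ((d * C + 2) * (n : ℝ) ^ (31 / 100 : ℝ)) := by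
    have h1 : 2 * ((n : ℝ) + 1) ≤ Real.exp ((n : ℝ) ^ (1 / 100 : ℝ)) := by
      rw [← Real.log_le_iff_le_exp (by positivity)]
      rw [one_mul] at hlog
      refine le_trans ?_ hlog
      rw [← Real.log_rpow hn0]
      refine Real.log_le_log (by positivity) ?_
      norm_num
      nlinarith
    have h3 : ((d * κ n + 1 + 1 : ℕ) : ℝ) ≤ (d * C + 2) * (n : ℝ) ^ (3 / 10 : ℝ) := by
      push_cast
      have h4 : 1 ≤ (n : ℝ) ^ (3 / 10 : ℝ) := Real.one_le_rpow hn1 (by norm_num)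
      have h5 : (d : ℝ) * κ n ≤ d * (C * (n : ℝ) ^ (3 / 10 : ℝ)) := by gcongr; exact hκn.2
      nlinarith
    calc (2 * ((n : ℝ) + 1)) ^ (d * κ n + 1 + 1)
        ≤ Real.exp ((n : ℝ) ^ (1 / 100 : ℝ)) ^ (d * κ n + 1 + 1) := by gcongr
      _ = Real.exp (((d * κ n + 1 + 1 : ℕ) : ℝ) * (n : ℝ) ^ (1 / 100 : ℝ)) :=
          (Real.exp_nat_mul _ _).symm
      _ ≤ Real.exp ((d * C + 2) * (n : ℝ) ^ (3 / 10 : ℝ) * (n : ℝ) ^ (1 / 100 : ℝ)) := by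
          rw [Real.exp_le_exp]; gcongr
      _ = _ := by rw [mul_assoc, ← Real.rpow_add hn0]; norm_num
  rw [← Real.exp_nat_mul, e2]
  calc _ ≤ Real.exp ((d * C + 2) * (n : ℝ) ^ (31 / 100 : ℝ)) *
        Real.exp (|CV| * (n : ℝ) ^ (32 / 100 : ℝ)) * Real.exp (-(n : ℝ) ^ (33 / 100 : ℝ)) := by
        have h4 : Real.exp (n * (((n : ℝ) ^ (-(34 / 100) : ℝ)) ^ 2 * CV)) ≤
            Real.exp (|CV| * (n : ℝ) ^ (32 / 100 : ℝ)) := by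
          rw [Real.exp_le_exp, mul_comm]; exact e1
        gcongr
    _ = Real.exp ((d * C + 2) * (n : ℝ) ^ (31 / 100 : ℝ) + |CV| * (n : ℝ) ^ (32 / 100 : ℝ) -
          (n : ℝ) ^ (33 / 100 : ℝ)) := by
        rw [← Real.exp_add, ← Real.exp_add, sub_eq_add_neg]
    _ ≤ Real.exp (Real.log n * -2) := by
        rw [Real.exp_le_exp]
        have hy : 0 ≤ (n : ℝ) ^ (33 / 100 : ℝ) := by positivity
        linarith
    _ = _ := (Real.rpow_def_of_pos hn0 _).symm

lemma measure_halfspace_sum_le (h1 : AssumptionA1 M Pr Z)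
    (h5 : AssumptionA5 M Cθ θ0) {R : (Fin d → ℝ) × ℝ → ℝ} (hR : Measurable R)
    (hR2 : MemLp R 2 M.law) {CV : ℝ} (hCV : 0 ≤ CV)
    (hmean : ∀ A : Set (Fin d → ℝ), MeasurableSet A → ∫ z in Prod.fst ⁻¹' A, R z ∂M.law = 0)
    (hvar : ∀ A : Set (Fin d → ℝ), MeasurableSet A →
      ∫ z in Prod.fst ⁻¹' A, R z ^ 2 ∂M.law ≤ CV * M.law.real (Prod.fst ⁻¹' A))
    (κ : ℕ) {l τ : ℝ} (hl : 0 ≤ l) (hτ : 0 ≤ τ) (hlτ : l * τ ≤ 1) (n : ℕ) (s : ℝ) :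
    Pr {ω | ∃ θ : Coef d κ, ∃ q : ℝ, s ≤ ∑ i : Fin n,
      if q < inner ℝ (M.P κ (Z i ω).1) θ then min (R (Z i ω)) τ else 0} ≤
      ENNReal.ofReal ((2 * ((n : ℝ) + 1)) ^ (d * κ + 1 + 1) * Real.exp (l ^ 2 * CV) ^ n *
        Real.exp (-(l * s))) := by
  have hp := h1.isProbabilityMeasure_law
  have hmap : Pr.map (fun ω (i : Fin n) => Z i ω) = Measure.pi fun _ : Fin n => M.law := by
    have h := (iIndepFun_iff_map_fun_eq_pi_map (μ := Pr) (f := fun (i : Fin n) => Z i)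
      fun i => (h1.measurable i).aemeasurable).1 (h1.indep.precomp Fin.val_injective)
    rw [h]
    simp only [h1.law_eq]
  have hexp := pi_cutOut_exp_le M.law (h5.measurable_P κ) (ψ := fun z => min (R z) τ)
    (hR.min measurable_const) (l := l) (C := Real.exp (l ^ 2 * CV))
    (Real.one_le_exp (by positivity))
    (fun g hg => lintegral_fst_mul_exp_min_le hR hR2 hmean hvar hl hτ hlτ hg) hl n s
  rw [finrank_coef] at hexp
  refine le_trans ?_ hexp
  rw [← hmap]
  -- The event is a union over uncountably many (θ, q); this inequality needs no measurability of
  -- it.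
  exact Measure.le_map_apply (f := fun ω (i : Fin n) => Z i ω)
    (measurable_pi_lambda _ fun i : Fin n => h1.measurable i).aemeasurable _

/-- The one-sided bound is applied to the disturbance and to its negative, each truncated from above
at n^{1/100}. When all disturbances are within n^{1/100}, the truncations are void and the two
bounds combine into one for the absolute value. -/
lemma whp_noiseBounded (h1 : AssumptionA1 M Pr Z) (h2 : AssumptionA2 M) (h3 : AssumptionA3 M)
    (h5 : AssumptionA5 M Cθ θ0) (h6 : AssumptionA6i κ) :
    Whp Pr fun n ω => NoiseBounded M (κ n) n fun i => Z i ω := by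
  have hp := h1.isProbabilityMeasure_law
  obtain ⟨CV, hCV, hV⟩ := exists_integral_mul_resid_sq_le h1 h2 h3
  have hRm := Model.measurable_resid h3
  have hind : ∀ A : Set (Fin d → ℝ), MeasurableSet A → ∀ f : (Fin d → ℝ) × ℝ → ℝ,
      ∫ z, A.indicator 1 z.1 * f z ∂M.law = ∫ z in Prod.fst ⁻¹' A, f z ∂M.law := by
    intro A hA f
    rw [← integral_indicator (measurable_fst hA)]
    refine integral_congr_ae (Eventually.of_forall fun z => ?_)
    by_cases hz : z.1 ∈ A
    · simp [hz]
    · simp [hz]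
  have hib : ∀ A : Set (Fin d → ℝ), ∀ x ∈ cube d, |A.indicator (1 : (Fin d → ℝ) → ℝ) x| ≤ 1 := by
    intro A x _
    by_cases hx : x ∈ A <;> simp [hx]
  have hmean : ∀ A : Set (Fin d → ℝ), MeasurableSet A →
      ∫ z in Prod.fst ⁻¹' A, M.resid z ∂M.law = 0 := fun A hA => by
    rw [← hind A hA]
    exact integral_mul_resid h1 h2 h3 (measurable_one.indicator hA) (hib A)
  have hvar : ∀ A : Set (Fin d → ℝ), MeasurableSet A →
      ∫ z in Prod.fst ⁻¹' A, M.resid z ^ 2 ∂M.law ≤ CV * M.law.real (Prod.fst ⁻¹' A) := by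
    intro A hA
    rw [← hind A hA]
    refine (hV _ 1 (measurable_one.indicator hA)
      (fun x => Set.indicator_nonneg (fun _ _ => zero_le_one) x) (hib A)).trans_eq ?_
    congr 1
    have := hind A hA fun _ => 1
    simp only [mul_one] at this
    rw [this]
    simp
  have hmean' : ∀ A : Set (Fin d → ℝ), MeasurableSet A →
      ∫ z in Prod.fst ⁻¹' A, (-M.resid) z ∂M.law = 0 := fun A hA => by
    simp only [Pi.neg_apply, integral_neg, hmean A hA, neg_zero]
  have hvar' : ∀ A : Set (Fin d → ℝ), MeasurableSet A →
      ∫ z in Prod.fst ⁻¹' A, (-M.resid) z ^ 2 ∂M.law ≤ CV * M.law.real (Prod.fst ⁻¹' A) :=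
    fun A hA => by simpa using hvar A hA
  have hL := memLp_resid h2 h3
  have key : ∀ R : (Fin d → ℝ) × ℝ → ℝ, Measurable R → MemLp R 2 M.law →
      (∀ A : Set (Fin d → ℝ), MeasurableSet A → ∫ z in Prod.fst ⁻¹' A, R z ∂M.law = 0) →
      (∀ A : Set (Fin d → ℝ), MeasurableSet A →
        ∫ z in Prod.fst ⁻¹' A, R z ^ 2 ∂M.law ≤ CV * M.law.real (Prod.fst ⁻¹' A)) →
      Whp Pr fun n ω => ∀ (θ : Coef d (κ n)) (q : ℝ), ∑ i : Fin n,
        (if q < inner ℝ (M.P (κ n) (Z i ω).1) θ then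
          min (R (Z i ω)) ((n : ℝ) ^ (1 / 100 : ℝ)) else 0) < (n : ℝ) ^ (67 / 100 : ℝ) := by
    intro R hR hR2 hm hv
    refine whp_of_le_rpow_neg_two (C := 1) ?_
    filter_upwards [exists_halfspace_sum_rate h6 CV d, eventually_ge_atTop 1] with n hn hn1
    have hn' : (1 : ℝ) ≤ n := by exact_mod_cast hn1
    rw [one_mul]
    have hb := measure_halfspace_sum_le h1 h5 hR hR2 hCV.le hm hv (κ n)
      (l := (n : ℝ) ^ (-(34 / 100) : ℝ)) (τ := (n : ℝ) ^ (1 / 100 : ℝ)) (by positivity)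
      (by positivity) (by
        rw [← Real.rpow_add (by positivity)]
        exact Real.rpow_le_one_of_one_le_of_nonpos hn' (by norm_num)) n
      ((n : ℝ) ^ (67 / 100 : ℝ))
    refine le_trans (le_trans (le_of_eq ?_) hb) (ENNReal.ofReal_le_ofReal hn)
    congr 1
    ext ω
    simp only [Set.mem_ofPred_eq, not_forall, not_lt]
  refine ((whp_resid_le h1 h2 h3).and ((key _ hRm hL hmean hvar).and
    (key _ hRm.neg hL.neg hmean' hvar'))).mono (Eventually.of_forall fun n =>
      Eventually.of_forall fun ω => ?_)
  rintro ⟨ha, hb, hc⟩ θ q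
  rw [abs_le]
  constructor
  · have := hc θ q
    have heq : ∀ i : Fin n, (if q < inner ℝ (M.P (κ n) (Z i ω).1) θ then
        min ((-M.resid) (Z i ω)) ((n : ℝ) ^ (1 / 100 : ℝ)) else 0) =
        -(if q < inner ℝ (M.P (κ n) (Z i ω).1) θ then M.resid (Z i ω) else 0) := by
      intro i
      rw [Pi.neg_apply, min_eq_left (by linarith [(abs_le.1 (ha i)).1])]
      split_ifs <;> simp
    simp only [heq, Finset.sum_neg_distrib] at this
    linarith
  · have := hb θ q
    have heq : ∀ i : Fin n, min (M.resid (Z i ω)) ((n : ℝ) ^ (1 / 100 : ℝ)) =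
        M.resid (Z i ω) := fun i => min_eq_left (abs_le.1 (ha i)).2
    simp only [heq] at this
    exact this.le

lemma abs_bilin_le {ι : Type*} [Fintype ι] {A : ι → ι → ℝ} {t : ℝ} (hA : ∀ a b, |A a b| ≤ t)
    (u : EuclideanSpace ℝ ι) :
    |∑ a, ∑ b, A a b * (u a * u b)| ≤ t * Fintype.card ι * ‖u‖ ^ 2 := by
  calc |∑ a, ∑ b, A a b * (u a * u b)| ≤ ∑ a, ∑ b, t * ((u a ^ 2 + u b ^ 2) / 2) := by
        refine (Finset.abs_sum_le_sum_abs _ _).trans (Finset.sum_le_sum fun a _ =>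
          (Finset.abs_sum_le_sum_abs _ _).trans (Finset.sum_le_sum fun b _ => ?_))
        rw [abs_mul]
        have h0 : 0 ≤ t := (abs_nonneg _).trans (hA a b)
        refine mul_le_mul (hA a b) ?_ (abs_nonneg _) h0
        rw [abs_le]
        constructor <;> nlinarith [sq_nonneg (u a + u b), sq_nonneg (u a - u b)]
    _ = t * Fintype.card ι * ‖u‖ ^ 2 := by
        rw [EuclideanSpace.real_norm_sq_eq]
        simp only [← Finset.mul_sum, add_div, Finset.sum_add_distrib, Finset.sum_const,
          Finset.card_univ, nsmul_eq_mul]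
        rw [← Finset.sum_div]
        ring

/-- A matrix whose entries are at most t has operator norm at most t times its dimension, so
entrywise deviations below g/(2 d(κ)) keep the quadratic form within g/2. The Bernstein exponent is
then of order n/κ³, at least n^{1/10} up to a constant, which dominates log n. -/
lemma whp_gramBounded (h1 : AssumptionA1 M Pr Z) (h2 : AssumptionA2 M)
    (h5 : AssumptionA5 M Cθ θ0) (h6 : AssumptionA6i κ) :
    ∃ g G : ℝ, 0 < g ∧ 1 ≤ G ∧ Whp Pr fun n ω => GramBounded M g G (κ n) n fun i => Z i ω := by
  have hp := h1.isProbabilityMeasure_law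
  obtain ⟨g, G, hg, hG, hgram⟩ := exists_gram_bounds h2 h5
  obtain ⟨Cz, hCz, hz⟩ := h5.exists_norm_P_sq_le
  obtain ⟨c, C, hc, hC, hκ⟩ := h6.exists_bounds
  have hgG : g ≤ G := by
    have h := (hgram 0 (EuclideanSpace.single none 1)).2.1.trans
      (hgram 0 (EuclideanSpace.single none 1)).2.2
    simpa using h
  refine ⟨g / 2, G + g / 2, by positivity, by linarith, whp_of_le_rpow_neg_two (C := 2) ?_⟩
  set A : ℝ := g ^ 2 / (16 * (d + 1) ^ 2 * Cz * G * C ^ 3) with hA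
  have hA0 : 0 < A := by positivity
  filter_upwards [h6.tendsto.eventually hz, hκ, h6.tendsto.eventually (eventually_ge_atTop 1),
    eventually_ge_atTop 1,
    eventually_mul_log_le 6 (a := 1 / 10) (c := A) (by norm_num) hA0,
    eventually_mul_rpow_le ((d + 1) * C) (a := 3 / 10) (b := 1) (by norm_num)]
    with n hzn hκn hκ1 hn hlog hdn
  have hn' : (1 : ℝ) ≤ n := by exact_mod_cast hn
  have hn0 : (0 : ℝ) < n := by linarith
  have hκ1' : (1 : ℝ) ≤ κ n := by exact_mod_cast hκ1
  set K : ℝ := ((κ n : ℕ) : ℝ) with hK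
  set D : ℝ := ((Fintype.card (Idx d (κ n)) : ℕ) : ℝ) with hD
  have hDeq : D = d * K + 1 := by simp [hD, hK, Fintype.card_option]
  have hD1 : 1 ≤ D := by rw [hDeq]; have : 0 ≤ d * K := by positivity
                         linarith
  have hDK : D ≤ (d + 1) * K := by rw [hDeq]; linarith
  -- Entrywise tolerance, chosen so that t · D = g/2; below, `v` bounds the second moments of the
  -- entries.
  set t : ℝ := g / (2 * D) with ht
  have ht0 : 0 < t := by positivity
  set v : ℝ := Cz * K * G with hv
  have hv0 : 0 < v := by positivity
  set f : Idx d (κ n) × Idx d (κ n) → (Fin d → ℝ) × ℝ → ℝ := fun ab z =>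
    M.P (κ n) z.1 ab.1 * M.P (κ n) z.1 ab.2 with hf
  have hfm : ∀ ab, Measurable (f ab) := fun ab =>
    ((h5.measurable_P_apply _ _).comp measurable_fst).mul
      ((h5.measurable_P_apply _ _).comp measurable_fst)
  have hPa : ∀ x ∈ cube d, ∀ a, M.P (κ n) x a ^ 2 ≤ Cz * K := by
    intro x hx a
    refine le_trans ?_ (hzn x hx)
    rw [EuclideanSpace.real_norm_sq_eq]
    exact Finset.single_le_sum (f := fun a => M.P (κ n) x a ^ 2) (fun i _ => sq_nonneg _)
      (Finset.mem_univ a)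
  have hfB : ∀ ab, ∀ᵐ z ∂M.law, |f ab z| ≤ Cz * K := by
    intro ab
    filter_upwards [h2.ae_mem_cube] with z hz1
    have h7 := hPa _ hz1 ab.1
    have h8 := hPa _ hz1 ab.2
    rw [abs_le]
    simp only [hf]
    constructor <;> nlinarith [sq_nonneg (M.P (κ n) z.1 ab.1 + M.P (κ n) z.1 ab.2),
      sq_nonneg (M.P (κ n) z.1 ab.1 - M.P (κ n) z.1 ab.2)]
  have hcoord : ∀ (x : Fin d → ℝ) (a : Idx d (κ n)),
      inner ℝ (M.P (κ n) x) (EuclideanSpace.single a (1 : ℝ)) = M.P (κ n) x a := by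
    intro x a
    simp [EuclideanSpace.inner_single_right]
  have hsq : ∀ a : Idx d (κ n), Integrable (fun z => M.P (κ n) z.1 a ^ 2) M.law ∧
      ∫ z, M.P (κ n) z.1 a ^ 2 ∂M.law ≤ G := by
    intro a
    have h := hgram (κ n) (EuclideanSpace.single a 1)
    simp only [hcoord, PiLp.norm_single, norm_one, one_pow, mul_one] at h
    exact ⟨h.1, h.2.2⟩
  have hfv : ∀ ab, ∫ z, f ab z ^ 2 ∂M.law ≤ v := by
    intro ab
    have h9 : ∫ z, f ab z ^ 2 ∂M.law ≤ ∫ z, Cz * K * M.P (κ n) z.1 ab.2 ^ 2 ∂M.law := by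
      refine integral_mono_of_nonneg (Eventually.of_forall fun z => sq_nonneg _)
        ((hsq ab.2).1.const_mul _) ?_
      filter_upwards [h2.ae_mem_cube] with z hz1
      simp only [hf, mul_pow]
      exact mul_le_mul_of_nonneg_right (hPa _ hz1 _) (sq_nonneg _)
    refine h9.trans ?_
    rw [integral_const_mul]
    exact mul_le_mul_of_nonneg_left (hsq ab.2).2 (by positivity)
  have htG : t ≤ G := by
    rw [ht, div_le_iff₀ (by positivity)]
    nlinarith
  have hone : ∀ ab, Pr {ω | n * t ≤ |∑ i ∈ Finset.range n, (f ab (Z i ω) - ∫ z, f ab z ∂M.law)|} ≤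
      ENNReal.ofReal (2 * (n : ℝ) ^ (-6 : ℝ)) := by
    intro ab
    -- The value l = t/(2v) minimizes n l² v - l n t, with minimum -n t²/(4v). This is at most -6
    -- log n, and n^{-6} survives the union over D² ≤ n² entries.
    refine (iid_chernoff_abs h1.measurable h1.indep h1.law_eq (hfm ab) (hfB ab) (hfv ab)
      (l := t / (2 * v)) (by positivity) ?_ n _).trans (ENNReal.ofReal_le_ofReal ?_)
    · rw [hv]
      calc t / (2 * (Cz * K * G)) * (2 * (Cz * K)) = t / G := by field_simp
        _ ≤ 1 := (div_le_one (by linarith)).2 htG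
    · have hexp : (n : ℝ) * ((t / (2 * v)) ^ 2 * v) - t / (2 * v) * (n * t) = -(n * t ^ 2 / (4 * v)) := by
        field_simp; ring
      have hbig : A * (n : ℝ) ^ (1 / 10 : ℝ) ≤ n * t ^ 2 / (4 * v) := by
        have hK3 : K ^ 3 ≤ C ^ 3 * (n : ℝ) ^ (9 / 10 : ℝ) := by
          calc K ^ 3 ≤ (C * (n : ℝ) ^ (3 / 10 : ℝ)) ^ 3 := by gcongr; exact hκn.2
            _ = _ := by
              rw [mul_pow, ← Real.rpow_natCast ((n : ℝ) ^ (3 / 10 : ℝ)), ← Real.rpow_mul hn0.le]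
              norm_num
        have hnn : (n : ℝ) = (n : ℝ) ^ (1 / 10 : ℝ) * (n : ℝ) ^ (9 / 10 : ℝ) := by
          rw [← Real.rpow_add hn0]; norm_num
        rw [le_div_iff₀ (by positivity), ht, hv, hA]
        have h10 : D ^ 2 * K ≤ (d + 1) ^ 2 * (C ^ 3 * (n : ℝ) ^ (9 / 10 : ℝ)) := by
          calc D ^ 2 * K ≤ ((d + 1) * K) ^ 2 * K := by gcongr
            _ = (d + 1) ^ 2 * K ^ 3 := by ring
            _ ≤ _ := by gcongr
        have h11 : (n : ℝ) * (g / (2 * D)) ^ 2 = n * g ^ 2 / (4 * D ^ 2) := by field_simp; ring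
        rw [h11, le_div_iff₀ (by positivity)]
        have h12 : g ^ 2 / (16 * (d + 1) ^ 2 * Cz * G * C ^ 3) * (n : ℝ) ^ (1 / 10 : ℝ) *
            (4 * (Cz * K * G)) * (4 * D ^ 2) =
            g ^ 2 * (n : ℝ) ^ (1 / 10 : ℝ) * (D ^ 2 * K) / ((d + 1) ^ 2 * C ^ 3) := by
          field_simp; ring
        rw [h12, div_le_iff₀ (by positivity)]
        calc g ^ 2 * (n : ℝ) ^ (1 / 10 : ℝ) * (D ^ 2 * K)
            ≤ g ^ 2 * (n : ℝ) ^ (1 / 10 : ℝ) *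
              ((d + 1) ^ 2 * (C ^ 3 * (n : ℝ) ^ (9 / 10 : ℝ))) := by gcongr
          _ = ((n : ℝ) ^ (1 / 10 : ℝ) * (n : ℝ) ^ (9 / 10 : ℝ)) * g ^ 2 * ((d + 1) ^ 2 * C ^ 3) := by
              ring
          _ = _ := by rw [← hnn]
      rw [hexp, Real.rpow_def_of_pos hn0]
      refine mul_le_mul_of_nonneg_left ?_ zero_le_two
      rw [Real.exp_le_exp]
      linarith
  calc Pr {ω | ¬ GramBounded M (g / 2) (G + g / 2) (κ n) n fun i => Z i ω}
      ≤ Pr (⋃ ab, {ω | n * t ≤ |∑ i ∈ Finset.range n, (f ab (Z i ω) - ∫ z, f ab z ∂M.law)|}) := by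
        refine measure_mono fun ω hω => ?_
        by_contra hcon
        simp only [Set.mem_iUnion, Set.mem_ofPred_eq, not_exists, not_le] at hcon
        refine hω fun u => ?_
        have hdiff : (n : ℝ)⁻¹ * ∑ i : Fin n, inner ℝ (M.P (κ n) (Z i ω).1) u ^ 2 -
            ∫ z, inner ℝ (M.P (κ n) z.1) u ^ 2 ∂M.law =
            ∑ a, ∑ b, ((n : ℝ)⁻¹ * ∑ i ∈ Finset.range n,
              (f (a, b) (Z i ω) - ∫ z, f (a, b) z ∂M.law)) * (u a * u b) := by
          have hfi : ∀ ab, Integrable (f ab) M.law := fun ab =>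
            Integrable.of_bound (hfm ab).aestronglyMeasurable _ (hfB ab)
          have h13 : ∫ z, inner ℝ (M.P (κ n) z.1) u ^ 2 ∂M.law =
              ∑ a, ∑ b, (∫ z, f (a, b) z ∂M.law) * (u a * u b) := by
            simp only [AssumptionA5.inner_P_sq]
            rw [integral_finsetSum _ fun a _ => integrable_finsetSum _ fun b _ =>
              (hfi (a, b)).mul_const _]
            refine Finset.sum_congr rfl fun a _ => ?_
            rw [integral_finsetSum _ fun b _ => (hfi (a, b)).mul_const _]
            simp only [integral_mul_const, hf]
          have h14 : (n : ℝ)⁻¹ * ∑ i : Fin n, inner ℝ (M.P (κ n) (Z i ω).1) u ^ 2 =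
              ∑ a, ∑ b, ((n : ℝ)⁻¹ * ∑ i ∈ Finset.range n, f (a, b) (Z i ω)) * (u a * u b) := by
            simp only [AssumptionA5.inner_P_sq]
            rw [← Finset.sum_range (fun i => ∑ a, ∑ b, M.P (κ n) (Z i ω).1 a *
              M.P (κ n) (Z i ω).1 b * (u a * u b)), Finset.sum_comm, Finset.mul_sum]
            refine Finset.sum_congr rfl fun a _ => ?_
            rw [Finset.sum_comm, Finset.mul_sum]
            refine Finset.sum_congr rfl fun b _ => ?_
            rw [← Finset.sum_mul]
            ring
          rw [h13, h14, ← Finset.sum_sub_distrib]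
          refine Finset.sum_congr rfl fun a _ => ?_
          rw [← Finset.sum_sub_distrib]
          refine Finset.sum_congr rfl fun b _ => ?_
          rw [Finset.sum_sub_distrib, Finset.sum_const, Finset.card_range, nsmul_eq_mul]
          field_simp
        have hbd := abs_bilin_le (A := fun a b => (n : ℝ)⁻¹ * ∑ i ∈ Finset.range n,
              (f (a, b) (Z i ω) - ∫ z, f (a, b) z ∂M.law)) (t := t) (fun a b => by
            have := (hcon (a, b)).le
            rw [abs_mul, abs_of_pos (by positivity), inv_mul_le_iff₀ hn0]
            exact this) u
        rw [← hdiff] at hbd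
        have htD : t * (Fintype.card (Idx d (κ n)) : ℝ) = g / 2 := by
          rw [ht, ← hD]; field_simp
        rw [htD] at hbd
        have h15 := abs_le.1 hbd
        have h16 := (hgram (κ n) u).2
        constructor <;> linarith [h15.1, h15.2, h16.1, h16.2]
    _ ≤ ∑ ab, Pr {ω | n * t ≤ |∑ i ∈ Finset.range n, (f ab (Z i ω) - ∫ z, f ab z ∂M.law)|} :=
        measure_iUnion_fintype_le _ _
    _ ≤ ∑ _ab : Idx d (κ n) × Idx d (κ n), ENNReal.ofReal (2 * (n : ℝ) ^ (-6 : ℝ)) :=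
        Finset.sum_le_sum fun ab _ => hone ab
    _ = ENNReal.ofReal (D * D * (2 * (n : ℝ) ^ (-6 : ℝ))) := by
        rw [Finset.sum_const, Finset.card_univ, Fintype.card_prod, nsmul_eq_mul,
          ENNReal.ofReal_mul (p := D * D) (by positivity), hD, ← Nat.cast_mul,
          ENNReal.ofReal_natCast]
    _ ≤ _ := by
        refine ENNReal.ofReal_le_ofReal ?_
        have hDn : D ≤ n := by
          refine hDK.trans (le_trans ?_ (hdn.trans_eq (Real.rpow_one _)))
          rw [mul_assoc]
          gcongr
          exact hκn.2
        calc D * D * (2 * (n : ℝ) ^ (-6 : ℝ)) ≤ n * n * (2 * (n : ℝ) ^ (-6 : ℝ)) := by gcongr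
          _ = 2 * (n : ℝ) ^ (-4 : ℝ) := by
              have : (n : ℝ) * n = (n : ℝ) ^ (2 : ℝ) := by
                rw [Real.rpow_two]; ring
              rw [this, mul_left_comm, ← Real.rpow_add hn0]; norm_num
          _ ≤ 2 * (n : ℝ) ^ (-2 : ℝ) := by
              gcongr
              norm_num

end Events

/-! ### A preliminary rate for the estimator. -/

section Consistency

variable {d : ℕ} {M : Model d} {Cθ : ℝ} {θ0 : ∀ κ : ℕ, Coef d κ} {κ : ℕ → ℕ}
  {Ω : Type*} [MeasurableSpace Ω] {Pr : Measure Ω} {Z : ℕ → Ω → (Fin d → ℝ) × ℝ}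

lemma ae_sample_mem_cube (h1 : AssumptionA1 M Pr Z) (h2 : AssumptionA2 M) :
    ∀ᵐ ω ∂Pr, ∀ i, (Z i ω).1 ∈ cube d := by
  rw [ae_all_iff]
  intro i
  refine ae_of_ae_map (h1.measurable i).aemeasurable (p := fun z => z.1 ∈ cube d) ?_
  rw [h1.law_eq i]
  exact h2.ae_mem_cube

/-- κ^{-2} = O(n^{-8/15}), so the bias is absorbed by n^{-1/2}; no κ^{-2} term is carried further.
-/
lemma exists_bias_bound (h5 : AssumptionA5 M Cθ θ0) (h6 : AssumptionA6i κ) :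
    ∃ B : ℝ, 0 < B ∧ ∀ᶠ n : ℕ in atTop, ∀ x ∈ cube d,
      |M.bias (κ n) (θ0 (κ n)) x| ≤ B * (n : ℝ) ^ (-(1 / 2) : ℝ) := by
  obtain ⟨C, hC⟩ := h5.approx
  obtain ⟨c, _, hc, _, hκ⟩ := h6.exists_bounds
  refine ⟨(|C| + 1) * c ^ (-2 : ℝ), by positivity, ?_⟩
  filter_upwards [h6.tendsto.eventually hC, hκ, eventually_ge_atTop 1] with n hn hκn hn1 x hx
  have hn' : (1 : ℝ) ≤ n := by exact_mod_cast hn1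
  have hpos : 0 < c * (n : ℝ) ^ (4 / 15 : ℝ) := by positivity
  calc |M.bias (κ n) (θ0 (κ n)) x| ≤ C * (κ n : ℝ) ^ (-2 : ℝ) := hn x hx
    _ ≤ (|C| + 1) * (c * (n : ℝ) ^ (4 / 15 : ℝ)) ^ (-2 : ℝ) := by
        refine mul_le_mul (by linarith [le_abs_self C]) ?_ (by positivity) (by positivity)
        exact Real.rpow_le_rpow_of_nonpos hpos hκn.1 (by norm_num)
    _ = (|C| + 1) * c ^ (-2 : ℝ) * (n : ℝ) ^ (-(8 / 15) : ℝ) := by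
        rw [Real.mul_rpow hc.le (by positivity), ← Real.rpow_mul (by positivity)]
        norm_num
        ring
    _ ≤ _ := by
        exact mul_le_mul_of_nonneg_left
          (Real.rpow_le_rpow_of_exponent_le hn' (by norm_num)) (by positivity)

lemma sum_sq_le_of_isMinOn {n k : ℕ} (hn : 0 < n) {z : ℕ → (Fin d → ℝ) × ℝ} {T : Set (Coef d k)}
    {θ θ' : Coef d k} (h : IsMinOn (M.S n k z) T θ) (hθ' : θ' ∈ T) :
    ∑ i : Fin n, (M.F (M.index (z i).1) + M.resid (z i) - M.F (inner ℝ (M.P k (z i).1) θ)) ^ 2 ≤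
    ∑ i : Fin n, (M.F (M.index (z i).1) + M.resid (z i) -
      M.F (inner ℝ (M.P k (z i).1) θ')) ^ 2 := by
  have h1 : M.S n k z θ ≤ M.S n k z θ' := h hθ'
  simp only [Model.S] at h1
  rw [mul_le_mul_iff_right₀ (by positivity), Finset.sum_range, Finset.sum_range] at h1
  simpa [Model.resid] using h1

/-- The rate is n^{67/100} · n^{1/100} / n: half-space sums times the range of the clipped link,
averaged. The squared bias is of smaller order. -/
lemma norm_sub_sq_le_of_isMinOn {n k : ℕ} (hn : 1 ≤ n) {z : ℕ → (Fin d → ℝ) × ℝ}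
    {δ c C a b B Z₀ C₀ g : ℝ} {θ θ' : Coef d k} (h3 : AssumptionA3 M)
    (hL : LinkRegular M.F (M.index '' cube d) δ c C a b) (hB : 0 < B) (hZ₀ : 1 ≤ Z₀) (hC₀ : 1 ≤ C₀)
    (hg : 0 < g) {A A' : ℝ} (hA : A = (C * B) ^ 2 + 4 * (|M.F b - M.F a| + 2))
    (hA' : A' = 2 * (A / c ^ 2) + 2 * B ^ 2)
    (hbn : ∀ x ∈ cube d, |M.bias k θ' x| ≤ B * (n : ℝ) ^ (-(1 / 2) : ℝ))
    (hzn : ∀ x ∈ cube d, ‖M.P k x‖ ^ 2 ≤ Z₀ * k) (hκn : (k : ℝ) ≤ C₀ * (n : ℝ) ^ (3 / 10 : ℝ))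
    (hr1 : B / δ * (n : ℝ) ^ (-(1 / 2) : ℝ) ≤ 1)
    (hr2 : 2 * (A' * (Z₀ * C₀) / (g * δ ^ 2)) * (n : ℝ) ^ (-(2 / 100) : ℝ) ≤ 1)
    (hcube : ∀ i, (z i).1 ∈ cube d) {T : Set (Coef d k)} (hmn : IsMinOn (M.S n k z) T θ)
    (hθ' : θ' ∈ T) (hgr : ∀ u : Coef d k, g * ‖u‖ ^ 2 ≤
      (n : ℝ)⁻¹ * ∑ i : Fin n, inner ℝ (M.P k (z i).1) u ^ 2) (hno : NoiseBounded M k n z)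
    (hre : ∀ i : Fin n, |M.resid (z i)| ≤ (n : ℝ) ^ (1 / 100 : ℝ)) :
    ‖θ - θ'‖ ^ 2 ≤ A' / g * (n : ℝ) ^ (-(32 / 100) : ℝ) := by
  have hδ := hL.delta_pos
  have hc := hL.c_pos
  have hC := hL.one_le_C
  have hA0 : 0 < A := by rw [hA]; positivity
  have hA'0 : 0 < A' := by rw [hA']; positivity
  have hn' : (1 : ℝ) ≤ n := by exact_mod_cast hn
  have hn0 : (0 : ℝ) < n := by linarith
  set β := B * (n : ℝ) ^ (-(1 / 2) : ℝ) with hβ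
  have hβδ : β ≤ δ := by
    rw [div_mul_eq_mul_div, div_le_one hδ] at hr1
    exact hr1
  have hsum := sum_min_sq_le_of_basic_ineq h3.monotone hL hn
    (w := fun i : Fin n => M.index (z i).1) (u := fun i => M.resid (z i))
    (v := fun i => inner ℝ (M.P k (z i).1) (θ))
    (v0 := fun i => inner ℝ (M.P k (z i).1) θ')
    (τ := (n : ℝ) ^ (1 / 100 : ℝ)) (β := β) (s := (n : ℝ) ^ (67 / 100 : ℝ))
    (fun i => ⟨_, hcube i, rfl⟩) hre (fun i => by
      rw [abs_sub_comm, Model.index_eq (hcube i)]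
      exact hbn _ (hcube i)) hβδ (by positivity)
    (sum_sq_le_of_isMinOn hn hmn hθ') (fun q => hno _ q) (fun q => hno _ q)
  set r : ℝ := A * (n : ℝ) ^ (-(32 / 100) : ℝ) with hr
  have hβ2 : β ^ 2 ≤ B ^ 2 * (n : ℝ) ^ (-(32 / 100) : ℝ) := by
    rw [hβ, mul_pow]
    gcongr
    rw [← Real.rpow_natCast, ← Real.rpow_mul hn0.le]
    exact Real.rpow_le_rpow_of_exponent_le hn' (by norm_num)
  have hsum' : ∑ i : Fin n, (c * min |inner ℝ (M.P k (z i).1) (θ) -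
      M.index (z i).1| δ) ^ 2 ≤ n * r := by
    refine hsum.trans ?_
    have e1 : (n : ℝ) ^ (67 / 100 : ℝ) * (n : ℝ) ^ (1 / 100 : ℝ) =
        n * (n : ℝ) ^ (-(32 / 100) : ℝ) := by
      nth_rewrite 3 [← Real.rpow_one (n : ℝ)]
      rw [← Real.rpow_add hn0, ← Real.rpow_add hn0]; norm_num
    have e2 : (1 : ℝ) ≤ (n : ℝ) ^ (1 / 100 : ℝ) := Real.one_le_rpow hn' (by norm_num)
    have e3 : M.F b - M.F a + 2 * (n : ℝ) ^ (1 / 100 : ℝ) ≤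
        (|M.F b - M.F a| + 2) * (n : ℝ) ^ (1 / 100 : ℝ) := by
      have : |M.F b - M.F a| ≤ |M.F b - M.F a| * (n : ℝ) ^ (1 / 100 : ℝ) :=
        le_mul_of_one_le_right (abs_nonneg _) e2
      linarith [le_abs_self (M.F b - M.F a)]
    calc (n : ℝ) * (C * β) ^ 2 + 4 * (n : ℝ) ^ (67 / 100 : ℝ) *
          (M.F b - M.F a + 2 * (n : ℝ) ^ (1 / 100 : ℝ))
        ≤ n * (C ^ 2 * (B ^ 2 * (n : ℝ) ^ (-(32 / 100) : ℝ))) + 4 * (n : ℝ) ^ (67 / 100 : ℝ) *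
          ((|M.F b - M.F a| + 2) * (n : ℝ) ^ (1 / 100 : ℝ)) := by
          rw [mul_pow]; gcongr
      _ = n * (C ^ 2 * (B ^ 2 * (n : ℝ) ^ (-(32 / 100) : ℝ))) + 4 * (|M.F b - M.F a| + 2) *
          ((n : ℝ) ^ (67 / 100 : ℝ) * (n : ℝ) ^ (1 / 100 : ℝ)) := by ring
      _ = n * r := by rw [e1, hr, hA]; ring
  have hρ : 2 * (r / c ^ 2) + 2 * β ^ 2 ≤ A' * (n : ℝ) ^ (-(32 / 100) : ℝ) := by
    calc 2 * (r / c ^ 2) + 2 * β ^ 2 ≤ 2 * (r / c ^ 2) +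
          2 * (B ^ 2 * (n : ℝ) ^ (-(32 / 100) : ℝ)) := by gcongr
      _ = _ := by rw [hr, hA']; ring
  have hmain := norm_sq_le_of_sum_min_sq_le hn (P := fun i : Fin n => M.P k (z i).1)
    (D := θ - θ')
    (e := fun i => inner ℝ (M.P k (z i).1) (θ) - M.index (z i).1)
    (b := fun i => M.bias k θ' (z i).1) (g := g) (ζ := Z₀ * k) (β := β) (r := r)
    hδ hc (fun i => by
      rw [Model.index_eq (hcube i), Model.bias, inner_sub_right]; ring)
    (fun i => hbn _ (hcube i)) (fun i => hzn _ (hcube i)) (hgr _) hsum' (by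
      -- Here κ ≲ n^{3/10} is decisive: κ · n^{-32/100} = O(n^{-2/100}) tends to zero, which is the
      -- smallness required to undo the truncation.
      have h7 : (2 * (r / c ^ 2) + 2 * β ^ 2) * (Z₀ * k) ≤
          A' * (Z₀ * C₀) * (n : ℝ) ^ (-(2 / 100) : ℝ) := by
        calc (2 * (r / c ^ 2) + 2 * β ^ 2) * (Z₀ * k)
            ≤ A' * (n : ℝ) ^ (-(32 / 100) : ℝ) * (Z₀ * (C₀ * (n : ℝ) ^ (3 / 10 : ℝ))) := by
              gcongr
          _ = A' * (Z₀ * C₀) * ((n : ℝ) ^ (-(32 / 100) : ℝ) * (n : ℝ) ^ (3 / 10 : ℝ)) := by ring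
          _ = _ := by rw [← Real.rpow_add hn0]; norm_num
      refine h7.trans_lt ?_
      rw [mul_div_assoc', div_mul_eq_mul_div, div_le_one (by positivity)] at hr2
      have : 0 < A' * (Z₀ * C₀) * (n : ℝ) ^ (-(2 / 100) : ℝ) := by positivity
      linarith)
  rw [div_mul_eq_mul_div, le_div_iff₀ hg, mul_comm]
  exact hmain.trans hρ

lemma whp_norm_sub_sq_le [IsProbabilityMeasure Pr] (hd : 0 < d)
    (h1 : AssumptionA1 M Pr Z) (h2 : AssumptionA2 M) (h3 : AssumptionA3 M)
    (h5 : AssumptionA5 M Cθ θ0) (h6 : AssumptionA6i κ) {θhat : ∀ n : ℕ, Ω → Coef d (κ n)}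
    (hmin : ∀ n, ∀ᵐ ω ∂Pr,
      IsMinOn (M.S n (κ n) (fun i => Z i ω)) (Theta d (κ n) Cθ) (θhat n ω)) :
    ∃ C : ℝ, 0 < C ∧ Whp Pr fun n ω =>
      ‖θhat n ω - θ0 (κ n)‖ ^ 2 ≤ C * (n : ℝ) ^ (-(32 / 100) : ℝ) := by
  obtain ⟨δ, c, C, a, b, hL⟩ := h3.exists_linkRegular hd
  obtain ⟨B, hB, hbias⟩ := exists_bias_bound h5 h6
  obtain ⟨Cz, hCz, hz⟩ := h5.exists_norm_P_sq_le
  obtain ⟨c₀, C₀, hc₀, hC₀, hκ⟩ := h6.exists_bounds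
  obtain ⟨g, G, hg, hG, hgram⟩ := whp_gramBounded h1 h2 h5 h6
  have hδ := hL.delta_pos
  have hc := hL.c_pos
  have hC := hL.one_le_C
  set A : ℝ := (C * B) ^ 2 + 4 * (|M.F b - M.F a| + 2) with hA
  have hA0 : 0 < A := by positivity
  set A' : ℝ := 2 * (A / c ^ 2) + 2 * B ^ 2 with hA'
  have hA'0 : 0 < A' := by positivity
  have hW := (hgram.and (whp_noiseBounded h1 h2 h3 h5 h6)).and (whp_resid_le h1 h2 h3)
  refine ⟨A' / g, div_pos hA'0 hg, ?_⟩
  refine hW.mono ?_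
  filter_upwards [hbias, h6.tendsto.eventually hz, hκ,
    h6.tendsto.eventually (eventually_ge_atTop 1), eventually_ge_atTop 1,
    eventually_mul_rpow_le (B / δ) (a := -(1 / 2)) (b := 0) (by norm_num),
    eventually_mul_rpow_le (2 * (A' * (Cz * C₀) / (g * δ ^ 2))) (a := -(2 / 100)) (b := 0)
      (by norm_num)] with n hbn hzn hκn hκ1 hn hr1 hr2
  filter_upwards [ae_sample_mem_cube h1 h2, hmin n] with ω hcube hmn
  rintro ⟨⟨hgr, hno⟩, hre⟩
  rw [Real.rpow_zero] at hr1 hr2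
  exact norm_sub_sq_le_of_isMinOn hn h3 hL hB hCz hC₀ hg hA hA' hbn hzn hκn.2 hr1 hr2 hcube hmn
    (h5.approx_mem _ hκ1) (fun u => (hgr u).1) hno hre

end Consistency

/-! ### Events of probability at least 1 - ε, and O_p. -/

section Likely

variable {Ω : Type*} [MeasurableSpace Ω] {Pr : Measure Ω}

/-- For large `n` the event `A n` fails with probability at most `ε`. -/
def Likely (Pr : Measure Ω) (ε : ℝ) (A : ℕ → Ω → Prop) : Prop :=
  ∀ᶠ n in atTop, Pr {ω | ¬ A n ω} ≤ ENNReal.ofReal ε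

lemma Likely.and {ε ε' : ℝ} {A B : ℕ → Ω → Prop} (hε : 0 ≤ ε) (hε' : 0 ≤ ε')
    (hA : Likely Pr ε A) (hB : Likely Pr ε' B) : Likely Pr (ε + ε') fun n ω => A n ω ∧ B n ω := by
  filter_upwards [hA, hB] with n h1 h2
  rw [ENNReal.ofReal_add hε hε']
  refine (measure_mono fun ω hω => ?_).trans ((measure_union_le _ _).trans (add_le_add h1 h2))
  by_contra hc
  simp only [Set.mem_union, Set.mem_ofPred_eq, not_or, not_not] at hc
  exact hω hc

lemma Likely.mono {ε : ℝ} {A B : ℕ → Ω → Prop} (hA : Likely Pr ε A)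
    (h : ∀ᶠ n in atTop, ∀ᵐ ω ∂Pr, A n ω → B n ω) : Likely Pr ε B := by
  filter_upwards [hA, h] with n h1 h2
  refine (measure_mono_ae ?_).trans h1
  filter_upwards [h2] with ω hω h3 h4 using h3 (hω h4)

lemma Whp.likely {A : ℕ → Ω → Prop} (h : Whp Pr A) {ε : ℝ} (hε : 0 < ε) : Likely Pr ε A :=
  h.2.eventually (ge_mem_nhds (by simpa using hε))

lemma isBigOp_of_likely {ξ : ℕ → Ω → ℝ≥0∞} {r : ℕ → ℝ}
    (h : ∀ ε : ℝ, 0 < ε → ∃ C : ℝ, 0 ≤ C ∧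
      Likely Pr ε fun n ω => ξ n ω ≤ ENNReal.ofReal (C * r n)) : IsBigOp Pr ξ r := by
  intro ε hε
  obtain ⟨ε', hε', hle⟩ : ∃ ε' : ℝ, 0 < ε' ∧ ENNReal.ofReal ε' ≤ ε := by
    rcases eq_or_ne ε ∞ with rfl | h
    · exact ⟨1, one_pos, le_top⟩
    · exact ⟨ε.toReal, ENNReal.toReal_pos hε.ne' h, ENNReal.ofReal_toReal_le⟩
  obtain ⟨C, hC, hL⟩ := h ε' hε'
  refine ⟨C.toNNReal, Eventually.mono hL fun n hn => ?_⟩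
  refine (measure_mono fun ω hω => ?_).trans (hn.trans hle)
  simp only [Set.mem_ofPred_eq, not_le] at hω ⊢
  rwa [ENNReal.ofReal_mul hC]

end Likely

/-! ### Weighted means of regressors and of their products, uniformly in the direction. -/

section Chebyshev

variable {d : ℕ} {M : Model d} {Cθ : ℝ} {θ0 : ∀ κ : ℕ, Coef d κ} {κ : ℕ → ℕ}
  {Ω : Type*} [MeasurableSpace Ω] {Pr : Measure Ω} [IsProbabilityMeasure Pr]
  {Z : ℕ → Ω → (Fin d → ℝ) × ℝ}

/-- Controlling the Euclidean norm of the whole vector of centred means is what later gives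
uniformity in the direction, through the Cauchy–Schwarz inequality. -/
lemma measure_lt_sum_sq_le (h1 : AssumptionA1 M Pr Z) (h2 : AssumptionA2 M) {ι : Type*} [Fintype ι]
    {f : ι → (Fin d → ℝ) × ℝ → ℝ} {h : (Fin d → ℝ) × ℝ → ℝ} {ρ b ε : ℝ} {n : ℕ}
    (hf : ∀ a, Measurable (f a)) (hh : MemLp h 2 M.law)
    (hfh : ∀ z : (Fin d → ℝ) × ℝ, z.1 ∈ cube d → ∑ a, f a z ^ 2 ≤ ρ * h z ^ 2)
    (hb : ∫ z, h z ^ 2 ∂M.law ≤ b) (hρ : 0 < ρ) (hb0 : 0 < b) (hn : 0 < n) (hε : 0 < ε) :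
    (∀ a, MemLp (f a) 2 M.law) ∧
    Pr {ω | ¬ ∑ a, ((n : ℝ)⁻¹ * ∑ i : Fin n, f a (Z i ω) - ∫ z, f a z ∂M.law) ^ 2 ≤
      ε⁻¹ * (ρ * b / n)} ≤ ENNReal.ofReal ε := by
  have hn' : (0 : ℝ) < n := by exact_mod_cast hn
  have hf2 : ∀ a, MemLp (f a) 2 M.law := fun a => by
    refine (hh.const_mul √ρ).of_le (hf a).aestronglyMeasurable ?_
    filter_upwards [h2.ae_mem_cube] with z hz
    rw [Real.norm_eq_abs, Real.norm_eq_abs]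
    refine sq_le_sq.1 ?_
    rw [mul_pow, Real.sq_sqrt hρ.le]
    exact (Finset.single_le_sum (f := fun a => f a z ^ 2) (fun i _ => sq_nonneg _)
      (Finset.mem_univ a)).trans (hfh z hz)
  refine ⟨hf2, ?_⟩
  have hB : ∫ z, ∑ a, f a z ^ 2 ∂M.law ≤ ρ * b := by
    calc ∫ z, ∑ a, f a z ^ 2 ∂M.law ≤ ∫ z, ρ * h z ^ 2 ∂M.law := by
          refine integral_mono_ae (integrable_finsetSum _ fun a _ => (hf2 a).integrable_sq)
            (hh.integrable_sq.const_mul ρ) ?_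
          filter_upwards [h2.ae_mem_cube] with z hz using hfh z hz
      _ ≤ _ := by rw [integral_const_mul]; gcongr
  have key := iid_chebyshev h1.measurable h1.indep h1.law_eq hf hf2 hB hn
    (t := ε⁻¹ * (ρ * b / n)) (by positivity)
  refine (measure_mono fun ω hω => ?_).trans (key.trans (le_of_eq ?_))
  · simp only [Set.mem_ofPred_eq, not_le] at hω ⊢
    simp only [Finset.sum_range]
    exact hω.le
  · congr 1
    field_simp

lemma abs_sum_mul_le_of_sum_sq_le {ι : Type*} [Fintype ι] {D x : ι → ℝ} {t X : ℝ}
    (ht : 0 ≤ t) (hX : 0 ≤ X) (hD : ∑ a, D a ^ 2 ≤ t ^ 2) (hx : ∑ a, x a ^ 2 ≤ X ^ 2) :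
    |∑ a, D a * x a| ≤ t * X := by
  refine abs_le_of_sq_le_sq ?_ (by positivity)
  calc (∑ a, D a * x a) ^ 2 ≤ (∑ a, D a ^ 2) * ∑ a, x a ^ 2 := Finset.sum_mul_sq_le_sq_mul_sq _ _ _
    _ ≤ t ^ 2 * X ^ 2 := by gcongr
    _ = _ := by ring

/-- Weighted means of the regressors are within `O(√(b κ / n))` of their expectations. -/
lemma exists_likely_linear (h1 : AssumptionA1 M Pr Z) (h2 : AssumptionA2 M)
    (h5 : AssumptionA5 M Cθ θ0) (h6 : AssumptionA6i κ) {h : ℕ → (Fin d → ℝ) × ℝ → ℝ} {b : ℕ → ℝ}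
    (hm : ∀ n, Measurable (h n)) (hh : ∀ᶠ n in atTop, MemLp (h n) 2 M.law ∧
      ∫ z, h n z ^ 2 ∂M.law ≤ b n) (hb : ∀ᶠ n in atTop, 0 < b n) {ε : ℝ} (hε : 0 < ε) :
    ∃ K : ℝ, 0 < K ∧ Likely Pr ε fun n ω => ∀ u : Coef d (κ n),
      |(n : ℝ)⁻¹ * ∑ i : Fin n, h n (Z i ω) * inner ℝ (M.P (κ n) (Z i ω).1) u -
        ∫ z, h n z * inner ℝ (M.P (κ n) z.1) u ∂M.law| ≤ K * √(κ n * b n / n) * ‖u‖ := by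
  have hp := h1.isProbabilityMeasure_law
  obtain ⟨Cz, hCz, hz⟩ := h5.exists_norm_P_sq_le
  refine ⟨√(ε⁻¹ * Cz), by positivity, ?_⟩
  filter_upwards [h6.tendsto.eventually hz, h6.tendsto.eventually (eventually_ge_atTop 1),
    eventually_ge_atTop 1, hh, hb] with n hzn hκ1 hn ⟨hL, hI⟩ hbn
  have hκ0 : (0 : ℝ) < κ n := by exact_mod_cast hκ1
  obtain ⟨hf2, hP⟩ := measure_lt_sum_sq_le h1 h2 (ι := Idx d (κ n))
    (f := fun a z => h n z * M.P (κ n) z.1 a) (h := h n) (ρ := Cz * κ n) (b := b n) (ε := ε)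
    (n := n) (fun a => (hm n).mul ((h5.measurable_P_apply _ a).comp measurable_fst)) hL
    (fun z hz => by
      have := hzn _ hz
      rw [EuclideanSpace.real_norm_sq_eq] at this
      simp only [mul_pow]
      rw [← Finset.mul_sum, mul_comm]
      gcongr) hI (by positivity) hbn hn hε
  refine (measure_mono fun ω hω => ?_).trans hP
  simp only [Set.mem_ofPred_eq] at hω ⊢
  refine fun hle => hω fun u => ?_
  have e1 : (n : ℝ)⁻¹ * ∑ i : Fin n, h n (Z i ω) * inner ℝ (M.P (κ n) (Z i ω).1) u -
        ∫ z, h n z * inner ℝ (M.P (κ n) z.1) u ∂M.law =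
      ∑ a, ((n : ℝ)⁻¹ * ∑ i : Fin n, h n (Z i ω) * M.P (κ n) (Z i ω).1 a -
        ∫ z, h n z * M.P (κ n) z.1 a ∂M.law) * u a := by
    simp only [sub_mul, Finset.sum_sub_distrib, inner_P, Finset.mul_sum, Finset.sum_mul]
    rw [Finset.sum_comm, integral_finsetSum _ fun a _ => ?_]
    · simp only [← integral_mul_const, mul_assoc]
    · simp only [← mul_assoc]
      exact ((hf2 a).integrable (by norm_num)).mul_const _
  rw [e1]
  refine abs_sum_mul_le_of_sum_sq_le (by positivity) (norm_nonneg u) (hle.trans (le_of_eq ?_))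
    (EuclideanSpace.real_norm_sq_eq u).ge
  rw [mul_pow, Real.sq_sqrt (by positivity), Real.sq_sqrt (by positivity)]
  ring

/-- Weighted Gram matrices of the regressors are within `O(κ / √n)` of their expectations. -/
lemma exists_likely_quadratic (h1 : AssumptionA1 M Pr Z) (h2 : AssumptionA2 M)
    (h5 : AssumptionA5 M Cθ θ0) (h6 : AssumptionA6i κ) {h : (Fin d → ℝ) × ℝ → ℝ}
    (hm : Measurable h) (hL : MemLp h 2 M.law) {ε : ℝ} (hε : 0 < ε) :
    ∃ K : ℝ, 0 < K ∧ Likely Pr ε fun n ω => ∀ u v : Coef d (κ n),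
      |(n : ℝ)⁻¹ * ∑ i : Fin n, h (Z i ω) * inner ℝ (M.P (κ n) (Z i ω).1) u *
          inner ℝ (M.P (κ n) (Z i ω).1) v -
        ∫ z, h z * inner ℝ (M.P (κ n) z.1) u * inner ℝ (M.P (κ n) z.1) v ∂M.law| ≤
      K * (κ n / √n) * (‖u‖ * ‖v‖) := by
  have hp := h1.isProbabilityMeasure_law
  obtain ⟨Cz, hCz, hz⟩ := h5.exists_norm_P_sq_le
  set b : ℝ := |∫ z, h z ^ 2 ∂M.law| + 1 with hb
  have hb0 : 0 < b := by positivity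
  refine ⟨√(ε⁻¹ * (Cz ^ 2 * b)), by positivity, ?_⟩
  filter_upwards [h6.tendsto.eventually hz, h6.tendsto.eventually (eventually_ge_atTop 1),
    eventually_ge_atTop 1] with n hzn hκ1 hn
  have hκ0 : (0 : ℝ) < κ n := by exact_mod_cast hκ1
  have hn0 : (0 : ℝ) < n := by exact_mod_cast hn
  -- The matrix is treated as a vector indexed by pairs, so Chebyshev bounds its Frobenius norm. The
  -- squared entries at a point sum to h²‖P_κ‖⁴ = O(h² κ²).
  obtain ⟨hf2, hP⟩ := measure_lt_sum_sq_le h1 h2 (ι := Idx d (κ n) × Idx d (κ n))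
    (f := fun a z => h z * M.P (κ n) z.1 a.1 * M.P (κ n) z.1 a.2) (h := h)
    (ρ := (Cz * κ n) ^ 2) (b := b) (ε := ε)
    (n := n) (fun a => (hm.mul ((h5.measurable_P_apply _ a.1).comp measurable_fst)).mul
      ((h5.measurable_P_apply _ a.2).comp measurable_fst)) hL
    (fun z hz => by
      have h7 := hzn _ hz
      have h8 : ∑ a : Idx d (κ n) × Idx d (κ n),
          (h z * M.P (κ n) z.1 a.1 * M.P (κ n) z.1 a.2) ^ 2 =
          (‖M.P (κ n) z.1‖ ^ 2) ^ 2 * h z ^ 2 := by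
        rw [EuclideanSpace.real_norm_sq_eq, sq (∑ i, _), Fintype.sum_mul_sum, ← Finset.sum_product',
          Finset.sum_mul]
        exact Finset.sum_congr rfl fun a _ => by ring
      rw [h8]
      gcongr) (by linarith [le_abs_self (∫ z, h z ^ 2 ∂M.law)]) (by positivity) hb0 hn hε
  refine (measure_mono fun ω hω => ?_).trans hP
  simp only [Set.mem_ofPred_eq] at hω ⊢
  refine fun hle => hω fun u v => ?_
  have e0 : ∀ z, h z * inner ℝ (M.P (κ n) z.1) u * inner ℝ (M.P (κ n) z.1) v =
      ∑ a : Idx d (κ n) × Idx d (κ n), h z * M.P (κ n) z.1 a.1 * M.P (κ n) z.1 a.2 *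
        (u a.1 * v a.2) := fun z => by
    rw [inner_P, inner_P, mul_assoc, Fintype.sum_mul_sum, ← Finset.sum_product', Finset.mul_sum]
    exact Finset.sum_congr rfl fun a _ => by ring
  have e1 : (n : ℝ)⁻¹ * ∑ i : Fin n, h (Z i ω) * inner ℝ (M.P (κ n) (Z i ω).1) u *
          inner ℝ (M.P (κ n) (Z i ω).1) v -
        ∫ z, h z * inner ℝ (M.P (κ n) z.1) u * inner ℝ (M.P (κ n) z.1) v ∂M.law =
      ∑ a : Idx d (κ n) × Idx d (κ n),
        ((n : ℝ)⁻¹ * ∑ i : Fin n, h (Z i ω) * M.P (κ n) (Z i ω).1 a.1 * M.P (κ n) (Z i ω).1 a.2 -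
        ∫ z, h z * M.P (κ n) z.1 a.1 * M.P (κ n) z.1 a.2 ∂M.law) * (u a.1 * v a.2) := by
    simp only [e0, sub_mul, Finset.sum_sub_distrib]
    rw [integral_finsetSum _ fun a _ => ((hf2 a).integrable (by norm_num)).mul_const _,
      Finset.sum_comm]
    simp only [integral_mul_const, ← Finset.sum_mul]
    rw [Finset.mul_sum]
    simp only [mul_assoc]
  rw [e1]
  refine abs_sum_mul_le_of_sum_sq_le (by positivity) (by positivity) (hle.trans (le_of_eq ?_))
    (le_of_eq ?_)
  · rw [mul_pow √_, Real.sq_sqrt (by positivity), div_pow, Real.sq_sqrt hn0.le]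
    ring
  · rw [mul_pow, EuclideanSpace.real_norm_sq_eq, EuclideanSpace.real_norm_sq_eq,
      Fintype.sum_mul_sum, ← Finset.sum_product']
    exact Finset.sum_congr rfl fun a _ => by ring

end Chebyshev

/-! ### The matrix Q_κ and the normal equations. -/

section Design

variable {d : ℕ} {M : Model d} {Cθ : ℝ} {θ0 : ∀ κ : ℕ, Coef d κ} {δ c C a b : ℝ}

lemma measurable_deriv_index (h3 : AssumptionA3 M) :
    Measurable fun x : Fin d → ℝ => deriv M.F (M.index x) :=
  (measurable_deriv M.F).comp (Model.continuous_index h3).measurable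

lemma measurable_deriv_deriv_index (h3 : AssumptionA3 M) :
    Measurable fun x : Fin d → ℝ => deriv (deriv M.F) (M.index x) :=
  (measurable_deriv (deriv M.F)).comp (Model.continuous_index h3).measurable

lemma abs_deriv_index_le (hL : LinkRegular M.F (M.index '' cube d) δ c C a b) {x : Fin d → ℝ}
    (hx : x ∈ cube d) : |deriv M.F (M.index x)| ≤ C :=
  hL.deriv_hi _ ⟨x, hx, rfl⟩ _ (by simpa using hL.delta_pos.le)

lemma dF_eq {x : Fin d → ℝ} (hx : x ∈ cube d) : M.dF x = deriv M.F (M.index x) := by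
  rw [Model.index_eq hx, Model.dF]

lemma integrable_of_cube_bound (h2 : AssumptionA2 M) [IsFiniteMeasure M.law]
    {f : (Fin d → ℝ) → ℝ} (hf : Measurable f) {B : ℝ} (hB : ∀ x ∈ cube d, |f x| ≤ B) :
    Integrable (fun z => f z.1) M.law :=
  Integrable.of_bound (hf.comp measurable_fst).aestronglyMeasurable B
    (h2.ae_mem_cube.mono fun _ hz => hB _ hz)

lemma inner_Q (h2 : AssumptionA2 M) [IsFiniteMeasure M.law] (h3 : AssumptionA3 M)
    (h5 : AssumptionA5 M Cθ θ0) (hL : LinkRegular M.F (M.index '' cube d) δ c C a b) (κ : ℕ)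
    (u v : Coef d κ) :
    inner ℝ u (Matrix.toEuclideanLin (M.Q κ) v) =
      ∫ z, deriv M.F (M.index z.1) ^ 2 * inner ℝ (M.P κ z.1) u * inner ℝ (M.P κ z.1) v ∂M.law := by
  have hint : ∀ i j : Idx d κ, Integrable (fun z : (Fin d → ℝ) × ℝ =>
      deriv M.F (M.index z.1) ^ 2 * (M.P κ z.1 i * M.P κ z.1 j)) M.law := fun i j => by
    obtain ⟨A, hA⟩ := h5.exists_P_apply_le κ i
    obtain ⟨B, hB⟩ := h5.exists_P_apply_le κ j
    refine integrable_of_cube_bound h2 (f := fun x => deriv M.F (M.index x) ^ 2 *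
      (M.P κ x i * M.P κ x j)) (((measurable_deriv_index h3).pow_const 2).mul
      ((h5.measurable_P_apply κ i).mul (h5.measurable_P_apply κ j))) (B := C ^ 2 * (A * B)) ?_
    intro x hx
    rw [abs_mul, abs_mul, abs_pow]
    have h7 := hA x hx
    have h8 := hB x hx
    have h9 := (abs_nonneg _).trans h7
    gcongr
    exact abs_deriv_index_le hL hx
  have e0 : ∀ z : (Fin d → ℝ) × ℝ,
      deriv M.F (M.index z.1) ^ 2 * inner ℝ (M.P κ z.1) u * inner ℝ (M.P κ z.1) v =
      ∑ i, ∑ j, deriv M.F (M.index z.1) ^ 2 * (M.P κ z.1 i * M.P κ z.1 j) * (u i * v j) := by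
    intro z
    rw [inner_P, inner_P, mul_assoc, Fintype.sum_mul_sum, Finset.mul_sum]
    refine Finset.sum_congr rfl fun i _ => ?_
    rw [Finset.mul_sum]
    exact Finset.sum_congr rfl fun j _ => by ring
  simp only [e0]
  rw [integral_finsetSum _ fun i _ => integrable_finsetSum _ fun j _ => (hint i j).mul_const _,
    PiLp.inner_apply]
  refine Finset.sum_congr rfl fun i _ => ?_
  rw [integral_finsetSum _ fun j _ => (hint i j).mul_const _]
  have hQ : ∀ j, M.Q κ i j = ∫ z, deriv M.F (M.index z.1) ^ 2 *
      (M.P κ z.1 i * M.P κ z.1 j) ∂M.law := fun j => by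
    refine integral_congr_ae (h2.ae_mem_cube.mono fun z hz => ?_)
    simp only [dF_eq hz]
  simp only [integral_mul_const, ← hQ]
  simp only [Matrix.toLpLin_apply, Matrix.mulVec, dotProduct, RCLike.inner_apply, conj_trivial,
    Finset.sum_mul]
  exact Finset.sum_congr rfl fun j _ => by ring

/-- F' is bounded below by c on the range of the index, so coercivity uniform in κ is inherited from
E(P_κ P_κ'). -/
lemma exists_le_inner_Q (h2 : AssumptionA2 M) [IsFiniteMeasure M.law] (h3 : AssumptionA3 M)
    (h5 : AssumptionA5 M Cθ θ0) (hL : LinkRegular M.F (M.index '' cube d) δ c C a b) :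
    ∃ q : ℝ, 0 < q ∧ ∀ (κ : ℕ) (u : Coef d κ),
      q * ‖u‖ ^ 2 ≤ inner ℝ u (Matrix.toEuclideanLin (M.Q κ) u) := by
  obtain ⟨g, G, hg, hG, hgram⟩ := exists_gram_bounds h2 h5
  have hc := hL.c_pos
  refine ⟨c ^ 2 * g, by positivity, fun κ u => ?_⟩
  obtain ⟨hi, hlo, -⟩ := hgram κ u
  rw [inner_Q h2 h3 h5 hL, mul_assoc]
  calc c ^ 2 * (g * ‖u‖ ^ 2) ≤ c ^ 2 * ∫ z, inner ℝ (M.P κ z.1) u ^ 2 ∂M.law := by gcongr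
    _ = ∫ z, c ^ 2 * inner ℝ (M.P κ z.1) u ^ 2 ∂M.law := by rw [integral_const_mul]
    _ ≤ _ := by
      obtain ⟨B, hB⟩ := h5.exists_norm_P_le κ
      have hm : Measurable fun x => inner ℝ (M.P κ x) u := (h5.measurable_P κ).inner_const
      refine integral_mono_ae (hi.const_mul _) (integrable_of_cube_bound h2
        (f := fun x => deriv M.F (M.index x) ^ 2 * inner ℝ (M.P κ x) u * inner ℝ (M.P κ x) u)
        ((((measurable_deriv_index h3).pow_const 2).mul hm).mul hm)
        (B := C ^ 2 * (B * ‖u‖) * (B * ‖u‖)) fun x hx => ?_) ?_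
      · rw [abs_mul, abs_mul, abs_pow]
        have h7 : |inner ℝ (M.P κ x) u| ≤ B * ‖u‖ :=
          (abs_real_inner_le_norm _ _).trans (by gcongr; exact hB x hx)
        have h9 := (abs_nonneg _).trans h7
        gcongr
        exact abs_deriv_index_le hL hx
      · filter_upwards [h2.ae_mem_cube] with z hz
        rw [mul_assoc, ← sq]
        have := hL.deriv_lo _ ⟨z.1, hz, rfl⟩
        gcongr

lemma toEuclideanLin_inv_apply {ι : Type*} [Fintype ι] [DecidableEq ι] {A : Matrix ι ι ℝ} {q : ℝ}
    (hq : 0 < q) (hA : ∀ u : EuclideanSpace ℝ ι, q * ‖u‖ ^ 2 ≤ inner ℝ u (Matrix.toEuclideanLin A u))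
    (v : EuclideanSpace ℝ ι) :
    Matrix.toEuclideanLin A⁻¹ (Matrix.toEuclideanLin A v) = v := by
  have hu : IsUnit A := by
    rw [← Matrix.mulVec_injective_iff_isUnit]
    refine (injective_iff_map_eq_zero (Matrix.mulVecLin A)).2 fun x hx => ?_
    have h1 := hA (WithLp.toLp 2 x)
    have h2 : Matrix.toEuclideanLin A (WithLp.toLp 2 x) = 0 := by
      rw [Matrix.toLpLin_toLp]
      simpa using hx
    rw [h2, inner_zero_right] at h1
    have h3 : ‖WithLp.toLp 2 x‖ ^ 2 ≤ 0 := by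
      by_contra! h; nlinarith [mul_pos hq h]
    have h4 : WithLp.toLp 2 x = 0 := norm_eq_zero.1 (pow_eq_zero_iff two_ne_zero |>.1
      (le_antisymm h3 (sq_nonneg _)))
    simpa using h4
  have hdet := (Matrix.isUnit_iff_isUnit_det A).1 hu
  rw [Matrix.toLpLin_apply, Matrix.toLpLin_apply]
  simp [Matrix.nonsing_inv_mul A hdet]

lemma norm_le_of_coercive {V : Type*} [NormedAddCommGroup V] [InnerProductSpace ℝ V]
    {T : V → V} {u : V} {q t : ℝ} (hT : q * ‖u‖ ^ 2 ≤ inner ℝ u (T u))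
    (ht : |inner ℝ u (T u)| ≤ t * ‖u‖) (ht0 : 0 ≤ t) : q * ‖u‖ ≤ t := by
  rcases eq_or_ne u 0 with rfl | hu
  · simpa using ht0
  · have h1 : 0 < ‖u‖ := norm_pos_iff.2 hu
    have h2 := hT.trans ((le_abs_self _).trans ht)
    rw [sq, ← mul_assoc] at h2
    exact le_of_mul_le_mul_right h2 h1

/-- A strictly interior minimizer can be moved along every line, so the criterion has a local
minimum at t = 0 in each direction. Differentiability is needed only at the fitted indices. -/
lemma normal_equations {n k : ℕ} {z : ℕ → (Fin d → ℝ) × ℝ} {θ : Coef d k} (hn : 0 < n)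
    (hmin : IsMinOn (M.S n k z) (Theta d k Cθ) θ) (hint : ∀ i, |θ i| < Cθ)
    (hdiff : ∀ i : Fin n, DifferentiableAt ℝ M.F (inner ℝ (M.P k (z i).1) θ)) (u : Coef d k) :
    ∑ i : Fin n, ((z i).2 - M.F (inner ℝ (M.P k (z i).1) θ)) *
      deriv M.F (inner ℝ (M.P k (z i).1) θ) * inner ℝ (M.P k (z i).1) u = 0 := by
  refine sum_mul_deriv_eq_zero hdiff ?_
  have hev : ∀ᶠ t : ℝ in 𝓝 0, ∀ i, |(θ + t • u) i| < Cθ := by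
    refine eventually_all.2 fun i => ?_
    have hc : Continuous fun t : ℝ => |(θ + t • u) i| := by
      simp only [PiLp.add_apply, PiLp.smul_apply, smul_eq_mul]
      fun_prop
    have := hc.tendsto 0
    refine this.eventually (gt_mem_nhds ?_)
    simpa using hint i
  filter_upwards [hev] with t ht
  have h1 : M.S n k z θ ≤ M.S n k z (θ + t • u) := hmin fun i => abs_le.1 (ht i).le
  simp only [Model.S] at h1
  rw [mul_le_mul_iff_right₀ (by positivity), Finset.sum_range, Finset.sum_range] at h1
  simpa [inner_add_right, inner_smul_right] using h1

end Design

/-! ### Linearization for a fixed sample. -/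

section Linearization

variable {d : ℕ} {M : Model d} {Cθ : ℝ} {δ c C a b : ℝ}

namespace Model

/-- `n⁻¹ ∑ F'[μ + m(X_i)] U_i P_κ(X_i)`. -/
def score (M : Model d) (n k : ℕ) (z : ℕ → (Fin d → ℝ) × ℝ) : Coef d k :=
  (n : ℝ)⁻¹ • ∑ i ∈ Finset.range n, (M.dF (z i).1 * M.U (z i)) • M.P k (z i).1

/-- `n⁻¹ ∑ F'[μ + m(X_i)]² b_θ(X_i) P_κ(X_i)`. -/
def biasScore (M : Model d) (n k : ℕ) (z : ℕ → (Fin d → ℝ) × ℝ) (θ : Coef d k) : Coef d k :=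
  (n : ℝ)⁻¹ • ∑ i ∈ Finset.range n, (M.dF (z i).1 ^ 2 * M.bias k θ (z i).1) • M.P k (z i).1

end Model

lemma inner_score {n k : ℕ} {z : ℕ → (Fin d → ℝ) × ℝ} (hcube : ∀ i, (z i).1 ∈ cube d)
    (u : Coef d k) : inner ℝ u (M.score n k z) =
      (n : ℝ)⁻¹ * ∑ i : Fin n, deriv M.F (M.index (z i).1) * M.resid (z i) *
        inner ℝ (M.P k (z i).1) u := by
  rw [Model.score, inner_smul_right, inner_sum, Finset.sum_range]
  simp only [inner_smul_right, dF_eq (hcube _), ← Model.resid_eq (hcube _), real_inner_comm u]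

lemma inner_biasScore {n k : ℕ} {z : ℕ → (Fin d → ℝ) × ℝ} (hcube : ∀ i, (z i).1 ∈ cube d)
    (θ u : Coef d k) : inner ℝ u (M.biasScore n k z θ) =
      (n : ℝ)⁻¹ * ∑ i : Fin n, deriv M.F (M.index (z i).1) ^ 2 * M.bias k θ (z i).1 *
        inner ℝ (M.P k (z i).1) u := by
  rw [Model.biasScore, inner_smul_right, inner_sum, Finset.sum_range]
  simp only [inner_smul_right, dF_eq (hcube _), real_inner_comm u]

lemma abs_inner_biasScore_le {n k : ℕ} {z : ℕ → (Fin d → ℝ) × ℝ} (hn : 0 < n)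
    (hcube : ∀ i, (z i).1 ∈ cube d) (hL : LinkRegular M.F (M.index '' cube d) δ c C a b)
    {θ : Coef d k} {β K : ℝ} (hβ : 0 ≤ β) (hK : 1 ≤ K) (hb : ∀ x ∈ cube d, |M.bias k θ x| ≤ β)
    (hG : ∀ u : Coef d k,
      (n : ℝ)⁻¹ * ∑ i : Fin n, inner ℝ (M.P k (z i).1) u ^ 2 ≤ K * ‖u‖ ^ 2) (u : Coef d k) :
    |inner ℝ u (M.biasScore n k z θ)| ≤ C ^ 2 * β * K * ‖u‖ := by
  have hn' : (0 : ℝ) < n := by exact_mod_cast hn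
  have hC := hL.one_le_C
  rw [inner_biasScore hcube, abs_mul, abs_of_pos (inv_pos.2 hn')]
  calc (n : ℝ)⁻¹ * |∑ i : Fin n, deriv M.F (M.index (z i).1) ^ 2 * M.bias k θ (z i).1 *
        inner ℝ (M.P k (z i).1) u|
      ≤ (n : ℝ)⁻¹ * ∑ i : Fin n, |deriv M.F (M.index (z i).1) ^ 2 * M.bias k θ (z i).1 *
        inner ℝ (M.P k (z i).1) u| := by gcongr; exact Finset.abs_sum_le_sum_abs _ _
    _ ≤ (C ^ 2 * β) * (K * ‖u‖) := by
        refine mean_abs_mul_le _ _ (by positivity) (by positivity) ?_ ?_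
        · calc (n : ℝ)⁻¹ * ∑ i : Fin n, (deriv M.F (M.index (z i).1) ^ 2 * M.bias k θ (z i).1) ^ 2
              ≤ (n : ℝ)⁻¹ * ∑ _i : Fin n, (C ^ 2 * β) ^ 2 := by
                refine mul_le_mul_of_nonneg_left (Finset.sum_le_sum fun i _ => ?_) (by positivity)
                rw [sq_le_sq, abs_mul, abs_pow, abs_of_nonneg (by positivity : 0 ≤ C ^ 2 * β)]
                gcongr
                · exact abs_deriv_index_le hL (hcube i)
                · exact hb _ (hcube i)
            _ = _ := by simp; field_simp
        · refine (hG u).trans ?_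
          rw [mul_pow]
          gcongr
          nlinarith
    _ = _ := by ring

/-- The linearization error of the least-squares estimator for a fixed sample. -/
lemma linearization_of_isMinOn {n k : ℕ} {z : ℕ → (Fin d → ℝ) × ℝ} {θ θ' : Coef d k} (hn : 0 < n)
    (hL : LinkRegular M.F (M.index '' cube d) δ c C a b) (hcube : ∀ i, (z i).1 ∈ cube d)
    (hmin : IsMinOn (M.S n k z) (Theta d k Cθ) θ) (hint : ∀ i, |θ i| < Cθ)
    {β ζ K q l α₁ α₂ α₃ : ℝ} (hβ : 0 ≤ β) (hζ : 0 ≤ ζ) (hK : 1 ≤ K) (hl : 0 ≤ l)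
    (hα₁ : 0 ≤ α₁) (hα₂ : 0 ≤ α₂) (hα₃ : 0 ≤ α₃) (hq : 0 < q)
    (hbias : ∀ x ∈ cube d, |M.bias k θ' x| ≤ β) (hP : ∀ x ∈ cube d, ‖M.P k x‖ ≤ ζ)
    (hsmall : ζ * ‖θ - θ'‖ + β ≤ δ)
    (hQ : ∀ u : Coef d k, q * ‖u‖ ^ 2 ≤ inner ℝ u (Matrix.toEuclideanLin (M.Q k) u))
    (hG : ∀ u : Coef d k,
      (n : ℝ)⁻¹ * ∑ i : Fin n, inner ℝ (M.P k (z i).1) u ^ 2 ≤ K * ‖u‖ ^ 2)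
    (hGU : ∀ u : Coef d k, (n : ℝ)⁻¹ * ∑ i : Fin n,
      M.resid (z i) ^ 2 * inner ℝ (M.P k (z i).1) u ^ 2 ≤ K * ‖u‖ ^ 2)
    (hscore : ∀ u : Coef d k, |inner ℝ u (M.score n k z)| ≤ l * ‖u‖)
    (hQn : ∀ u v : Coef d k, |(n : ℝ)⁻¹ * ∑ i : Fin n, deriv M.F (M.index (z i).1) ^ 2 *
      inner ℝ (M.P k (z i).1) u * inner ℝ (M.P k (z i).1) v -
      inner ℝ v (Matrix.toEuclideanLin (M.Q k) u)| ≤ α₁ * (‖u‖ * ‖v‖))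
    (hR : ∀ u v : Coef d k, |(n : ℝ)⁻¹ * ∑ i : Fin n, M.resid (z i) *
      deriv (deriv M.F) (M.index (z i).1) * inner ℝ (M.P k (z i).1) u *
      inner ℝ (M.P k (z i).1) v| ≤ α₂ * (‖u‖ * ‖v‖))
    (hRb : ∀ u : Coef d k, |(n : ℝ)⁻¹ * ∑ i : Fin n, M.resid (z i) *
      deriv (deriv M.F) (M.index (z i).1) * M.bias k θ' (z i).1 *
      inner ℝ (M.P k (z i).1) u| ≤ α₃ * ‖u‖) {w : ℝ}
    (hw : w = (α₁ + α₂) * ‖θ - θ'‖ + α₃ +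
      8 * C ^ 2 * K ^ 2 * (ζ * ‖θ - θ'‖ + β) * (‖θ - θ'‖ + β)) :
    q * ‖θ - θ'‖ ≤ w + l + C ^ 2 * β * K ∧
    q * ‖θ - θ' - Matrix.toEuclideanLin (M.Q k)⁻¹ (M.score n k z) -
      Matrix.toEuclideanLin (M.Q k)⁻¹ (M.biasScore n k z θ')‖ ≤ w := by
  have hC := hL.one_le_C
  have hw0 : 0 ≤ w := by rw [hw]; positivity
  set T := Matrix.toEuclideanLin (M.Q k) with hT
  have hv : ∀ i : Fin n, M.index (z i).1 + (inner ℝ (M.P k (z i).1) (θ - θ') -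
      M.bias k θ' (z i).1) = inner ℝ (M.P k (z i).1) θ := fun i => by
    rw [Model.index_eq (hcube i), Model.bias, inner_sub_right]; ring
  have hfoc : ∀ u : Coef d k, ∑ i : Fin n, (M.F (M.index (z i).1) + M.resid (z i) -
      M.F (M.index (z i).1 + (inner ℝ (M.P k (z i).1) (θ - θ') - M.bias k θ' (z i).1))) *
      deriv M.F (M.index (z i).1 + (inner ℝ (M.P k (z i).1) (θ - θ') - M.bias k θ' (z i).1)) *
      inner ℝ (M.P k (z i).1) u = 0 := fun u => by
    simp only [hv, Model.resid, add_sub_cancel]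
    refine normal_equations hn hmin hint (fun i => hL.diff _ ⟨_, hcube i, rfl⟩ _ ?_) u
    rw [← hv, add_sub_cancel_left]
    refine le_trans ((abs_sub _ _).trans (add_le_add ?_ (hbias _ (hcube i)))) hsmall
    exact (abs_real_inner_le_norm _ _).trans (by gcongr; exact hP _ (hcube i))
  -- The bound for weighted Gram forms applied to the unit vector of the constant term, whose
  -- regressor is 1.
  have hU : (n : ℝ)⁻¹ * ∑ i : Fin n, M.resid (z i) ^ 2 ≤ K := by
    have h := hGU (EuclideanSpace.single none 1)
    simpa [inner_P, P_none] using h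
  have hmain : ∀ u : Coef d k, |inner ℝ u (T (θ - θ') - M.score n k z -
      M.biasScore n k z θ')| ≤ w * ‖u‖ := fun u => by
    have h1 := abs_normal_equations_remainder_le hL
      (P := fun i : Fin n => M.P k (z i).1) (D := θ - θ') (w := fun i => M.index (z i).1)
      (U := fun i => M.resid (z i)) (bi := fun i => M.bias k θ' (z i).1) (α := α₂) (α' := α₃)
      (fun i => ⟨_, hcube i, rfl⟩) hβ hζ (fun i => hbias _ (hcube i)) (fun i => hP _ (hcube i))
      hsmall hK hfoc hG hGU hU u ((hR _ u).trans_eq (by ring)) (hRb u)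
    rw [← inner_score hcube, ← inner_biasScore hcube] at h1
    have h2 := hQn (θ - θ') u
    rw [abs_le] at h1 h2 ⊢
    rw [inner_sub_right, inner_sub_right, hw]
    constructor <;> nlinarith [h1.1, h1.2, h2.1, h2.2]
  constructor
  -- The linearized equations are tested in the direction θ - θ' itself.
  · refine norm_le_of_coercive (hQ _) ?_ (by positivity)
    have h1 := hmain (θ - θ')
    have h2 := hscore (θ - θ')
    have h3 := abs_inner_biasScore_le hn hcube hL hβ hK hbias hG (θ - θ')
    rw [inner_sub_right, inner_sub_right] at h1
    rw [abs_le] at h1 h2 h3 ⊢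
    constructor <;> linarith [h1.1, h1.2, h2.1, h2.2, h3.1, h3.2]
  · set R := θ - θ' - Matrix.toEuclideanLin (M.Q k)⁻¹ (M.score n k z) -
      Matrix.toEuclideanLin (M.Q k)⁻¹ (M.biasScore n k z θ') with hRdef
    -- In finite dimension the left inverse provided by coercivity is also a right inverse.
    have hinv : ∀ y : Coef d k, T (Matrix.toEuclideanLin (M.Q k)⁻¹ y) = y := fun y => by
      have hinj : Function.Injective (Matrix.toEuclideanLin (M.Q k)⁻¹) := by
        refine LinearMap.injective_iff_surjective.2 fun v => ⟨T v, ?_⟩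
        exact toEuclideanLin_inv_apply hq hQ v
      exact hinj (toEuclideanLin_inv_apply hq hQ _)
    refine norm_le_of_coercive (hQ R) ?_ hw0
    have hTR : T R = T (θ - θ') - M.score n k z - M.biasScore n k z θ' := by
      rw [hRdef, map_sub, map_sub, hinv, hinv]
    rw [hTR]
    exact hmain R

/-- The rate implied by the linearization bound; `y = √κ` and `x = √(κ / n)`. -/
lemma rate_of_linearization {D w q x y K : ℝ} (hD : 0 ≤ D) (hx : 0 ≤ x) (hy : 1 ≤ y) (hK : 0 < K)
    (hq : 0 < q) (hw : w ≤ K * y * x * D + K * y * x ^ 2 + K * (y * D + x) * (D + x))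
    (hqD : q * D ≤ w + K * x) (hsmall : 2 * (K * (2 * (y * x) + y * D)) ≤ q) :
    D ≤ (2 * q + 2 * K) / q * x ∧
    w ≤ K * (1 + (2 * q + 2 * K) / q + ((2 * q + 2 * K) / q + 1) ^ 2) * (y * x ^ 2) := by
  have hxy : x ≤ y * x := le_mul_of_one_le_left hx hy
  -- The terms of w are grouped by their last factor, D or x. The common coefficient K(yx + yD + x)
  -- is at most q/2, so its D part is absorbed by q D on the left.
  have hD1 : D ≤ (2 * q + 2 * K) / q * x := by
    have h1 : K * (y * x + (y * D + x)) * D ≤ q / 2 * D := by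
      refine mul_le_mul_of_nonneg_right ?_ hD
      nlinarith
    have h2 : K * (y * x + (y * D + x)) * x ≤ q / 2 * x := by
      refine mul_le_mul_of_nonneg_right ?_ hx
      nlinarith
    rw [div_mul_eq_mul_div, le_div_iff₀ hq]
    nlinarith
  refine ⟨hD1, hw.trans ?_⟩
  set L := (2 * q + 2 * K) / q with hL
  have hL0 : 0 ≤ L := by positivity
  calc K * y * x * D + K * y * x ^ 2 + K * (y * D + x) * (D + x)
      ≤ K * y * x * (L * x) + K * y * x ^ 2 + K * (y * (L * x) + y * x) * (L * x + x) := by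
        gcongr
    _ = _ := by ring

end Linearization

/-! ### Stochastic orders of the terms of the expansion. -/

section StochasticBounds

variable {d : ℕ} {M : Model d} {Cθ : ℝ} {θ0 : ∀ κ : ℕ, Coef d κ} {κ : ℕ → ℕ}
  {Ω : Type*} [MeasurableSpace Ω] {Pr : Measure Ω} [IsProbabilityMeasure Pr]
  {Z : ℕ → Ω → (Fin d → ℝ) × ℝ} {δ c C a b : ℝ}

lemma memLp_mul_resid (h2 : AssumptionA2 M) (h3 : AssumptionA3 M) {g : (Fin d → ℝ) → ℝ}
    (hg : Measurable g) {B : ℝ} (hB : ∀ x ∈ cube d, |g x| ≤ B) :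
    MemLp (fun z => g z.1 * M.resid z) 2 M.law := by
  refine (memLp_resid h2 h3).of_le_mul (c := B)
    ((hg.comp measurable_fst).mul (Model.measurable_resid h3)).aestronglyMeasurable ?_
  filter_upwards [h2.ae_mem_cube] with z hz
  rw [norm_mul]
  gcongr
  exact hB _ hz

/-- The expectation vanishes because the disturbance has conditional mean zero. The bound on the
weight enters the rate as a factor, so that weights shrinking with n, such as the bias, give a
smaller order. -/
lemma exists_likely_linear_resid (h1 : AssumptionA1 M Pr Z) (h2 : AssumptionA2 M)
    (h3 : AssumptionA3 M) (h5 : AssumptionA5 M Cθ θ0) (h6 : AssumptionA6i κ)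
    {g : ℕ → (Fin d → ℝ) → ℝ} {B : ℕ → ℝ} (hg : ∀ n, Measurable (g n))
    (hB : ∀ᶠ n in atTop, 0 < B n ∧ ∀ x ∈ cube d, |g n x| ≤ B n) {ε : ℝ} (hε : 0 < ε) :
    ∃ K : ℝ, 0 < K ∧ Likely Pr ε fun n ω => ∀ u : Coef d (κ n),
      |(n : ℝ)⁻¹ * ∑ i : Fin n, g n (Z i ω).1 * M.resid (Z i ω) *
        inner ℝ (M.P (κ n) (Z i ω).1) u| ≤ K * (B n * √(κ n / n)) * ‖u‖ := by
  have hp := h1.isProbabilityMeasure_law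
  obtain ⟨CV, hCV, hV⟩ := exists_integral_mul_resid_sq_le h1 h2 h3
  obtain ⟨K, hK, hL⟩ := exists_likely_linear h1 h2 h5 h6
    (h := fun n z => g n z.1 * M.resid z) (b := fun n => CV * B n ^ 2)
    (fun n => ((hg n).comp measurable_fst).mul (Model.measurable_resid h3)) (by
      filter_upwards [hB] with n ⟨hB0, hBn⟩
      refine ⟨memLp_mul_resid h2 h3 (hg n) hBn, ?_⟩
      have hb2 : ∀ x ∈ cube d, |g n x ^ 2| ≤ B n ^ 2 := fun x hx => by
        rw [abs_pow]; gcongr; exact hBn x hx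
      have h7 := hV (fun x => g n x ^ 2) (B n ^ 2) ((hg n).pow_const 2) (fun x => sq_nonneg _) hb2
      simp only [mul_pow]
      refine h7.trans ?_
      gcongr
      calc ∫ z, g n z.1 ^ 2 ∂M.law ≤ ∫ _z, B n ^ 2 ∂M.law := by
            refine integral_mono_ae (integrable_of_cube_bound h2 (f := fun x => g n x ^ 2)
              ((hg n).pow_const 2) hb2) (integrable_const _) ?_
            filter_upwards [h2.ae_mem_cube] with z hz
            exact (le_abs_self _).trans (hb2 _ hz)
        _ = _ := by simp) (hB.mono fun n hn => by have := hn.1; positivity) hε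
  refine ⟨K * √CV, by positivity, hL.mono ?_⟩
  filter_upwards [hB] with n ⟨hB0, hBn⟩
  refine Eventually.of_forall fun ω hω u => ?_
  have h0 : ∫ z, g n z.1 * M.resid z * inner ℝ (M.P (κ n) z.1) u ∂M.law = 0 := by
    obtain ⟨A, hA⟩ := h5.exists_norm_P_le (κ n)
    rw [← integral_mul_resid h1 h2 h3 (g := fun x => g n x * inner ℝ (M.P (κ n) x) u)
      ((hg n).mul (h5.measurable_P _).inner_const) (B := B n * (A * ‖u‖)) fun x hx => ?_]
    · exact integral_congr_ae (Eventually.of_forall fun z => by ring)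
    · rw [abs_mul]
      gcongr
      · exact hBn x hx
      · exact (abs_real_inner_le_norm _ _).trans (by gcongr; exact hA x hx)
  have h7 := hω u
  rw [h0, sub_zero] at h7
  refine h7.trans (le_of_eq ?_)
  rw [show (κ n : ℝ) * (CV * B n ^ 2) / n = CV * (B n ^ 2 * (κ n / n)) by ring,
    Real.sqrt_mul hCV.le, Real.sqrt_mul (sq_nonneg _), Real.sqrt_sq hB0.le]
  ring

lemma exists_likely_quadratic_resid (h1 : AssumptionA1 M Pr Z) (h2 : AssumptionA2 M)
    (h3 : AssumptionA3 M) (h5 : AssumptionA5 M Cθ θ0) (h6 : AssumptionA6i κ)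
    {g : (Fin d → ℝ) → ℝ} {B : ℝ} (hg : Measurable g) (hB : ∀ x ∈ cube d, |g x| ≤ B)
    {ε : ℝ} (hε : 0 < ε) :
    ∃ K : ℝ, 0 < K ∧ Likely Pr ε fun n ω => ∀ u v : Coef d (κ n),
      |(n : ℝ)⁻¹ * ∑ i : Fin n, g (Z i ω).1 * M.resid (Z i ω) *
        inner ℝ (M.P (κ n) (Z i ω).1) u * inner ℝ (M.P (κ n) (Z i ω).1) v| ≤
      K * (κ n / √n) * (‖u‖ * ‖v‖) := by
  have hp := h1.isProbabilityMeasure_law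
  obtain ⟨K, hK, hL⟩ := exists_likely_quadratic h1 h2 h5 h6
    (h := fun z => g z.1 * M.resid z)
    ((hg.comp measurable_fst).mul (Model.measurable_resid h3)) (memLp_mul_resid h2 h3 hg hB) hε
  refine ⟨K, hK, hL.mono (Eventually.of_forall fun n => Eventually.of_forall fun ω hω u v => ?_)⟩
  have h0 : ∫ z, g z.1 * M.resid z * inner ℝ (M.P (κ n) z.1) u *
      inner ℝ (M.P (κ n) z.1) v ∂M.law = 0 := by
    obtain ⟨A, hA⟩ := h5.exists_norm_P_le (κ n)
    rw [← integral_mul_resid h1 h2 h3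
      (g := fun x => g x * (inner ℝ (M.P (κ n) x) u * inner ℝ (M.P (κ n) x) v))
      (hg.mul ((h5.measurable_P _).inner_const.mul (h5.measurable_P _).inner_const))
      (B := B * ((A * ‖u‖) * (A * ‖v‖))) fun x hx => ?_]
    · exact integral_congr_ae (Eventually.of_forall fun z => by ring)
    · have h8 : ∀ w : Coef d (κ n), |inner ℝ (M.P (κ n) x) w| ≤ A * ‖w‖ := fun w =>
        (abs_real_inner_le_norm _ _).trans (by gcongr; exact hA x hx)
      have h9 := hB x hx
      rw [abs_mul, abs_mul]
      exact mul_le_mul h9 (mul_le_mul (h8 u) (h8 v) (abs_nonneg _) ((abs_nonneg _).trans (h8 u)))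
        (by positivity) ((abs_nonneg _).trans h9)
  have h7 := hω u v
  rwa [h0, sub_zero] at h7

lemma eventually_div_sqrt_le (h6 : AssumptionA6i κ) {s : ℝ} (hs : 0 < s) :
    ∀ᶠ n : ℕ in atTop, (κ n : ℝ) / √n ≤ s := by
  obtain ⟨c, C, hc, hC, hκ⟩ := h6.exists_bounds
  filter_upwards [hκ, eventually_ge_atTop 1,
    eventually_mul_rpow_le (C / s) (show (3 / 10 : ℝ) < 1 / 2 by norm_num)] with n hn hn1 hr
  have hn0 : (0 : ℝ) < n := by exact_mod_cast hn1
  rw [div_le_iff₀ (by positivity), Real.sqrt_eq_rpow]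
  rw [div_mul_eq_mul_div, div_le_iff₀ hs] at hr
  linarith [hn.2]

/-- The expectation is at most CV · G by the bounded conditional variance. The deviation, O(κ/√n) by
the fourth moment of the disturbance, is eventually below 1, so the constant does not depend on ε.
-/
lemma exists_likely_resid_gram (h1 : AssumptionA1 M Pr Z) (h2 : AssumptionA2 M)
    (h3 : AssumptionA3 M) (h5 : AssumptionA5 M Cθ θ0) (h6 : AssumptionA6i κ) :
    ∃ K : ℝ, 0 < K ∧ ∀ ε : ℝ, 0 < ε → Likely Pr ε fun n ω => ∀ u : Coef d (κ n),
      (n : ℝ)⁻¹ * ∑ i : Fin n, M.resid (Z i ω) ^ 2 * inner ℝ (M.P (κ n) (Z i ω).1) u ^ 2 ≤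
        K * ‖u‖ ^ 2 := by
  have hp := h1.isProbabilityMeasure_law
  obtain ⟨CV, hCV, hV⟩ := exists_integral_mul_resid_sq_le h1 h2 h3
  obtain ⟨g, G, hg, hG, hgram⟩ := exists_gram_bounds h2 h5
  refine ⟨CV * G + 1, by positivity, fun ε hε => ?_⟩
  have hm : Measurable fun z => M.resid z ^ 2 := (Model.measurable_resid h3).pow_const 2
  obtain ⟨K, hK, hL⟩ := exists_likely_quadratic h1 h2 h5 h6 hm (by
    rw [memLp_two_iff_integrable_sq hm.aestronglyMeasurable]
    refine (integrable_resid_pow h2 (j := 4) (by norm_num)).congr ?_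
    refine Eventually.of_forall fun z => ?_
    simp only [← pow_mul]
    exact (even_two_mul 2).pow_abs _) hε
  refine hL.mono ?_
  filter_upwards [eventually_div_sqrt_le h6 (s := K⁻¹) (by positivity)] with n hn
  refine Eventually.of_forall fun ω hω u => ?_
  have h7 := (abs_le.1 (hω u u)).2
  have h8 : ∫ z, M.resid z ^ 2 * inner ℝ (M.P (κ n) z.1) u * inner ℝ (M.P (κ n) z.1) u ∂M.law ≤
      CV * G * ‖u‖ ^ 2 := by
    obtain ⟨A, hA⟩ := h5.exists_norm_P_le (κ n)
    have h9 := hV (fun x => inner ℝ (M.P (κ n) x) u ^ 2) ((A * ‖u‖) ^ 2)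
      ((h5.measurable_P _).inner_const.pow_const 2) (fun x => sq_nonneg _) fun x hx => by
        rw [abs_pow]
        gcongr
        exact (abs_real_inner_le_norm _ _).trans (by gcongr; exact hA x hx)
    calc _ = ∫ z, inner ℝ (M.P (κ n) z.1) u ^ 2 * M.resid z ^ 2 ∂M.law :=
          integral_congr_ae (Eventually.of_forall fun z => by ring)
      _ ≤ CV * (G * ‖u‖ ^ 2) := h9.trans (by gcongr; exact (hgram _ u).2.2)
      _ = _ := by ring
  have h10 : K * (κ n / √n) * (‖u‖ * ‖u‖) ≤ 1 * ‖u‖ ^ 2 := by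
    rw [sq]
    gcongr
    calc K * (κ n / √n) ≤ K * K⁻¹ := by gcongr
      _ = 1 := mul_inv_cancel₀ hK.ne'
  have h11 : ∑ i : Fin n, M.resid (Z i ω) ^ 2 * inner ℝ (M.P (κ n) (Z i ω).1) u ^ 2 =
      ∑ i : Fin n, M.resid (Z i ω) ^ 2 * inner ℝ (M.P (κ n) (Z i ω).1) u *
        inner ℝ (M.P (κ n) (Z i ω).1) u := Finset.sum_congr rfl fun i _ => by ring
  rw [h11]
  linarith

lemma exists_likely_Q (h1 : AssumptionA1 M Pr Z) (h2 : AssumptionA2 M)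
    (h3 : AssumptionA3 M) (h5 : AssumptionA5 M Cθ θ0) (h6 : AssumptionA6i κ)
    (hL : LinkRegular M.F (M.index '' cube d) δ c C a b) {ε : ℝ} (hε : 0 < ε) :
    ∃ K : ℝ, 0 < K ∧ Likely Pr ε fun n ω => ∀ u v : Coef d (κ n),
      |(n : ℝ)⁻¹ * ∑ i : Fin n, deriv M.F (M.index (Z i ω).1) ^ 2 *
        inner ℝ (M.P (κ n) (Z i ω).1) u * inner ℝ (M.P (κ n) (Z i ω).1) v -
        inner ℝ v (Matrix.toEuclideanLin (M.Q (κ n)) u)| ≤ K * (κ n / √n) * (‖u‖ * ‖v‖) := by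
  have hp := h1.isProbabilityMeasure_law
  have hm := (measurable_deriv_index h3).pow_const 2
  obtain ⟨K, hK, hLk⟩ := exists_likely_quadratic h1 h2 h5 h6
    (h := fun z => deriv M.F (M.index z.1) ^ 2) (hm.comp measurable_fst)
    (MemLp.of_bound (hm.comp measurable_fst).aestronglyMeasurable (C ^ 2)
      (h2.ae_mem_cube.mono fun z hz => by
        rw [Real.norm_eq_abs, abs_pow]
        gcongr
        exact abs_deriv_index_le hL hz)) hε
  refine ⟨K, hK, hLk.mono (Eventually.of_forall fun n => Eventually.of_forall fun ω hω u v => ?_)⟩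
  rw [real_inner_comm, real_inner_comm, inner_Q h2 h3 h5 hL]
  have h8 : ∀ z : (Fin d → ℝ) × ℝ, deriv M.F (M.index z.1) ^ 2 * inner ℝ (M.P (κ n) z.1) v *
      inner ℝ (M.P (κ n) z.1) u = deriv M.F (M.index z.1) ^ 2 * inner ℝ (M.P (κ n) z.1) u *
      inner ℝ (M.P (κ n) z.1) v := fun z => by ring
  simp only [h8]
  exact hω u v

/-- The squared norm is O(n^{-32/100}) and κ = O(n^{3/10}), which leaves n^{-2/100}. The factor √κ
makes the fitted indices uniformly close to the true ones. -/
lemma whp_sqrt_mul_norm_le (hd : 0 < d)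
    (h1 : AssumptionA1 M Pr Z) (h2 : AssumptionA2 M) (h3 : AssumptionA3 M)
    (h5 : AssumptionA5 M Cθ θ0) (h6 : AssumptionA6i κ) {θhat : ∀ n : ℕ, Ω → Coef d (κ n)}
    (hmin : ∀ n, ∀ᵐ ω ∂Pr,
      IsMinOn (M.S n (κ n) (fun i => Z i ω)) (Theta d (κ n) Cθ) (θhat n ω)) {s : ℝ} (hs : 0 < s) :
    Whp Pr fun n ω => √(κ n) * ‖θhat n ω - θ0 (κ n)‖ ≤ s := by
  obtain ⟨A, hA, hW⟩ := whp_norm_sub_sq_le hd h1 h2 h3 h5 h6 hmin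
  obtain ⟨c, C, hc, hC, hκ⟩ := h6.exists_bounds
  refine hW.mono ?_
  filter_upwards [hκ, eventually_ge_atTop 1,
    eventually_mul_rpow_le (C * A / s ^ 2) (show (-(2 / 100) : ℝ) < 0 by norm_num)] with n hn hn1 hr
  refine Eventually.of_forall fun ω hω => ?_
  have hn0 : (0 : ℝ) < n := by exact_mod_cast hn1
  rw [Real.rpow_zero, div_mul_eq_mul_div, div_le_one (by positivity)] at hr
  refine abs_le_of_sq_le_sq' ?_ hs.le |>.2
  rw [mul_pow, Real.sq_sqrt (by positivity)]
  calc (κ n : ℝ) * ‖θhat n ω - θ0 (κ n)‖ ^ 2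
      ≤ (C * (n : ℝ) ^ (3 / 10 : ℝ)) * (A * (n : ℝ) ^ (-(32 / 100) : ℝ)) := by
        gcongr
        exact hn.2
    _ = C * A * ((n : ℝ) ^ (3 / 10 : ℝ) * (n : ℝ) ^ (-(32 / 100) : ℝ)) := by ring
    _ = C * A * (n : ℝ) ^ (-(2 / 100) : ℝ) := by rw [← Real.rpow_add hn0]; norm_num
    _ ≤ _ := hr

end StochasticBounds

/-! ### Assembly of the convergence rates. -/

section Rates

variable {d : ℕ} {M : Model d} {Cθ : ℝ} {θ0 : ∀ κ : ℕ, Coef d κ} {κ : ℕ → ℕ}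
  {Ω : Type*} [MeasurableSpace Ω] {Pr : Measure Ω} [IsProbabilityMeasure Pr]
  {Z : ℕ → Ω → (Fin d → ℝ) × ℝ} {δ c C a b : ℝ}

/-- The estimation error and its linearization error for a fixed sample, given stochastic bounds
of the right orders; here `y = √κ` and `x = √(κ / n)`. -/
lemma rate_of_isMinOn {n k : ℕ} {z : ℕ → (Fin d → ℝ) × ℝ} {θ θ' : Coef d k} (hn : 0 < n)
    (hL : LinkRegular M.F (M.index '' cube d) δ c C a b) (hcube : ∀ i, (z i).1 ∈ cube d)
    (hmin : IsMinOn (M.S n k z) (Theta d k Cθ) θ) {B Y G q K₁ K₂ K₃ K₄ s ρ x y A : ℝ}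
    (hx : 0 ≤ x) (hy : 1 ≤ y) (hB : 0 < B) (hY : 0 < Y) (hG : 1 ≤ G) (hq : 0 < q)
    (hK₁ : 0 < K₁) (hK₂ : 0 < K₂) (hK₃ : 0 < K₃) (hK₄ : 0 < K₄)
    (hA : A = K₁ + K₂ + K₃ + K₄ + 8 * C ^ 2 * G ^ 2 * (Y + B) * (1 + B) + C ^ 2 * B * G)
    (hsδ : (Y + B) * (2 * s) ≤ δ) (hsρ : s * (1 + 2 ^ (d + 1) * B) < ρ) (hsq : 6 * A * s ≤ q)
    (hyx : y * x ≤ s) (hyD : y * ‖θ - θ'‖ ≤ s)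
    (hmargin : ∀ i, |θ' i| ≤ Cθ - ρ + 2 ^ (d + 1) * (B * x))
    (hbias : ∀ v ∈ cube d, |M.bias k θ' v| ≤ B * x) (hP : ∀ v ∈ cube d, ‖M.P k v‖ ≤ Y * y)
    (hQ : ∀ u : Coef d k, q * ‖u‖ ^ 2 ≤ inner ℝ u (Matrix.toEuclideanLin (M.Q k) u))
    (hgram : ∀ u : Coef d k,
      (n : ℝ)⁻¹ * ∑ i : Fin n, inner ℝ (M.P k (z i).1) u ^ 2 ≤ G * ‖u‖ ^ 2)
    (hGU : ∀ u : Coef d k, (n : ℝ)⁻¹ * ∑ i : Fin n,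
      M.resid (z i) ^ 2 * inner ℝ (M.P k (z i).1) u ^ 2 ≤ G * ‖u‖ ^ 2)
    (hscore : ∀ u : Coef d k, |(n : ℝ)⁻¹ * ∑ i : Fin n, deriv M.F (M.index (z i).1) *
      M.resid (z i) * inner ℝ (M.P k (z i).1) u| ≤ K₄ * x * ‖u‖)
    (hQn : ∀ u v : Coef d k, |(n : ℝ)⁻¹ * ∑ i : Fin n, deriv M.F (M.index (z i).1) ^ 2 *
      inner ℝ (M.P k (z i).1) u * inner ℝ (M.P k (z i).1) v -
      inner ℝ v (Matrix.toEuclideanLin (M.Q k) u)| ≤ K₁ * (y * x) * (‖u‖ * ‖v‖))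
    (hR : ∀ u v : Coef d k, |(n : ℝ)⁻¹ * ∑ i : Fin n, deriv (deriv M.F) (M.index (z i).1) *
      M.resid (z i) * inner ℝ (M.P k (z i).1) u *
      inner ℝ (M.P k (z i).1) v| ≤ K₂ * (y * x) * (‖u‖ * ‖v‖))
    (hRb : ∀ u : Coef d k, |(n : ℝ)⁻¹ * ∑ i : Fin n, deriv (deriv M.F) (M.index (z i).1) *
      (M.index (z i).1 - inner ℝ (M.P k (z i).1) θ') * M.resid (z i) *
      inner ℝ (M.P k (z i).1) u| ≤ K₃ * (y * x ^ 2) * ‖u‖) :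
    ‖θ - θ'‖ ≤ (2 * q + 2 * A) / q * x ∧
    ‖θ - θ' - Matrix.toEuclideanLin (M.Q k)⁻¹ (M.score n k z) -
      Matrix.toEuclideanLin (M.Q k)⁻¹ (M.biasScore n k z θ')‖ ≤
      A * (1 + (2 * q + 2 * A) / q + ((2 * q + 2 * A) / q + 1) ^ 2) / q * (y * x ^ 2) := by
  have hC := hL.one_le_C
  have hA0 : 0 < A := by rw [hA]; positivity
  have hy0 : 0 < y := one_pos.trans_le hy
  set D := ‖θ - θ'‖ with hD
  have hD0 : 0 ≤ D := norm_nonneg _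
  have hxs : x ≤ s := (le_mul_of_one_le_left hx hy).trans hyx
  have hDs : D ≤ s := (le_mul_of_one_le_left hD0 hy).trans hyD
  -- The estimator inherits interiority: each coordinate is within D ≤ s of θ', which is inside by ρ
  -- up to the bias, and s(1 + 2^(d+1) B) < ρ.
  have hint : ∀ i, |θ i| < Cθ := fun i => by
    have h1 : |(θ - θ') i| ≤ D := by
      rw [← Real.norm_eq_abs]; exact PiLp.norm_apply_le _ i
    have h2 : |θ i| ≤ |(θ - θ') i| + |θ' i| := by
      refine le_trans (le_of_eq ?_) (abs_add_le _ _)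
      simp
    have h3 : (2 : ℝ) ^ (d + 1) * (B * x) ≤ 2 ^ (d + 1) * (B * s) := by gcongr
    linarith [hmargin i]
  have hηle : Y * y * D + B * x ≤ (Y + B) * (y * D + x) := by
    have h1 : 0 ≤ B * (y * D) := by positivity
    have h2 : 0 ≤ Y * x := by positivity
    linarith
  have hsmall : Y * y * D + B * x ≤ δ := by
    refine hηle.trans (le_trans ?_ hsδ)
    gcongr
    linarith
  obtain ⟨h1, h2⟩ := linearization_of_isMinOn hn hL hcube hmin hint (β := B * x) (ζ := Y * y)
    (K := G) (q := q) (l := K₄ * x) (α₁ := K₁ * (y * x)) (α₂ := K₂ * (y * x))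
    (α₃ := K₃ * (y * x ^ 2)) (by positivity) (by positivity) hG (by positivity) (by positivity)
    (by positivity) (by positivity) hq hbias hP hsmall hQ hgram hGU
    (fun u => by rw [inner_score hcube]; exact hscore u) hQn
    (fun u v => by simpa only [mul_comm (M.resid _)] using hR u v)
    (fun u => by
      have h := hRb u
      have e : ∀ i : Fin n, deriv (deriv M.F) (M.index (z i).1) *
          (M.index (z i).1 - inner ℝ (M.P k (z i).1) θ') * M.resid (z i) *
          inner ℝ (M.P k (z i).1) u = M.resid (z i) * deriv (deriv M.F) (M.index (z i).1) *
          M.bias k θ' (z i).1 * inner ℝ (M.P k (z i).1) u := fun i => by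
        rw [Model.bias, ← Model.index_eq (hcube i)]; ring
      simpa only [e] using h) rfl
  set w := (K₁ * (y * x) + K₂ * (y * x)) * ‖θ - θ'‖ + K₃ * (y * x ^ 2) +
      8 * C ^ 2 * G ^ 2 * (Y * y * ‖θ - θ'‖ + B * x) * (‖θ - θ'‖ + B * x) with hw
  have hE0 : 0 ≤ 8 * C ^ 2 * G ^ 2 * (Y + B) * (1 + B) := by positivity
  have hF0 : 0 ≤ C ^ 2 * B * G := by positivity
  have hwA : w ≤ A * y * x * D + A * y * x ^ 2 + A * (y * D + x) * (D + x) := by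
    have h3 : D + B * x ≤ (1 + B) * (D + x) := by
      have h1 : 0 ≤ B * D := by positivity
      linarith
    calc w ≤ (K₁ + K₂) * (y * x * D) + K₃ * (y * x ^ 2) +
          8 * C ^ 2 * G ^ 2 * ((Y + B) * (y * D + x)) * ((1 + B) * (D + x)) := by
          rw [hw, ← hD]
          have : (K₁ * (y * x) + K₂ * (y * x)) * D = (K₁ + K₂) * (y * x * D) := by ring
          rw [this]
          gcongr
      _ = (K₁ + K₂) * (y * x * D) + K₃ * (y * x ^ 2) +
          8 * C ^ 2 * G ^ 2 * (Y + B) * (1 + B) * ((y * D + x) * (D + x)) := by ring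
      _ ≤ A * (y * x * D) + A * (y * x ^ 2) + A * ((y * D + x) * (D + x)) := by
          gcongr <;> linarith
      _ = _ := by ring
  have hqD : q * D ≤ w + A * x := by
    refine h1.trans ?_
    have h3 : (K₄ + C ^ 2 * B * G) * x ≤ A * x := by gcongr; linarith
    linarith
  have hfin : 2 * (A * (2 * (y * x) + y * D)) ≤ q := by
    refine le_trans ?_ hsq
    have h3 : A * (2 * (y * x) + y * D) ≤ A * (2 * s + s) := by gcongr
    linarith
  obtain ⟨h5, h6⟩ := rate_of_linearization hD0 hx hy hA0 hq hwA hqD hfin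
  refine ⟨h5, ?_⟩
  rw [div_mul_eq_mul_div, le_div_iff₀ hq, mul_comm]
  exact h2.trans h6

lemma exists_likely_rate (hd : 0 < d)
    (h1 : AssumptionA1 M Pr Z) (h2 : AssumptionA2 M) (h3 : AssumptionA3 M)
    (h5 : AssumptionA5 M Cθ θ0) (h6 : AssumptionA6i κ) {θhat : ∀ n : ℕ, Ω → Coef d (κ n)}
    (hmin : ∀ n, ∀ᵐ ω ∂Pr,
      IsMinOn (M.S n (κ n) (fun i => Z i ω)) (Theta d (κ n) Cθ) (θhat n ω)) {ε : ℝ} (hε : 0 < ε) :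
    ∃ L : ℝ, 0 < L ∧ Likely Pr ε fun n ω =>
      ‖θhat n ω - θ0 (κ n)‖ ≤ L * √(κ n / n) ∧
      ‖θhat n ω - θ0 (κ n) -
        Matrix.toEuclideanLin (M.Q (κ n))⁻¹ (M.score n (κ n) fun i => Z i ω) -
        Matrix.toEuclideanLin (M.Q (κ n))⁻¹ (M.biasScore n (κ n) (fun i => Z i ω) (θ0 (κ n)))‖ ≤
        L * (√(κ n) * √(κ n / n) ^ 2) := by
  have hp := h1.isProbabilityMeasure_law
  obtain ⟨δ, c, C, a, b, hL⟩ := h3.exists_linkRegular hd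
  obtain ⟨B, hB, hbias⟩ := exists_bias_bound h5 h6
  obtain ⟨Cz, hCz, hz⟩ := h5.exists_norm_P_sq_le
  obtain ⟨g, G, hg, hG, hgram⟩ := whp_gramBounded h1 h2 h5 h6
  obtain ⟨ρ, hρ, hmargin⟩ := exists_thetaSeries_margin h3 h5 hd
  obtain ⟨q, hq, hQ⟩ := exists_le_inner_Q h2 h3 h5 hL
  have hC := hL.one_le_C
  have hδ := hL.delta_pos
  have hε' : 0 < ε / 6 := by positivity
  obtain ⟨K₁, hK₁, hE₁⟩ := exists_likely_Q h1 h2 h3 h5 h6 hL hε'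
  obtain ⟨K₂, hK₂, hE₂⟩ := exists_likely_quadratic_resid h1 h2 h3 h5 h6
    (measurable_deriv_deriv_index h3) (fun x hx => hL.deriv2_hi _ ⟨x, hx, rfl⟩) hε'
  -- The bias is written with the extended index, which is continuous everywhere, so that the weight
  -- is measurable off the cube as well.
  have hbm : ∀ n, Measurable fun x => deriv (deriv M.F) (M.index x) *
      (M.index x - inner ℝ (M.P (κ n) x) (θ0 (κ n))) := fun n =>
    (measurable_deriv_deriv_index h3).mul ((Model.continuous_index h3).measurable.sub
      (h5.measurable_P _).inner_const)
  obtain ⟨K₃, hK₃, hE₃⟩ := exists_likely_linear_resid h1 h2 h3 h5 h6 hbm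
    (B := fun n => C * (B * (n : ℝ) ^ (-(1 / 2) : ℝ))) (by
      filter_upwards [hbias, eventually_ge_atTop 1] with n hn hn1
      have hn0 : (0 : ℝ) < n := by exact_mod_cast hn1
      refine ⟨by positivity, fun x hx => ?_⟩
      rw [abs_mul]
      have h7 := hn x hx
      rw [Model.bias, ← Model.index_eq hx] at h7
      have h8 := hL.deriv2_hi _ ⟨x, hx, rfl⟩
      gcongr) hε'
  obtain ⟨K₄, hK₄, hE₄⟩ := exists_likely_linear_resid h1 h2 h3 h5 h6
    (g := fun _ x => deriv M.F (M.index x)) (fun _ => measurable_deriv_index h3)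
    (B := fun _ => C) (Eventually.of_forall fun n => ⟨by linarith, fun x hx =>
      abs_deriv_index_le hL hx⟩) hε'
  obtain ⟨K₅, hK₅, hE₅⟩ := exists_likely_resid_gram h1 h2 h3 h5 h6
  set A : ℝ := K₁ + K₂ + K₃ * (C * B) + K₄ * C +
    8 * C ^ 2 * (G + K₅) ^ 2 * (√Cz + B) * (1 + B) + C ^ 2 * B * (G + K₅) with hA
  have hY : 0 < √Cz := by positivity
  have hA0 : 0 < A := by positivity
  -- A single bound s for both yx and yD secures the three needs: fitted indices in the smooth
  -- region, an interior minimizer, and absorption of the D terms.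
  obtain ⟨s, hs, hsδ, hsρ, hsq⟩ : ∃ s : ℝ, 0 < s ∧ (√Cz + B) * (2 * s) ≤ δ ∧
      s * (1 + 2 ^ (d + 1) * B) < ρ ∧ 6 * A * s ≤ q := by
    refine ⟨min (δ / (2 * (√Cz + B))) (min (ρ / (2 * (1 + 2 ^ (d + 1) * B))) (q / (6 * A))),
      by positivity, ?_, ?_, ?_⟩
    · calc _ ≤ (√Cz + B) * (2 * (δ / (2 * (√Cz + B)))) := by gcongr; exact min_le_left _ _
        _ = δ := by field_simp
    · calc _ ≤ ρ / (2 * (1 + 2 ^ (d + 1) * B)) * (1 + 2 ^ (d + 1) * B) := by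
            gcongr; exact (min_le_right _ _).trans (min_le_left _ _)
        _ = ρ / 2 := by field_simp
        _ < ρ := by linarith
    · calc _ ≤ 6 * A * (q / (6 * A)) := by
            gcongr; exact (min_le_right _ _).trans (min_le_right _ _)
        _ = q := by field_simp
  have hW := ((whp_sqrt_mul_norm_le hd h1 h2 h3 h5 h6 hmin hs).and hgram).likely hε'
  have hall := (((((hE₁.and hε'.le hε'.le hE₂).and (by positivity) hε'.le hE₃).and (by positivity)
    hε'.le hE₄).and (by positivity) hε'.le (hE₅ _ hε')).and (by positivity) hε'.le hW)
  rw [show ε / 6 + ε / 6 + ε / 6 + ε / 6 + ε / 6 + ε / 6 = ε by ring] at hall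
  set L₁ : ℝ := (2 * q + 2 * A) / q with hL₁
  have hL₁0 : 0 < L₁ := by positivity
  set L₂ : ℝ := A * (1 + L₁ + (L₁ + 1) ^ 2) / q with hL₂
  have hL₂0 : 0 < L₂ := by positivity
  refine ⟨L₁ + L₂, by positivity, hall.mono ?_⟩
  filter_upwards [hbias, h6.tendsto.eventually hz, eventually_div_sqrt_le h6 hs,
    h6.tendsto.eventually (eventually_ge_atTop 1), eventually_ge_atTop 1] with n hbn hzn hsn hκ1 hn
  filter_upwards [ae_sample_mem_cube h1 h2, hmin n] with ω hcube hmn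
  rintro ⟨⟨⟨⟨⟨e₁, e₂⟩, e₃⟩, e₄⟩, e₅⟩, e₆, e₇⟩
  have hn0 : (0 : ℝ) < n := by exact_mod_cast hn
  have hκ0 : (1 : ℝ) ≤ κ n := by exact_mod_cast hκ1
  have hyx : (κ n : ℝ) / √n = √(κ n) * √(κ n / n) := by
    rw [Real.sqrt_div (by positivity), ← mul_div_assoc, Real.mul_self_sqrt (by positivity)]
  have hnx : (n : ℝ) ^ (-(1 / 2) : ℝ) ≤ √(κ n / n) := by
    rw [Real.rpow_neg hn0.le, ← Real.sqrt_eq_rpow, ← Real.sqrt_inv, inv_eq_one_div]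
    gcongr
  have hβx : ∀ x ∈ cube d, |M.bias (κ n) (θ0 (κ n)) x| ≤ B * √(κ n / n) := fun x hx =>
    (hbn x hx).trans (by gcongr)
  have hy1 : 1 ≤ √(κ n : ℝ) := by rwa [Real.one_le_sqrt]
  have hGK : G ≤ G + K₅ := by linarith
  have hres := rate_of_isMinOn (z := fun i => Z i ω) (x := √(κ n / n)) (y := √(κ n)) (G := G + K₅)
    (Y := √Cz) (B := B) (θ' := θ0 (κ n)) (s := s) (ρ := ρ) (K₁ := K₁) (K₂ := K₂)
    (K₃ := K₃ * (C * B)) (K₄ := K₄ * C) (A := A) (q := q) hn hL hcube hmn (by positivity) hy1 hB hY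
    (by linarith) hq hK₁ hK₂ (by positivity) (by positivity) hA hsδ hsρ hsq (hyx ▸ hsn) e₆
    (fun i => by
      have h7 := abs_thetaSeries_sub_le h3 h5 (θ0 (κ n)) hβx i
      have h8 := hmargin (κ n) hκ1 i
      have h9 := abs_sub_abs_le_abs_sub (θ0 (κ n) i) (M.thetaSeries (κ n) i)
      rw [abs_sub_comm] at h9
      linarith)
    hβx (fun x hx => by
      rw [← Real.sqrt_mul (by positivity)]
      exact Real.le_sqrt_of_sq_le (hzn x hx))
    (hQ _) (fun u => (e₇ u).2.trans (by gcongr)) (fun u => (e₅ u).trans (by gcongr; linarith))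
    (fun u => (e₄ u).trans_eq (by ring)) (fun u v => by rw [← hyx]; exact e₁ u v)
    (fun u v => by rw [← hyx]; exact e₂ u v)
    (fun u => (e₃ u).trans (by
      refine mul_le_mul_of_nonneg_right ?_ (norm_nonneg u)
      calc K₃ * (C * (B * (n : ℝ) ^ (-(1 / 2) : ℝ)) * √(κ n / n))
          ≤ K₃ * (C * (B * √(κ n / n)) * √(κ n / n)) := by gcongr
        _ = K₃ * (C * B) * (1 * √(κ n / n) ^ 2) := by ring
        _ ≤ K₃ * (C * B) * (√(κ n) * √(κ n / n) ^ 2) := by gcongr))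
  rw [← hL₁, ← hL₂] at hres
  refine ⟨hres.1.trans ?_, hres.2.trans ?_⟩
  · gcongr; linarith
  · gcongr; linarith

lemma mTilde_sub_mSum (k : ℕ) (θ θ' : Coef d k) (x : Fin d → ℝ) :
    M.mTilde k θ x - M.mSum x =
      inner ℝ (M.P k x) (θ - θ') - M.bias k θ' x - (θ none - M.mu) := by
  have h : inner ℝ (M.P k x) θ = θ none + M.mTilde k θ x := by
    rw [inner_P, Fintype.sum_option, Fintype.sum_prod_type]
    simp [Model.mTilde, P_none, P_some]
  rw [Model.bias, inner_sub_right, h]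
  ring

/-- Dropping the constant term leaves its own error, at most ‖θ - θ'‖ plus |μ - θ'_0|, with θ'_0 the
constant coefficient of θ'. The latter is controlled by the bias, since the constant series
coefficient is μ. -/
lemma abs_mTilde_sub_mSum_le (h3 : AssumptionA3 M) (h5 : AssumptionA5 M Cθ θ0) {k : ℕ}
    {θ θ' : Coef d k} {β ζ : ℝ} (hbias : ∀ x ∈ cube d, |M.bias k θ' x| ≤ β)
    (hP : ∀ x ∈ cube d, ‖M.P k x‖ ≤ ζ) {x : Fin d → ℝ} (hx : x ∈ cube d) :
    |M.mTilde k θ x - M.mSum x| ≤ (ζ + 1) * ‖θ - θ'‖ + (1 + 2 ^ (d + 1)) * β := by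
  have h1 : |inner ℝ (M.P k x) (θ - θ')| ≤ ζ * ‖θ - θ'‖ :=
    (abs_real_inner_le_norm _ _).trans (by gcongr; exact hP x hx)
  have h2 := hbias x hx
  have h4 : |M.mu - θ' none| ≤ 2 ^ (d + 1) * β := abs_thetaSeries_sub_le h3 h5 θ' hbias none
  have h6 : |θ none - θ' none| ≤ ‖θ - θ'‖ := by
    have := PiLp.norm_apply_le (θ - θ') none
    rwa [Real.norm_eq_abs] at this
  rw [mTilde_sub_mSum k θ θ' x]
  rw [abs_le] at h1 h2 h4 h6 ⊢
  constructor <;> linarith [h1.1, h1.2, h2.1, h2.2, h4.1, h4.2, h6.1, h6.2]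

end Rates

end SeriesLS

end

/-! ### The four conclusions. -/

theorem theorem1 {d : ℕ} (hd : 2 ≤ d) (M : SeriesLS.Model d)
    {Ω : Type*} [MeasurableSpace Ω] (Pr : Measure Ω) [IsProbabilityMeasure Pr]
    (Z : ℕ → Ω → (Fin d → ℝ) × ℝ)
    (Cθ : ℝ) (θ0 : ∀ κ : ℕ, SeriesLS.Coef d κ) (κ : ℕ → ℕ)
    (hA1 : SeriesLS.AssumptionA1 M Pr Z) (hA2 : SeriesLS.AssumptionA2 M)
    (hA3 : SeriesLS.AssumptionA3 M) (hA4 : SeriesLS.AssumptionA4 M)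
    (hA5 : SeriesLS.AssumptionA5 M Cθ θ0) (hA6 : SeriesLS.AssumptionA6i κ)
    (θhat : ∀ n : ℕ, Ω → SeriesLS.Coef d (κ n))
    (hmeas : ∀ n, Measurable (θhat n))
    (hmem : ∀ n, ∀ᵐ ω ∂Pr, θhat n ω ∈ SeriesLS.Theta d (κ n) Cθ)
    (hmin : ∀ n, ∀ᵐ ω ∂Pr,
      IsMinOn (M.S n (κ n) (fun i => Z i ω)) (SeriesLS.Theta d (κ n) Cθ) (θhat n ω)) :
    (∀ᵐ ω ∂Pr, Tendsto (fun n => ‖θhat n ω - θ0 (κ n)‖) atTop (𝓝 0)) ∧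
    SeriesLS.IsBigOp Pr (fun n ω => ‖θhat n ω - θ0 (κ n)‖ₑ)
      (fun n => (κ n : ℝ) ^ (1 / 2 : ℝ) / (n : ℝ) ^ (1 / 2 : ℝ) + (κ n : ℝ) ^ (-2 : ℝ)) ∧
    SeriesLS.IsBigOp Pr
      (fun n ω => ⨆ x ∈ SeriesLS.cube d, ‖M.mTilde (κ n) (θhat n ω) x - M.mSum x‖ₑ)
      (fun n => (κ n : ℝ) / (n : ℝ) ^ (1 / 2 : ℝ) + (κ n : ℝ) ^ (-(3 / 2) : ℝ)) ∧
    ∃ R : ∀ n : ℕ, Ω → SeriesLS.Coef d (κ n),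
      (∀ n ω, θhat n ω - θ0 (κ n) =
        (n : ℝ)⁻¹ • Matrix.toEuclideanLin (M.Q (κ n))⁻¹
          (∑ i ∈ Finset.range n,
            (M.dF (Z i ω).1 * M.U (Z i ω)) • M.P (κ n) (Z i ω).1) +
        (n : ℝ)⁻¹ • Matrix.toEuclideanLin (M.Q (κ n))⁻¹
          (∑ i ∈ Finset.range n,
            (M.dF (Z i ω).1 ^ 2 * M.bias (κ n) (θ0 (κ n)) (Z i ω).1) •
              M.P (κ n) (Z i ω).1) +
        R n ω) ∧
      SeriesLS.IsBigOp Pr (fun n ω => ‖R n ω‖ₑ)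
        (fun n => (κ n : ℝ) ^ (3 / 2 : ℝ) / (n : ℝ) + (n : ℝ) ^ (-(1 / 2) : ℝ)) := by
  have hd0 : 0 < d := by omega
  have hrate : ∀ ε : ℝ, 0 < ε → _ := fun ε hε =>
    SeriesLS.exists_likely_rate hd0 hA1 hA2 hA3 hA5 hA6 hmin hε
  refine ⟨?_, ?_, ?_, ?_⟩
  -- Countably many thresholds 1/(j + 1) share one null set; the factor √κ ≥ 1 is then discarded.
  · have hW : ∀ j : ℕ, ∀ᵐ ω ∂Pr, ∀ᶠ n in atTop,
        √(κ n) * ‖θhat n ω - θ0 (κ n)‖ ≤ ((j : ℝ) + 1)⁻¹ := fun j =>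
      (SeriesLS.whp_sqrt_mul_norm_le hd0 hA1 hA2 hA3 hA5 hA6 hmin (by positivity)).1
    filter_upwards [ae_all_iff.2 hW] with ω hω
    rw [Metric.tendsto_nhds]
    intro ε hε
    obtain ⟨j, hj⟩ := exists_nat_one_div_lt hε
    filter_upwards [hω j, hA6.tendsto.eventually (eventually_ge_atTop 1)] with n hn hκ1
    have hy1 : 1 ≤ √(κ n : ℝ) := by rw [Real.one_le_sqrt]; exact_mod_cast hκ1
    rw [dist_zero_right, norm_norm]
    refine (le_mul_of_one_le_left (norm_nonneg _) hy1).trans_lt (hn.trans_lt ?_)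
    rwa [← one_div]
  · refine SeriesLS.isBigOp_of_likely fun ε hε => ?_
    obtain ⟨L, hL, h⟩ := hrate ε hε
    refine ⟨L, hL.le, h.mono (Eventually.of_forall fun n => Eventually.of_forall fun ω hω => ?_)⟩
    rw [← ofReal_norm]
    refine ENNReal.ofReal_le_ofReal (hω.1.trans ?_)
    rw [Real.sqrt_div (by positivity), Real.sqrt_eq_rpow, Real.sqrt_eq_rpow]
    gcongr
    -- The stochastic term alone already dominates, the bias having been absorbed in it.
    exact le_add_of_nonneg_right (by positivity)
  · refine SeriesLS.isBigOp_of_likely fun ε hε => ?_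
    obtain ⟨L, hL, h⟩ := hrate ε hε
    obtain ⟨B, hB, hbias⟩ := SeriesLS.exists_bias_bound hA5 hA6
    obtain ⟨Cz, hCz, hz⟩ := hA5.exists_norm_P_sq_le
    refine ⟨(√Cz + 1) * L + (1 + 2 ^ (d + 1)) * B, by positivity, h.mono ?_⟩
    filter_upwards [hbias, hA6.tendsto.eventually hz, eventually_ge_atTop 1,
      hA6.tendsto.eventually (eventually_ge_atTop 1)] with n hbn hzn hn1 hκ1
    refine Eventually.of_forall fun ω hω => iSup₂_le fun x hx => ?_
    have hn0 : (0 : ℝ) < n := by exact_mod_cast hn1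
    have hκ : (1 : ℝ) ≤ κ n := by exact_mod_cast hκ1
    have hy1 : 1 ≤ √(κ n : ℝ) := by rwa [Real.one_le_sqrt]
    rw [← ofReal_norm, Real.norm_eq_abs]
    refine ENNReal.ofReal_le_ofReal ((SeriesLS.abs_mTilde_sub_mSum_le hA3 hA5 hbn
      (ζ := √Cz * √(κ n)) (fun x hx => by
        rw [← Real.sqrt_mul (by positivity)]
        exact Real.le_sqrt_of_sq_le (hzn x hx)) hx).trans ?_)
    have e1 : √(κ n : ℝ) * √(κ n / n) = (κ n : ℝ) / (n : ℝ) ^ (1 / 2 : ℝ) := by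
      rw [Real.sqrt_div (by positivity), ← mul_div_assoc, Real.mul_self_sqrt (by positivity),
        Real.sqrt_eq_rpow]
    -- The bias n^{-1/2} is also dominated by κ/√n, as κ ≥ 1.
    have e2 : (n : ℝ) ^ (-(1 / 2) : ℝ) ≤ (κ n : ℝ) / (n : ℝ) ^ (1 / 2 : ℝ) := by
      rw [Real.rpow_neg hn0.le, inv_eq_one_div]
      gcongr
    have e3 : 0 ≤ (κ n : ℝ) ^ (-(3 / 2) : ℝ) := by positivity
    calc (√Cz * √(κ n) + 1) * ‖θhat n ω - θ0 (κ n)‖ +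
          (1 + 2 ^ (d + 1)) * (B * (n : ℝ) ^ (-(1 / 2) : ℝ))
        ≤ (√Cz * √(κ n) + 1 * √(κ n)) * (L * √(κ n / n)) +
          (1 + 2 ^ (d + 1)) * (B * ((κ n : ℝ) / (n : ℝ) ^ (1 / 2 : ℝ))) := by
          gcongr
          · linarith
          · exact hω.1
      _ = ((√Cz + 1) * L + (1 + 2 ^ (d + 1)) * B) * ((κ n : ℝ) / (n : ℝ) ^ (1 / 2 : ℝ)) := by
          rw [← e1]; ring
      _ ≤ _ := by
          gcongr
          exact le_add_of_nonneg_right e3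
  · refine ⟨fun n ω => θhat n ω - θ0 (κ n) -
      Matrix.toEuclideanLin (M.Q (κ n))⁻¹ (M.score n (κ n) fun i => Z i ω) -
      Matrix.toEuclideanLin (M.Q (κ n))⁻¹ (M.biasScore n (κ n) (fun i => Z i ω) (θ0 (κ n))),
      fun n ω => ?_, ?_⟩
    · simp only [SeriesLS.Model.score, SeriesLS.Model.biasScore, map_smul]
      abel
    · refine SeriesLS.isBigOp_of_likely fun ε hε => ?_
      obtain ⟨L, hL, h⟩ := hrate ε hε
      refine ⟨L, hL.le, h.mono ?_⟩
      refine Eventually.of_forall fun n => Eventually.of_forall fun ω hω => ?_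
      rw [← ofReal_norm]
      refine ENNReal.ofReal_le_ofReal (hω.2.trans ?_)
      -- The remainder order yx² in the original notation; κ = 0 is treated apart because the power
      -- rule needs a positive base.
      have e1 : √(κ n : ℝ) * √(κ n / n) ^ 2 = (κ n : ℝ) ^ (3 / 2 : ℝ) / n := by
        rw [Real.sq_sqrt (by positivity), ← mul_div_assoc]
        congr 1
        rcases Nat.eq_zero_or_pos (κ n) with h0 | h0
        · rw [h0]; norm_num
        · have : (0 : ℝ) < κ n := by exact_mod_cast h0
          rw [Real.sqrt_eq_rpow]
          nth_rewrite 2 [← Real.rpow_one (κ n : ℝ)]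
          rw [← Real.rpow_add this]
          norm_num
      rw [e1]
      gcongr
      exact le_add_of_nonneg_right (by positivity)
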